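/- Let $\Phi\subset\mathfrak h^*$ be an irreducible reduced crystallographic root system over $\mathbb C$ (the root system of a simple, simply connected complex algebraic group), with simple roots $\{\alpha_i\}_{i\in I}$, highest root $\theta$, Weyl group $W$, coroot lattice $Q^\vee$, coweight lattice $P^\vee$ and fundamental coweights $\{\varpi_i^\vee\}_{i\in I}$; put $\varpi_0^\vee=0$, $\alpha_0=-\theta$. Let $W_{\mathrm{af}}=Q^\vee\rtimes W\subset\widetilde W_{\mathrm{af}}=P^\vee\rtimes W$, with translations $t_\lambda$, simple reflections $s_i$ ($i\in I$) and $s_0=t_{\theta^\vee}s_\theta$, and Coxeter length $\ell$ on $W_{\mathrm{af}}$. A node $s\in I_{\mathrm{af}}=I\cup\{0\}$ is special if it is the image of $0$ under an automorphism of the affine Dynkin diagram. For $s$ special let $u_s\in W$ be the shortest element with $u_s^{-1}(\varpi_s^\vee)$ anti-dominant, and $\pi_s=t_{\varpi_s^\vee}u_s$. Put $\Sigma=\{\pi_s\}$, so that $\widetilde W_{\mathrm{af}}=\Sigma\ltimes W_{\mathrm{af}}$, and $\ell(\sigma w)=\ell(w)$ for $\sigma\in\Sigma$, $w\in W_{\mathrm{af}}$.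 Let $W_{\mathrm{af}}^0$ (resp. $\widetilde W_{\mathrm{af}}^0$) be the set of $w\in W_{\mathrm{af}}$ (resp. $\widetilde W_{\mathrm{af}}$) of minimal length in $wW$. Let $S=\mathrm{Sym}(\mathfrak h^*)$ and $S^{\mathrm{reg}}=S[\alpha^{-1}:\alpha\in\Phi]$. Let $S^{\mathrm{reg}}[\widetilde W_{\mathrm{af}}]$ be the twisted group algebra for the level zero action (translations act trivially on $S^{\mathrm{reg}}$), with $(f\otimes v)(g\otimes w)=f\,v(g)\otimes vw$. Put $A_i=\alpha_i^{-1}(1-s_i)$ for $i\in I_{\mathrm{af}}$, $A_w=A_{i_1}\cdots A_{i_l}$ for a reduced expression $w=s_{i_1}\cdots s_{i_l}$ in $W_{\mathrm{af}}$, and $A_{\pi w}=\pi A_w$ for $\pi\in\Sigma$, $w\in W_{\mathrm{af}}$. The extended Peterson algebra $\widetilde{\mathbb P}$ is the centralizer of $S$ in $\widetilde{\mathbb A}=\sum_{w\in\widetilde W_{\mathrm{af}}}S A_w$. For $w\in\widetilde W_{\mathrm{af}}^0$, let $j_w$ be the unique element of $\widetilde{\mathbb P}$ of the form $A_w+\sum_{v\in\widetilde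 W_{\mathrm{af}}\setminus\widetilde W_{\mathrm{af}}^0}j_w^v A_v$ with $j_w^v\in S$. For $u\in W$ write $u(a)=u\,a\,u^{-1}$. For $i\in I$ let $i^s$ be the unique special node with $\varpi_i^\vee+Q^\vee=\varpi_{i^s}^\vee+Q^\vee$, and define $\kappa_i\in W_{\mathrm{af}}^0$ by $t_{-\varpi_i^\vee}=\pi_{i^s}^{-1}\kappa_i$. **Theorem.** The objects $i^s$, $u_{i^s}$, $\kappa_i$ and $j_w$ ($w\in\widetilde W_{\mathrm{af}}^0$) above are well defined: the special node $i^s$, the shortest element $u_{i^s}$ and the elements $j_w$ exist and are unique, and $\pi_{i^s}t_{-\varpi_i^\vee}\in W_{\mathrm{af}}^0$. Moreover, let $i\in I$ and let $v\in W_{\mathrm{af}}$ be such that $v\kappa_i\in W_{\mathrm{af}}^0$ and $\ell(v\kappa_i)=\ell(v)+\ell(\kappa_i)$. Then $\bar v:=\pi_{i^s}^{-1}v\,\pi_{i^s}\in W_{\mathrm{af}}^0$ and $$j_{v\kappa_i}=u_{i^s}(j_{\bar v})\,j_{\kappa_i}.$$ -/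

import Mathlib

noncomputable section

namespace AffineNilHecke

/-! Throughout, `P` is a root system with root space `M = 𝔥*` and coroot space `N = 𝔥`. -/

section Lattices

variable {ι M N : Type*} [AddCommGroup M] [Module ℂ M] [AddCommGroup N] [Module ℂ N]
  (P : RootPairing ι ℂ M N)

/-- The coweight lattice `P^∨ ⊆ 𝔥`: the elements pairing integrally with all roots. -/
def coweightLattice : AddSubgroup N where
  carrier := {h | ∀ j, ∃ n : ℤ, P.toLinearMap (P.root j) h = n}
  zero_mem' := fun _ => ⟨0, by simp⟩
  add_mem' := by
    intro x y hx hy j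
    obtain ⟨m, hm⟩ := hx j
    obtain ⟨n, hn⟩ := hy j
    exact ⟨m + n, by simp [hm, hn]⟩
  neg_mem' := by
    intro x hx j
    obtain ⟨m, hm⟩ := hx j
    exact ⟨-m, by simp [hm]⟩

/-- The coroot lattice `Q^∨ ⊆ 𝔥`. -/
def corootLattice : AddSubgroup N := AddSubgroup.closure (Set.range P.coroot)

lemma coroot_mem_coweightLattice [P.IsCrystallographic] (j : ι) :
    P.coroot j ∈ coweightLattice P := fun k => by
  obtain ⟨n, hn⟩ := P.exists_value (S := ℤ) k j
  exact ⟨n, by simpa using hn.symm⟩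

/-- The action of the Weyl group on `𝔥`, dual to its action on `𝔥*`. -/
def coAct (w : P.weylGroup) : N →+ N :=
  DistribSMul.toAddMonoidHom N (MulOpposite.op ((w⁻¹ : P.weylGroup) : P.Aut))

lemma coAct_apply (w : P.weylGroup) (h : N) :
    coAct P w h = RootPairing.Equiv.coweightEquiv P P ((w : P.Aut)⁻¹) h := rfl

lemma coAct_one (h : N) : coAct P 1 h = h := by
  simp [coAct]

lemma coAct_mul (v w : P.weylGroup) (h : N) :
    coAct P (v * w) h = coAct P v (coAct P w h) := by
  rw [coAct_apply, coAct_apply, coAct_apply, Subgroup.coe_mul, mul_inv_rev]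
  rfl

lemma pairing_coAct (w : P.weylGroup) (x : M) (h : N) :
    P.toLinearMap x (coAct P w h) = P.toLinearMap (w⁻¹ • x) h :=
  (LinearMap.congr_fun (LinearMap.congr_fun
    ((w : P.Aut)⁻¹).weight_coweight_transpose h) x).symm

lemma coAct_mem_coweightLattice (w : P.weylGroup) {h : N} (hh : h ∈ coweightLattice P) :
    coAct P w h ∈ coweightLattice P := fun j => by
  rw [pairing_coAct, RootPairing.weylGroup_apply_root]
  exact hh _

lemma coAct_coroot (w : P.weylGroup) (j : ι) :
    ∃ k, coAct P w (P.coroot j) = P.coroot k :=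
  ⟨_, congr_fun ((w : P.Aut)⁻¹).coroot_coweightMap j⟩

lemma coAct_mem_corootLattice (w : P.weylGroup) {h : N} (hh : h ∈ corootLattice P) :
    coAct P w h ∈ corootLattice P := by
  induction hh using AddSubgroup.closure_induction with
  | mem x hx =>
    obtain ⟨j, rfl⟩ := hx
    obtain ⟨k, hk⟩ := coAct_coroot P w j
    rw [hk]
    exact AddSubgroup.subset_closure ⟨k, rfl⟩
  | zero => rw [map_zero]; exact zero_mem _
  | add x y _ _ hx hy => rw [map_add]; exact add_mem hx hy
  | neg x _ hx => rw [map_neg]; exact neg_mem hx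

/-- The action of the Weyl group on the coweight lattice, written multiplicatively. -/
def coweightAction : P.weylGroup →* MulAut (Multiplicative (coweightLattice P)) where
  toFun w :=
    { toFun := fun t => Multiplicative.ofAdd
        ⟨coAct P w t.toAdd, coAct_mem_coweightLattice P w t.toAdd.2⟩
      invFun := fun t => Multiplicative.ofAdd
        ⟨coAct P w⁻¹ t.toAdd, coAct_mem_coweightLattice P w⁻¹ t.toAdd.2⟩
      left_inv := fun t => by
        apply Multiplicative.toAdd.injective
        apply Subtype.ext
        simp [← coAct_mul, coAct_one]
      right_inv := fun t => by
        apply Multiplicative.toAdd.injective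
        apply Subtype.ext
        simp [← coAct_mul, coAct_one]
      map_mul' := fun s t => by
        apply Multiplicative.toAdd.injective
        apply Subtype.ext
        simp }
  map_one' := by
    ext t
    simp [coAct_one]
  map_mul' v w := by
    ext t
    simp [coAct_mul]

lemma coweightAction_apply (w : P.weylGroup) (t : Multiplicative (coweightLattice P)) :
    ((coweightAction P w t).toAdd : N) = coAct P w t.toAdd := rfl

/-- The extended affine Weyl group `P^∨ ⋊ W`. -/
abbrev ExtWeyl : Type _ := Multiplicative (coweightLattice P) ⋊[coweightAction P] P.weylGroup

/-- The translation element `t_μ`, for `μ` in the coweight lattice. -/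
def translation (μ : coweightLattice P) : ExtWeyl P :=
  SemidirectProduct.inl (Multiplicative.ofAdd μ)

/-- The inclusion of the finite Weyl group. -/
def ofWeyl : P.weylGroup →* ExtWeyl P := SemidirectProduct.inr

/-- The affine Weyl group `Q^∨ ⋊ W`, as a subgroup of `P^∨ ⋊ W`. -/
def affineWeyl : Subgroup (ExtWeyl P) where
  carrier := {x | (x.left.toAdd : N) ∈ corootLattice P}
  one_mem' := zero_mem (corootLattice P)
  mul_mem' := by
    intro x y hx hy
    exact add_mem (S := AddSubgroup N) hx (coAct_mem_corootLattice P x.right hy)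
  inv_mem' := by
    intro x hx
    exact coAct_mem_corootLattice P x.right⁻¹ (neg_mem (S := AddSubgroup N) hx)

end Lattices

section NilHeckeRing

variable {ι M N : Type*} [AddCommGroup M] [Module ℂ M] [AddCommGroup N] [Module ℂ N]
  (P : RootPairing ι ℂ M N)

/-- `S = Sym(𝔥*)`, the equivariant cohomology ring of a point. -/
abbrev SRing (_ : RootPairing ι ℂ M N) : Type _ := SymmetricAlgebra ℂ M

/-- The root `α_j` as an element of `S`. -/
def rootS (j : ι) : SRing P := SymmetricAlgebra.ι ℂ M (P.root j)

/-- The multiplicative set generated by the roots. -/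
def rootMonoid : Submonoid (SRing P) := Submonoid.closure (Set.range (rootS P))

/-- `S^reg`, the localization of `S` at all roots. -/
def SReg : Type _ := Localization (rootMonoid P)

instance : CommRing (SReg P) := inferInstanceAs (CommRing (Localization (rootMonoid P)))

instance : Algebra (SRing P) (SReg P) :=
  inferInstanceAs (Algebra (SRing P) (Localization (rootMonoid P)))

instance : IsLocalization (rootMonoid P) (SReg P) :=
  inferInstanceAs (IsLocalization (rootMonoid P) (Localization (rootMonoid P)))

/-- The automorphism of `S` induced by a Weyl group element. -/
def symAct (w : P.weylGroup) : SRing P →ₐ[ℂ] SRing P :=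
  SymmetricAlgebra.lift
    (SymmetricAlgebra.ι ℂ M ∘ₗ (RootPairing.Equiv.weightEquiv P P (w : P.Aut)).toLinearMap)

lemma symAct_ι (w : P.weylGroup) (x : M) :
    symAct P w (SymmetricAlgebra.ι ℂ M x) = SymmetricAlgebra.ι ℂ M (w • x) := by
  rw [symAct, SymmetricAlgebra.lift_ι_apply]
  rfl

lemma symAct_one : symAct P 1 = AlgHom.id ℂ _ := by
  apply SymmetricAlgebra.algHom_ext
  ext x
  simp [symAct_ι]

lemma symAct_mul (v w : P.weylGroup) :
    symAct P (v * w) = (symAct P v).comp (symAct P w) := by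
  apply SymmetricAlgebra.algHom_ext
  ext x
  simp [symAct_ι, mul_smul]

lemma rootMonoid_le_comap (w : P.weylGroup) :
    rootMonoid P ≤ (rootMonoid P).comap (symAct P w : SRing P →+* SRing P) := by
  rw [rootMonoid, Submonoid.closure_le]
  rintro _ ⟨j, rfl⟩
  refine Submonoid.subset_closure ⟨P.weylGroupToPerm w j, ?_⟩
  rw [rootS, rootS, ← RootPairing.weylGroup_apply_root]
  exact (symAct_ι P w _).symm

/-- The automorphism of `S^reg` induced by a Weyl group element. -/
def regAct (w : P.weylGroup) : SReg P →+* SReg P :=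
  IsLocalization.map (SReg P) (symAct P w : SRing P →+* SRing P) (rootMonoid_le_comap P w)

lemma regAct_algebraMap (w : P.weylGroup) (f : SRing P) :
    regAct P w (algebraMap (SRing P) (SReg P) f) = algebraMap _ _ (symAct P w f) :=
  IsLocalization.map_eq _ _

lemma regAct_one : regAct P 1 = RingHom.id _ := by
  apply IsLocalization.ringHom_ext (rootMonoid P)
  ext f
  simp [regAct_algebraMap, symAct_one]

lemma regAct_mul (v w : P.weylGroup) :
    regAct P (v * w) = (regAct P v).comp (regAct P w) := by
  apply IsLocalization.ringHom_ext (rootMonoid P)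
  ext f
  simp [regAct_algebraMap, symAct_mul]

/-- The level zero action of the extended affine Weyl group on `S^reg`: translations act
trivially. -/
instance levelZeroAction : MulSemiringAction (ExtWeyl P) (SReg P) where
  smul x f := regAct P x.right f
  one_smul f := by
    change regAct P 1 f = f
    rw [regAct_one]; rfl
  mul_smul x y f := by
    change regAct P (x.right * y.right) f = regAct P x.right (regAct P y.right f)
    rw [regAct_mul]; rfl
  smul_zero x := map_zero (regAct P x.right)
  smul_add x := map_add (regAct P x.right)
  smul_one x := map_one (regAct P x.right)
  smul_mul x := map_mul (regAct P x.right)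

/-- The twisted group algebra `S^reg[P^∨ ⋊ W]`, with product
`(f ⊗ v) (g ⊗ w) = f v(g) ⊗ vw`. -/
abbrev TwistedAlg : Type _ := SkewMonoidAlgebra (SReg P) (ExtWeyl P)

/-- The group element `x` in the twisted group algebra. -/
def grp (x : ExtWeyl P) : TwistedAlg P := SkewMonoidAlgebra.single x 1

/-- The scalar `f` in the twisted group algebra. -/
def scalar (f : SReg P) : TwistedAlg P := SkewMonoidAlgebra.single 1 f

/-- The inverse of a root in `S^reg`. -/
def rootInv (j : ι) : SReg P :=
  IsLocalization.mk' (SReg P) (1 : SRing P)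
    (⟨rootS P j, Submonoid.subset_closure ⟨j, rfl⟩⟩ : rootMonoid P)

/-- The action of a finite Weyl group element on `S^reg[P^∨ ⋊ W]` by conjugation,
`u(a) = u a u⁻¹`. -/
def conj (u : P.weylGroup) (a : TwistedAlg P) : TwistedAlg P :=
  grp P (ofWeyl P u) * a * grp P (ofWeyl P u)⁻¹

end NilHeckeRing

lemma nonempty_index {ι M N : Type*} [AddCommGroup M] [Module ℂ M] [AddCommGroup N] [Module ℂ N]
    (P : RootPairing ι ℂ M N) [P.IsRootSystem] [P.IsIrreducible] : Nonempty ι := by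
  by_contra h
  rw [not_nonempty_iff] at h
  have h1 := RootPairing.IsRootSystem.span_root_eq_top (P := P)
  have h2 := RootPairing.IsIrreducible.nontrivial (P := P)
  rw [Set.range_eq_empty, Submodule.span_empty] at h1
  exact bot_ne_top h1

section Based

variable {ι M N : Type*} [AddCommGroup M] [Module ℂ M] [AddCommGroup N] [Module ℂ N]
  {P : RootPairing ι ℂ M N} [P.IsRootSystem] (b : P.Base)

/-- The fundamental coweight `ϖ_j^∨ ∈ 𝔥`, `j ∈ I`, dual to the simple roots. -/
def fundCoweightN (j : b.support) : N := P.flip.toPerfPair.symm (b.toWeightBasis.coord j)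

lemma fundCoweightN_mem (j : b.support) : fundCoweightN b j ∈ coweightLattice P := fun k => by
  have key : ∀ x : M, P.toLinearMap x (fundCoweightN b j) = b.toWeightBasis.coord j x := fun x =>
    LinearMap.congr_fun (P.flip.toPerfPair.apply_symm_apply (b.toWeightBasis.coord j)) x
  simp only [key]
  have hk := b.root_mem_span_int k
  generalize P.root k = y at hk
  induction hk using Submodule.span_induction with
  | mem x hx =>
    obtain ⟨l, hl, rfl⟩ := hx
    classical
    refine ⟨if (⟨l, hl⟩ : b.support) = j then 1 else 0, ?_⟩
    rw [Module.Basis.coord_apply, b.toWeightBasis_repr_root ⟨l, hl⟩, Finsupp.single_apply]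
    split_ifs <;> simp
  | zero => exact ⟨0, by simp⟩
  | add x y _ _ hx hy =>
    obtain ⟨m, hm⟩ := hx
    obtain ⟨n, hn⟩ := hy
    exact ⟨m + n, by rw [map_add, hm, hn]; push_cast; rfl⟩
  | smul a x _ hx =>
    obtain ⟨m, hm⟩ := hx
    exact ⟨a * m, by rw [map_zsmul, hm]; simp⟩

variable [Finite ι] [P.IsIrreducible]

lemma exists_highestRoot : ∃ j : ι, ∀ k, b.height k ≤ b.height j :=
  haveI := nonempty_index P
  Finite.exists_max _

/-- (The index of) the highest root `θ`, the root of maximal height. -/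
def highestRoot : ι := (exists_highestRoot b).choose

variable [P.IsCrystallographic]

/-- The set `I_af = I ∪ {0}` of affine Dynkin nodes; the node `0` is `none`. -/
abbrev AffineNode (b : P.Base) : Type _ := Option b.support

/-- (The index of) the classical projection of the simple affine root attached to a node:
`α_j` for `j ∈ I`, and `α_0 = -θ`. -/
def nodeRoot : AffineNode b → ι
  | some j => j
  | none => P.reflectionPerm (highestRoot b) (highestRoot b)

/-- The simple reflections: `s_j ∈ W` for `j ∈ I` and `s_0 = t_{θ^∨} s_θ`. -/
def simpleReflection : AffineNode b → ExtWeyl P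
  | some j => ofWeyl P (RootPairing.weylGroup.ofIdx P j)
  | none => translation P ⟨P.coroot (highestRoot b), coroot_mem_coweightLattice P _⟩ *
      ofWeyl P (RootPairing.weylGroup.ofIdx P (highestRoot b))

/-- The automorphisms of the affine Dynkin diagram: permutations of the nodes that preserve the
affine Cartan matrix. -/
def IsDiagramAut (σ : Equiv.Perm (AffineNode b)) : Prop :=
  ∀ j k, P.pairing (nodeRoot b (σ j)) (nodeRoot b (σ k)) = P.pairing (nodeRoot b j) (nodeRoot b k)

/-- The special nodes: the images of `0` under diagram automorphisms. -/
def IsSpecial (s : AffineNode b) : Prop := ∃ σ, IsDiagramAut b σ ∧ σ none = s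

/-- The fundamental coweight `ϖ_s^∨` attached to an affine node, where `ϖ_0^∨ = 0`. -/
def fundCoweight : AffineNode b → coweightLattice P
  | some j => ⟨fundCoweightN b j, fundCoweightN_mem b j⟩
  | none => 0

/-- `s` is the special node `i^s` attached to `i ∈ I`: `ϖ_i^∨ + Q^∨ = ϖ_s^∨ + Q^∨`. -/
def IsSpecialFor (i : b.support) (s : AffineNode b) : Prop :=
  IsSpecial b s ∧
    ((fundCoweight b (some i) : N) - (fundCoweight b s : N)) ∈ corootLattice P

/-- The special node `i^s`. -/
def specialNode (i : b.support) : AffineNode b := Classical.epsilon (IsSpecialFor b i)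

/-- The length function of the finite Weyl group. -/
def weylLength (w : P.weylGroup) : ℕ :=
  sInf {n | ∃ l : List b.support,
    l.length = n ∧ (l.map fun j => RootPairing.weylGroup.ofIdx P (j : ι)).prod = w}

/-- Anti-dominance of an element of `𝔥` in the coweight lattice. -/
def IsAntidominant (h : N) : Prop :=
  ∀ j : b.support, ∃ n : ℕ, P.toLinearMap (P.root j) h = -(n : ℂ)

/-- `u` is the shortest element of `W` such that `u⁻¹ ϖ_s^∨` is anti-dominant. -/
def IsShortestAntidominant (s : AffineNode b) (u : P.weylGroup) : Prop :=
  IsAntidominant b (coAct P u⁻¹ (fundCoweight b s)) ∧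
    ∀ u' : P.weylGroup, IsAntidominant b (coAct P u'⁻¹ (fundCoweight b s)) →
      weylLength b u ≤ weylLength b u'

/-- The element `u_s ∈ W`. -/
def uElt (s : AffineNode b) : P.weylGroup := Classical.epsilon (IsShortestAntidominant b s)

/-- The element `π_s = t_{ϖ_s^∨} u_s` of the extended affine Weyl group. -/
def piElt (s : AffineNode b) : ExtWeyl P := translation P (fundCoweight b s) * ofWeyl P (uElt b s)

/-- The group `Σ = {π_s : s special}`. -/
def sigmaSet : Set (ExtWeyl P) := {x | ∃ s, IsSpecial b s ∧ x = piElt b s}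

/-- The product of simple affine reflections along a word. -/
def wordProd (l : List (AffineNode b)) : ExtWeyl P := (l.map (simpleReflection b)).prod

/-- The (Coxeter) length function of the affine Weyl group. -/
def affLength (x : ExtWeyl P) : ℕ :=
  sInf {n | ∃ l : List (AffineNode b), l.length = n ∧ wordProd b l = x}

/-- The length function of the extended affine Weyl group: `ℓ(σ w) = ℓ(w)` for `σ ∈ Σ` and `w` in
the affine Weyl group. -/
def extLength (x : ExtWeyl P) : ℕ :=
  sInf {n | ∃ σ ∈ sigmaSet b, ∃ w ∈ affineWeyl P, x = σ * w ∧ affLength b w = n}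

/-- The affine Grassmannian elements `W_af^0` of the affine Weyl group. -/
def affGrassmannian : Set (ExtWeyl P) :=
  {x | x ∈ affineWeyl P ∧ ∀ u : P.weylGroup, affLength b x ≤ affLength b (x * ofWeyl P u)}

/-- The affine Grassmannian elements of the extended affine Weyl group. -/
def extGrassmannian : Set (ExtWeyl P) :=
  {x | ∀ u : P.weylGroup, extLength b x ≤ extLength b (x * ofWeyl P u)}

/-- The element `κ_i`, given by `t_{-ϖ_i^∨} = π_{i^s}⁻¹ κ_i`. -/
def kappa (i : b.support) : ExtWeyl P :=
  piElt b (specialNode b i) * translation P (-fundCoweight b (some i))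

/-- `A_s = α_s⁻¹ (1 - s_s)` for an affine node `s`. -/
def nilGen (s : AffineNode b) : TwistedAlg P :=
  scalar P (rootInv P (nodeRoot b s)) * (1 - grp P (simpleReflection b s))

/-- A reduced expression of an element of the affine Weyl group. -/
def reducedWord (x : ExtWeyl P) : List (AffineNode b) :=
  Classical.epsilon fun l => wordProd b l = x ∧ l.length = affLength b x

/-- `A_w` for `w` in the affine Weyl group: the product of the `A_s` along a reduced expression
of `w` (it does not depend on the reduced expression, by the braid relations). -/
def nilAff (x : ExtWeyl P) : TwistedAlg P := ((reducedWord b x).map (nilGen b)).prod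

/-- The decomposition `x = π v` with `π ∈ Σ` and `v` in the affine Weyl group. -/
def decomp (x : ExtWeyl P) : ExtWeyl P × ExtWeyl P :=
  Classical.epsilon fun p => p.1 ∈ sigmaSet b ∧ p.2 ∈ affineWeyl P ∧ x = p.1 * p.2

/-- `A_{π v} = π A_v` for `π ∈ Σ` and `v` in the affine Weyl group. -/
def nilExt (x : ExtWeyl P) : TwistedAlg P := grp P (decomp b x).1 * nilAff b (decomp b x).2

/-- The level zero extended affine nil-Hecke algebra `∑ S A_w`, a left `S`-submodule of the
twisted group algebra. -/
def nilHecke : Submodule (SRing P) (TwistedAlg P) :=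
  Submodule.span (SRing P) (Set.range (nilExt b))

/-- The extended Peterson algebra: the centralizer of `S` in the extended affine nil-Hecke
algebra. -/
def peterson : Set (TwistedAlg P) :=
  {a | a ∈ nilHecke b ∧ ∀ f : SRing P,
    a * scalar P (algebraMap (SRing P) (SReg P) f) = scalar P (algebraMap (SRing P) (SReg P) f) * a}

/-- `a` is the Schubert basis element `j_w`: it lies in the extended Peterson algebra and it is
`A_w` plus an `S`-linear combination of `A_v` with `v` not affine Grassmannian. -/
def IsSchubert (w : ExtWeyl P) (a : TwistedAlg P) : Prop :=
  a ∈ peterson b ∧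
    a - nilExt b w ∈ Submodule.span (SRing P) (nilExt b '' (extGrassmannian b)ᶜ)

/-- The Schubert basis element `j_w` of the extended Peterson algebra. -/
def jElt (w : ExtWeyl P) : TwistedAlg P := Classical.epsilon (IsSchubert b w)

/-- `v̄ = π_{i^s}⁻¹ v π_{i^s}`. -/
def bar (i : b.support) (v : ExtWeyl P) : ExtWeyl P :=
  (piElt b (specialNode b i))⁻¹ * v * piElt b (specialNode b i)

end Based

end AffineNilHecke

end

open AffineNilHecke

/-!
An element of length zero permutes the simple affine roots, so `π A_v = A_{π v π⁻¹} π` for `π ∈ Σ`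
and `v ∈ W_af`; with `v κ_i = π_{i^s} v̄ t_{-ϖ_i^∨}` this gives
`A_{v κ_i} = π_{i^s} A_{v̄} A_{t_{-ϖ_i^∨}}`.

Let `p` be the projection `f ⊗ t_μ u ↦ f ⊗ t_μ` of the twisted group algebra onto the commutative
algebra spanned by the translations. It satisfies `p(a c) = p(a p(c))`, it fixes the centralizer
of `S`, and it kills `A_v` unless `v` is of minimal length in `v W`, because then `A_v` ends with
some `A_j`, `j ∈ I`. Hence `j_w = p(A_w)`.

For `j ∈ I` the product `A_j A_{t_{-ϖ_i^∨}}` either vanishes or is again of the form `a A_j`, so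
`p` kills it. It follows that `p(A_{t_{-ϖ_i^∨}})` commutes with `W`, whence
`p(a A_{t_{-ϖ_i^∨}}) = p(a) p(A_{t_{-ϖ_i^∨}})` for every `a`. Applying `p` to the formula for
`A_{v κ_i}`, the factor `π_{i^s}` contributes a translation, which is absorbed into `j_{κ_i}`, and
conjugation by `u_{i^s}`.
-/

namespace AffineNilHecke

section Words

variable {G J : Type*} [Group G] (s : J → G)

/-- The product of a family of group elements along a word in its index set. -/
def genProd (l : List J) : G := (l.map s).prod

/-- The word length of a group element with respect to a family of generators; the junk value `0`
is taken outside the submonoid generated by the family. -/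
noncomputable def genLength (x : G) : ℕ :=
  sInf {n | ∃ l : List J, l.length = n ∧ genProd s l = x}

/-- A word is reduced if no shorter word has the same product. -/
def IsReduced (l : List J) : Prop := genLength s (genProd s l) = l.length

/-- The alternating word `i j i j …` with a prescribed number of letters. -/
def altWord (i j : J) : ℕ → List J
  | 0 => []
  | n + 1 => i :: altWord j i n

@[simp] lemma length_altWord (i j : J) (n : ℕ) : (altWord i j n).length = n := by
  induction n generalizing i j with
  | zero => rfl
  | succ n ih => simp [altWord, ih]

@[simp] lemma genProd_nil : genProd s [] = 1 := rfl

@[simp] lemma genProd_cons (j : J) (l : List J) :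
    genProd s (j :: l) = s j * genProd s l := by simp [genProd]

@[simp] lemma genProd_append (l l' : List J) :
    genProd s (l ++ l') = genProd s l * genProd s l' := by simp [genProd]

lemma genProd_mem_closure (l : List J) : genProd s l ∈ Submonoid.closure (Set.range s) :=
  Submonoid.list_prod_mem _ <| List.forall_mem_map.2 fun j _ => Submonoid.subset_closure ⟨j, rfl⟩

variable {s}

lemma gen_mem_closure (j : J) : s j ∈ Submonoid.closure (Set.range s) :=
  Submonoid.subset_closure ⟨j, rfl⟩

lemma mem_closure_range_iff_exists_genProd {x : G} :
    x ∈ Submonoid.closure (Set.range s) ↔ ∃ l, genProd s l = x := by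
  refine ⟨fun hx => ?_, fun ⟨l, hl⟩ => hl ▸ genProd_mem_closure s l⟩
  induction hx using Submonoid.closure_induction with
  | mem x hx => obtain ⟨j, rfl⟩ := hx; exact ⟨[j], by simp⟩
  | one => exact ⟨[], rfl⟩
  | mul x y _ _ hx hy =>
    obtain ⟨l, rfl⟩ := hx
    obtain ⟨l', rfl⟩ := hy
    exact ⟨l ++ l', by simp⟩

variable (s) in
lemma genLength_genProd_le (l : List J) : genLength s (genProd s l) ≤ l.length :=
  Nat.sInf_le ⟨l, rfl, rfl⟩

lemma exists_isReduced {x : G} (hx : x ∈ Submonoid.closure (Set.range s)) :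
    ∃ l, genProd s l = x ∧ l.length = genLength s x := by
  obtain ⟨l, hl⟩ := mem_closure_range_iff_exists_genProd.1 hx
  obtain ⟨l', h, h'⟩ := Nat.sInf_mem (s := {n | ∃ l : List J, l.length = n ∧ genProd s l = x})
    ⟨_, l, rfl, hl⟩
  exact ⟨l', h', h⟩

variable (s) in
lemma genLength_one : genLength s 1 = 0 :=
  Nat.le_zero.1 (genLength_genProd_le s [])

lemma genLength_mul_le {x y : G} (hx : x ∈ Submonoid.closure (Set.range s))
    (hy : y ∈ Submonoid.closure (Set.range s)) :
    genLength s (x * y) ≤ genLength s x + genLength s y := by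
  obtain ⟨l, rfl, hl⟩ := exists_isReduced hx
  obtain ⟨l', rfl, hl'⟩ := exists_isReduced hy
  rw [← hl, ← hl', ← genProd_append, ← List.length_append]
  exact genLength_genProd_le s _

namespace IsReduced

lemma of_genProd_eq {l l' : List J} (hl : IsReduced s l) (h : genProd s l = genProd s l')
    (hlen : l.length = l'.length) : IsReduced s l' := by
  rw [IsReduced, ← h, hl, hlen]

lemma append {l l' : List J} (h : IsReduced s (l ++ l')) : IsReduced s l ∧ IsReduced s l' := by
  have hle := genLength_mul_le (genProd_mem_closure s l) (genProd_mem_closure s l')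
  rw [← genProd_append, h, List.length_append] at hle
  have hl := genLength_genProd_le s l
  have hl' := genLength_genProd_le s l'
  exact ⟨by unfold IsReduced; omega, by unfold IsReduced; omega⟩

end IsReduced

end Words

section RootedGenerators

variable {G R J : Type*} [Group G] [MulAction G R]

/-- Involutive generators `s j` of a group acting on a set of roots, with simple roots `a j`, such
that the only positive root made negative by `s j` is `a j`. The field `pos_smul_neg` encodes
`s j • a j = -a j` without assuming that `R` has a negation. -/
structure RootedGenerators (pos : R → Prop) (a : J → R) (s : J → G) : Prop where
  mul_self : ∀ j, s j * s j = 1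
  pos_simple : ∀ j, pos (a j)
  pos_smul_neg : ∀ (x : G) (j : J), pos (x • s j • a j) ↔ ¬ pos (x • a j)
  pos_smul : ∀ j r, pos r → r ≠ a j → pos (s j • r)
  mul_eq_mul : ∀ (x : G) (j k : J), x • a j = a k → x * s j = s k * x

namespace RootedGenerators

variable {pos : R → Prop} {a : J → R} {s : J → G} (h : RootedGenerators pos a s)
include h

lemma comp {K : Type*} (f : K → J) : RootedGenerators pos (a ∘ f) (s ∘ f) where
  mul_self _ := h.mul_self _
  pos_simple _ := h.pos_simple _
  pos_smul_neg x _ := h.pos_smul_neg x _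
  pos_smul _ := h.pos_smul _
  mul_eq_mul x _ _ := h.mul_eq_mul x _ _

lemma inv_eq (j : J) : (s j)⁻¹ = s j := inv_eq_of_mul_eq_one_right (h.mul_self j)

lemma mul_cancel_left (j : J) (x : G) : s j * (s j * x) = x := by
  rw [← mul_assoc, h.mul_self, one_mul]

lemma mul_cancel_right (j : J) (x : G) : x * s j * s j = x := by
  rw [mul_assoc, h.mul_self, mul_one]

lemma genProd_reverse (l : List J) : genProd s l.reverse = (genProd s l)⁻¹ := by
  induction l with
  | nil => simp
  | cons j l ih => simp [ih, h.inv_eq]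

lemma inv_mem_closure {x : G} (hx : x ∈ Submonoid.closure (Set.range s)) :
    x⁻¹ ∈ Submonoid.closure (Set.range s) := by
  obtain ⟨l, rfl⟩ := mem_closure_range_iff_exists_genProd.1 hx
  exact h.genProd_reverse l ▸ genProd_mem_closure s _

lemma eq_simple {j : J} {r : R} (hr : pos r) (hn : ¬ pos (s j • r)) : r = a j :=
  not_imp_comm.1 (h.pos_smul j r hr) hn

lemma not_pos_smul_simple (j : J) : ¬ pos (s j • a j) := by
  have hneg := h.pos_smul_neg 1 j
  rw [one_smul, one_smul] at hneg
  exact fun hp => hneg.1 hp (h.pos_simple j)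

lemma ne_one (j : J) : s j ≠ 1 := fun h1 =>
  h.not_pos_smul_simple j (by rw [h1, one_smul]; exact h.pos_simple j)

lemma pos_mul_smul_simple (x : G) (j : J) : pos ((x * s j) • a j) ↔ ¬ pos (x • a j) := by
  rw [mul_smul, h.pos_smul_neg]

lemma simple_eq_of_eq {i j : J} (hij : s i = s j) : a i = a j :=
  (h.eq_simple (h.pos_simple i) (hij ▸ h.not_pos_smul_simple i))

lemma exchange_right (l : List J) (j : J) (hn : ¬ pos (genProd s l • a j)) :
    ∃ l₁ k l₂, l = l₁ ++ k :: l₂ ∧ genProd s l * s j = genProd s (l₁ ++ l₂) := by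
  induction l with
  | nil => simp [h.pos_simple] at hn
  | cons k l ih =>
    by_cases hp : pos (genProd s l • a j)
    · rw [genProd_cons, mul_smul] at hn
      have hcomm := h.mul_eq_mul _ _ _ (h.eq_simple hp hn)
      exact ⟨[], k, l, rfl, by rw [genProd_cons, mul_assoc, hcomm, h.mul_cancel_left]; rfl⟩
    · obtain ⟨l₁, p, l₂, rfl, hdel⟩ := ih hp
      exact ⟨k :: l₁, p, l₂, rfl, by rw [genProd_cons, mul_assoc, hdel]; simp⟩

lemma exchange_left (l : List J) (j : J) (hn : ¬ pos ((genProd s l)⁻¹ • a j)) :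
    ∃ l₁ k l₂, l = l₁ ++ k :: l₂ ∧ s j * genProd s l = genProd s (l₁ ++ l₂) := by
  rw [← h.genProd_reverse] at hn
  obtain ⟨l₁, k, l₂, hl, hdel⟩ := h.exchange_right _ _ hn
  refine ⟨l₂.reverse, k, l₁.reverse, ?_, ?_⟩
  · rw [← l.reverse_reverse, hl]; simp
  · rw [← inv_inj, mul_inv_rev, h.inv_eq, ← h.genProd_reverse, hdel, ← h.genProd_reverse]; simp

lemma genLength_inv {x : G} (hx : x ∈ Submonoid.closure (Set.range s)) :
    genLength s x⁻¹ = genLength s x := by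
  have inv_le : ∀ y ∈ Submonoid.closure (Set.range s), genLength s y⁻¹ ≤ genLength s y := by
    intro y hy
    obtain ⟨l, rfl, hl⟩ := exists_isReduced hy
    rw [← hl, ← h.genProd_reverse, ← l.length_reverse]
    exact genLength_genProd_le s _
  refine le_antisymm (inv_le x hx) ?_
  simpa using inv_le x⁻¹ (h.inv_mem_closure hx)

lemma genLength_mul_of_not_pos {x : G} (hx : x ∈ Submonoid.closure (Set.range s)) {j : J}
    (hn : ¬ pos (x • a j)) : genLength s (x * s j) + 1 = genLength s x := by
  have hle : genLength s x ≤ genLength s (x * s j) + genLength s (s j) := by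
    simpa [h.mul_cancel_right] using genLength_mul_le (mul_mem hx (gen_mem_closure j))
      (gen_mem_closure (s := s) j)
  have hgen : genLength s (s j) ≤ 1 := by simpa using genLength_genProd_le s [j]
  obtain ⟨l, rfl, hl⟩ := exists_isReduced hx
  obtain ⟨l₁, k, l₂, rfl, hdel⟩ := h.exchange_right l j hn
  have hdel_le := genLength_genProd_le s (l₁ ++ l₂)
  simp only [List.length_append, List.length_cons] at hl hdel_le
  rw [hdel] at hle ⊢
  omega

lemma genLength_mul_of_pos {x : G} (hx : x ∈ Submonoid.closure (Set.range s)) {j : J}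
    (hp : pos (x • a j)) : genLength s (x * s j) = genLength s x + 1 := by
  have hlen := h.genLength_mul_of_not_pos (mul_mem hx (gen_mem_closure j)) (j := j)
    (by rw [h.pos_mul_smul_simple]; exact not_not.2 hp)
  rw [h.mul_cancel_right] at hlen
  exact hlen.symm

lemma genLength_simple (j : J) : genLength s (s j) = 1 := by
  have hlen := h.genLength_mul_of_pos (one_mem _) (j := j) (by simpa using h.pos_simple j)
  rwa [one_mul, genLength_one] at hlen

lemma genLength_simple_mul {x : G} (hx : x ∈ Submonoid.closure (Set.range s)) (j : J) :
    genLength s (s j * x) = genLength s (x⁻¹ * s j) := by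
  rw [← h.genLength_inv (mul_mem (gen_mem_closure j) hx), mul_inv_rev, h.inv_eq]

lemma genLength_simple_mul_of_not_pos {x : G} (hx : x ∈ Submonoid.closure (Set.range s)) {j : J}
    (hn : ¬ pos (x⁻¹ • a j)) : genLength s (s j * x) + 1 = genLength s x := by
  rw [h.genLength_simple_mul hx, h.genLength_mul_of_not_pos (h.inv_mem_closure hx) hn,
    h.genLength_inv hx]

lemma genLength_simple_mul_of_pos {x : G} (hx : x ∈ Submonoid.closure (Set.range s)) {j : J}
    (hp : pos (x⁻¹ • a j)) : genLength s (s j * x) = genLength s x + 1 := by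
  rw [h.genLength_simple_mul hx, h.genLength_mul_of_pos (h.inv_mem_closure hx) hp,
    h.genLength_inv hx]

lemma pos_smul_simple_of_genLength_mul {x y : G} (hx : x ∈ Submonoid.closure (Set.range s))
    (hy : y ∈ Submonoid.closure (Set.range s))
    (hxy : genLength s (x * y) = genLength s x + genLength s y) {j : J}
    (hn : ¬ pos (y⁻¹ • a j)) : pos (x • a j) := by
  by_contra hneg
  have hx_len := h.genLength_mul_of_not_pos hx hneg
  have hy_len := h.genLength_simple_mul_of_not_pos hy hn
  have hle := genLength_mul_le (mul_mem hx (gen_mem_closure j)) (mul_mem (gen_mem_closure j) hy)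
  rw [mul_assoc, h.mul_cancel_left] at hle
  omega

lemma exists_not_pos_smul_simple {x : G} (hx : x ∈ Submonoid.closure (Set.range s))
    (hx1 : x ≠ 1) : ∃ j, ¬ pos (x • a j) := by
  obtain ⟨l, rfl, hl⟩ := exists_isReduced hx
  rcases List.eq_nil_or_concat' l with rfl | ⟨l', j, rfl⟩
  · exact absurd rfl hx1
  · refine ⟨j, fun hp => ?_⟩
    have hup := h.genLength_mul_of_pos hx hp
    have hle := genLength_genProd_le s l'
    rw [← hl] at hup
    simp only [genProd_append, genProd_cons, genProd_nil, mul_one, h.mul_cancel_right,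
      List.length_append, List.length_singleton] at hup
    omega

lemma eq_one_of_forall_pos {x : G} (hx : x ∈ Submonoid.closure (Set.range s))
    (hp : ∀ j, pos (x • a j)) : x = 1 := by
  by_contra hx1
  obtain ⟨j, hj⟩ := h.exists_not_pos_smul_simple hx hx1
  exact hj (hp j)

lemma image_inversions_ssubset (x : G) {j : J} (hj : ¬ pos (x • a j)) :
    (s j • ·) '' {r | pos r ∧ ¬ pos ((x * s j) • r)} ⊂ {r | pos r ∧ ¬ pos (x • r)} := by
  refine (Set.ssubset_iff_of_subset ?_).2 ⟨a j, ⟨h.pos_simple j, hj⟩, ?_⟩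
  · rintro _ ⟨r, ⟨hr, hr'⟩, rfl⟩
    refine ⟨h.pos_smul j r hr ?_, by rwa [← mul_smul]⟩
    rintro rfl
    exact hr' ((h.pos_mul_smul_simple x j).2 hj)
  · rintro ⟨r, ⟨hr, -⟩, hr' : s j • r = a j⟩
    have hr_eq : r = s j • a j := by rw [← hr', ← mul_smul, h.mul_self, one_smul]
    exact h.not_pos_smul_simple j (hr_eq ▸ hr)

lemma exists_forall_pos_mul_genProd (x : G) (hx : {r | pos r ∧ ¬ pos (x • r)}.Finite) :
    ∃ l, ∀ j, pos ((x * genProd s l) • a j) := by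
  generalize hn : {r | pos r ∧ ¬ pos (x • r)}.ncard = n
  induction n using Nat.strong_induction_on generalizing x with
  | _ n ih =>
    by_cases hp : ∀ j, pos (x • a j)
    · exact ⟨[], by simpa using hp⟩
    push Not at hp
    obtain ⟨j, hj⟩ := hp
    have hsub := h.image_inversions_ssubset x hj
    have hinj : Function.Injective ((s j • ·) : R → R) := MulAction.injective _
    have hlt := Set.ncard_lt_ncard hsub hx
    rw [Set.ncard_image_of_injective _ hinj, hn] at hlt
    obtain ⟨l, hl⟩ := ih _ hlt (x * s j)
      ((hx.subset hsub.subset).of_finite_image hinj.injOn) rfl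
    exact ⟨j :: l, by simpa [mul_assoc] using hl⟩

end RootedGenerators

end RootedGenerators

section Matsumoto

variable {G R J A : Type*} [Group G] [MulAction G R] [Monoid A]

/-- The family `F` satisfies the braid relations of the generators `s`: its products along the two
alternating words in two letters agree whenever these words are reduced words of one element. -/
def SatisfiesBraidRelations (s : J → G) (F : J → A) : Prop :=
  ∀ i j m, i ≠ j → genProd s (altWord i j m) = genProd s (altWord j i m) →
    IsReduced s (altWord i j m) → ((altWord i j m).map F).prod = ((altWord j i m).map F).prod

/-- The products of the family `F` along two reduced words with `n` letters agree as soon as the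
products of the generators `s` do: the inductive statement in Matsumoto's theorem. -/
def ReducedProdsAgree (s : J → G) (F : J → A) (n : ℕ) : Prop :=
  ∀ l l' : List J, l.length = n → l'.length = n → IsReduced s l → genProd s l = genProd s l' →
    (l.map F).prod = (l'.map F).prod

variable {s : J → G} {F : J → A} {n : ℕ}

lemma ReducedProdsAgree.cons (hn : ReducedProdsAgree s F n) {i : J} {l l' : List J}
    (hl : l.length = n) (hl' : l'.length = n) (hr : IsReduced s (i :: l))
    (he : genProd s (i :: l) = genProd s (i :: l')) :
    ((i :: l).map F).prod = ((i :: l').map F).prod := by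
  rw [genProd_cons, genProd_cons, mul_right_inj] at he
  simp [hn l l' hl hl' (hr.append (l := [i])).2 he]

lemma ReducedProdsAgree.concat (hn : ReducedProdsAgree s F n) {i : J} {l l' : List J}
    (hl : l.length = n) (hl' : l'.length = n) (hr : IsReduced s (l ++ [i]))
    (he : genProd s (l ++ [i]) = genProd s (l' ++ [i])) :
    ((l ++ [i]).map F).prod = ((l' ++ [i]).map F).prod := by
  rw [genProd_append, genProd_append, mul_left_inj] at he
  simp [hn l l' hl hl' hr.append.1 he]

namespace RootedGenerators

variable {pos : R → Prop} {a : J → R} (h : RootedGenerators pos a s)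
include h

lemma not_pos_of_genProd_eq_cons {l l' : List J} {j : J} (hlen : l.length = l'.length + 1)
    (hr : IsReduced s l) (he : genProd s l = genProd s (j :: l')) :
    ¬ pos ((genProd s l)⁻¹ • a j) := by
  intro hp
  have hup := h.genLength_simple_mul_of_pos (genProd_mem_closure s l) hp
  rw [hr, he, genProd_cons, h.mul_cancel_left] at hup
  have hle := genLength_genProd_le s l'
  omega

lemma exchange_first_letter (hn : ReducedProdsAgree s F n) {l l' : List J} {j z : J}
    (hl : l.length = n) (hl' : l'.length = n) (hr : IsReduced s (l ++ [z]))
    (he : genProd s (l ++ [z]) = genProd s (j :: l')) :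
    ((l ++ [z]).map F).prod = ((j :: l').map F).prod ∨
      genProd s (j :: l) = genProd s (l ++ [z]) ∧
        ((j :: l).map F).prod = ((j :: l').map F).prod := by
  obtain ⟨l₁, k, l₂, hsplit, hdel⟩ := h.exchange_left (l ++ [z]) j
    (h.not_pos_of_genProd_eq_cons (by simp [hl, hl']) hr he)
  have hprod : genProd s (j :: (l₁ ++ l₂)) = genProd s (l ++ [z]) := by
    rw [genProd_cons, ← hdel, h.mul_cancel_left]
  have hlen : (l₁ ++ l₂).length = n := by
    have := congrArg List.length hsplit
    simp only [List.length_append, List.length_cons, List.length_nil] at this ⊢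
    omega
  have hF := hn.cons (i := j) hlen hl' (hr.of_genProd_eq hprod.symm (by simp [hl, hlen]))
    (hprod.trans he)
  rcases List.eq_nil_or_concat' l₂ with rfl | ⟨l₃, z', rfl⟩
  · obtain ⟨rfl, -⟩ := List.append_inj' hsplit rfl
    simp only [List.append_nil] at hprod hF
    exact .inr ⟨hprod, hF⟩
  · left
    simp only [← List.append_assoc, ← List.cons_append] at hsplit hprod hF
    obtain ⟨rfl, hz⟩ := List.append_inj' hsplit rfl
    obtain rfl : z = z' := by simpa using hz
    rw [← hF]
    exact hn.concat hl (by simp at hl ⊢; omega) hr hprod.symm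

lemma prod_map_altWord_append_eq (hb : SatisfiesBraidRelations s F)
    (hn : ReducedProdsAgree s F n) {i j : J} (hij : i ≠ j) (k : ℕ) (t t' : List J)
    (ht : t.length + k = n) (ht' : t'.length = t.length)
    (hr : IsReduced s (altWord i j (k + 1) ++ t))
    (he : genProd s (altWord i j (k + 1) ++ t) = genProd s (altWord j i (k + 1) ++ t')) :
    ((altWord i j (k + 1) ++ t).map F).prod = ((altWord j i (k + 1) ++ t').map F).prod := by
  induction hd : t.length generalizing k t t' with
  | zero =>
    obtain rfl := List.length_eq_zero_iff.1 hd
    obtain rfl := List.length_eq_zero_iff.1 (ht'.trans hd)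
    simp only [List.append_nil] at *
    exact hb i j _ hij he hr
  | succ d ih =>
    obtain ⟨t, z, rfl⟩ := (List.eq_nil_or_concat' t).resolve_left (by rintro rfl; simp at hd)
    obtain ⟨t', z', rfl⟩ := (List.eq_nil_or_concat' t').resolve_left
      (by rintro rfl; simp at ht')
    simp only [List.length_append, List.length_singleton] at ht ht' hd
    simp only [← List.append_assoc] at *
    have hr' := hr.of_genProd_eq he (by simp; omega)
    rcases h.exchange_first_letter hn (j := j) (l' := altWord i j k ++ t' ++ [z'])
      (by simp; omega) (by simp; omega) hr he with hF | ⟨hprod, hF⟩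
    · exact hF
    rcases h.exchange_first_letter hn (j := i) (l' := altWord j i k ++ t ++ [z])
      (by simp; omega) (by simp; omega) hr' he.symm with hF' | ⟨hprod', hF'⟩
    · exact hF'.symm
    exact hF'.symm.trans ((ih (k + 1) t' t (by omega) (by omega)
      (hr'.of_genProd_eq hprod'.symm (by simp; omega))
      (hprod'.trans (he.symm.trans hprod.symm)) (by omega)).trans hF)

lemma reducedProdsAgree_succ (hb : SatisfiesBraidRelations s F) (hn : ReducedProdsAgree s F n) :
    ReducedProdsAgree s F (n + 1) := by
  intro l l' hl hl' hr he
  obtain ⟨i, t, rfl⟩ := List.exists_cons_of_length_eq_add_one hl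
  obtain ⟨j, t', rfl⟩ := List.exists_cons_of_length_eq_add_one hl'
  rw [List.length_cons, add_left_inj] at hl hl'
  by_cases hij : i = j
  · subst hij
    exact hn.cons hl hl' hr he
  · exact h.prod_map_altWord_append_eq hb hn hij 0 t t' hl (hl'.trans hl.symm) hr he

theorem prod_map_eq_of_isReduced (hb : SatisfiesBraidRelations s F) {l l' : List J}
    (hl : IsReduced s l) (hl' : IsReduced s l') (he : genProd s l = genProd s l') :
    (l.map F).prod = (l'.map F).prod := by
  have agree : ∀ n, ReducedProdsAgree s F n := by
    intro n
    induction n with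
    | zero =>
      intro l l' hl hl' _ _
      rw [List.length_eq_zero_iff.1 hl, List.length_eq_zero_iff.1 hl']
    | succ n ih => exact h.reducedProdsAgree_succ hb ih
  exact agree _ l l' rfl (by rw [← hl, ← hl', he]) hl he

end RootedGenerators

end Matsumoto

section WeylAction

open RootPairing

variable {ι M N : Type*} [AddCommGroup M] [Module ℂ M] [AddCommGroup N] [Module ℂ N]
  {P : RootPairing ι ℂ M N}

instance : SMulCommClass P.weylGroup ℂ M where
  smul_comm w := smul_comm (w : P.Aut)

lemma weyl_ext {v w : P.weylGroup} (h : ∀ m : M, v • m = w • m) : v = w :=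
  Subtype.ext <| RootPairing.Equiv.weightHom_injective P <| LinearEquiv.ext h

lemma ofIdx_smul (k : ι) (m : M) :
    weylGroup.ofIdx P k • m = m - P.toLinearMap m (P.coroot k) • P.root k :=
  P.reflection_apply k m

lemma ofIdx_smul_root (j k : ι) :
    weylGroup.ofIdx P j • P.root k = P.root (P.reflectionPerm j k) :=
  (P.root_reflectionPerm j k).symm

lemma ofIdx_mul_self (k : ι) : weylGroup.ofIdx P k * weylGroup.ofIdx P k = 1 :=
  weyl_ext fun m => by rw [mul_smul, one_smul]; exact P.reflection_same k m

lemma pairing_smul_coAct (w : P.weylGroup) (m : M) (h : N) :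
    P.toLinearMap (w • m) (coAct P w h) = P.toLinearMap m h := by
  rw [pairing_coAct, inv_smul_smul]

lemma coAct_inv_coAct (w : P.weylGroup) (h : N) : coAct P w⁻¹ (coAct P w h) = h := by
  rw [← coAct_mul, inv_mul_cancel, coAct_one]

lemma coAct_coroot_eq (w : P.weylGroup) (k : ι) :
    coAct P w (P.coroot k) = P.coroot (P.weylGroupToPerm w k) :=
  congr_fun ((w : P.Aut)⁻¹).coroot_coweightMap k

lemma coAct_ofIdx (k : ι) (h : N) :
    coAct P (weylGroup.ofIdx P k) h = h - P.toLinearMap (P.root k) h • P.coroot k := by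
  have hinv : (weylGroup.ofIdx P k : P.Aut)⁻¹ = RootPairing.Equiv.reflection P k :=
    RootPairing.Equiv.reflection_inv P k
  rw [coAct_apply, hinv, RootPairing.Equiv.reflection_coweightEquiv, coreflection_apply]

lemma pairing_smul_coroot {w : P.weylGroup} {j k : ι} (h : w • P.root j = P.root k) (m : M) :
    P.toLinearMap (w • m) (P.coroot k) = P.toLinearMap m (P.coroot j) := by
  rw [weylGroup_apply_root] at h
  rw [← P.root.injective h, ← coAct_coroot_eq, pairing_smul_coAct]

lemma mul_ofIdx {w : P.weylGroup} {i k : ι} (h : w • P.root i = P.root k) :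
    w * weylGroup.ofIdx P i = weylGroup.ofIdx P k * w := by
  refine weyl_ext fun m => ?_
  rw [mul_smul, mul_smul, ofIdx_smul, ofIdx_smul, smul_sub, smul_comm w, h, pairing_smul_coroot h]

lemma ofIdx_reflectionPerm (j k : ι) :
    weylGroup.ofIdx P (P.reflectionPerm j k) =
      weylGroup.ofIdx P j * weylGroup.ofIdx P k * weylGroup.ofIdx P j := by
  rw [mul_ofIdx (ofIdx_smul_root j k), mul_assoc, ofIdx_mul_self, mul_one]

lemma cast_pairingIn [P.IsCrystallographic] (i j : ι) :
    ((P.pairingIn ℤ i j : ℤ) : ℂ) = P.pairing i j :=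
  P.algebraMap_pairingIn ℤ i j

end WeylAction

section SimpleReflections

open RootPairing

variable {ι M N : Type*} [AddCommGroup M] [Module ℂ M] [AddCommGroup N] [Module ℂ N]
  {P : RootPairing ι ℂ M N} (b : P.Base)

/-- The simple reflections of the finite Weyl group. -/
noncomputable def weylGen (j : b.support) : P.weylGroup := weylGroup.ofIdx P (j : ι)

/-- Positivity of a vector of `𝔥*`: it is a positive root. -/
def IsPosRoot (m : M) : Prop := ∃ k, P.root k = m ∧ b.IsPos k

lemma isPosRoot_root_iff (k : ι) : IsPosRoot b (P.root k) ↔ b.IsPos k :=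
  ⟨fun ⟨_, h, hk⟩ => P.root.injective h ▸ hk, fun hk => ⟨k, rfl, hk⟩⟩

lemma isPos_reflectionPerm_self_iff (k : ι) : b.IsPos (P.reflectionPerm k k) ↔ ¬ b.IsPos k :=
  RootPairing.Base.IsPos.neg_iff_not b k

variable [Finite ι] [P.IsCrystallographic] [P.IsReduced]

lemma weylGen_rootedGenerators :
    RootedGenerators (IsPosRoot b) (fun j : b.support => P.root j) (weylGen b) where
  mul_self j := ofIdx_mul_self _
  pos_simple j := ⟨j, rfl, b.isPos_of_mem_support j.2⟩
  pos_smul_neg x j := by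
    rw [weylGen, ofIdx_smul_root, root_reflectionPerm, reflection_apply_self, smul_neg,
      weylGroup_apply_root, ← reflection_apply_self, ← root_reflectionPerm, isPosRoot_root_iff,
      isPosRoot_root_iff, isPos_reflectionPerm_self_iff]
  pos_smul j _ := by
    rintro ⟨k, rfl, hk⟩ hkj
    exact ⟨_, (ofIdx_smul_root _ k).symm, hk.reflectionPerm j.2 fun e => hkj (e ▸ rfl)⟩
  mul_eq_mul x j k h := mul_ofIdx h

lemma ofIdx_mem_closure_weylGen (k : ι) :
    weylGroup.ofIdx P k ∈ Submonoid.closure (Set.range (weylGen b)) := by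
  induction k using b.induction_reflect with
  | h₀ i hi =>
    rw [ofIdx_reflectionPerm]
    exact mul_mem (mul_mem hi hi) hi
  | h₁ i hi => exact gen_mem_closure (s := weylGen b) ⟨i, hi⟩
  | h₂ i j hi hj =>
    have hj : weylGroup.ofIdx P j ∈ Submonoid.closure (Set.range (weylGen b)) :=
      gen_mem_closure (s := weylGen b) ⟨j, hj⟩
    rw [ofIdx_reflectionPerm]
    exact mul_mem (mul_mem hj hi) hj

lemma mem_closure_weylGen (w : P.weylGroup) :
    w ∈ Submonoid.closure (Set.range (weylGen b)) := by
  obtain ⟨w, hw⟩ := w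
  induction hw using weylGroup.induction with
  | mem k => exact ofIdx_mem_closure_weylGen b k
  | one => exact one_mem _
  | mul v w _ _ hv hw => exact mul_mem hv hw

end SimpleReflections

section AffineAction

variable {ι M N : Type*} [AddCommGroup M] [Module ℂ M] [AddCommGroup N] [Module ℂ N]
  {P : RootPairing ι ℂ M N}

/-- The level one action of the extended affine Weyl group on affine weights `𝔥* ⊕ ℂ δ`:
`t_μ (m + c δ) = m + (c - ⟨m, μ⟩) δ`. -/
noncomputable instance affineAction : DistribMulAction (ExtWeyl P) (M × ℂ) where
  smul x v := (x.right • v.1, v.2 - P.toLinearMap (x.right • v.1) (x.left.toAdd : N))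
  one_smul v := by
    change ((1 : P.weylGroup) • v.1, v.2 - P.toLinearMap ((1 : P.weylGroup) • v.1) (0 : N)) = v
    simp
  mul_smul x y v := by
    change ((x.right * y.right) • v.1, v.2 - P.toLinearMap ((x.right * y.right) • v.1)
      ((x.left.toAdd : N) + coAct P x.right y.left.toAdd)) =
      (x.right • y.right • v.1, (v.2 - P.toLinearMap (y.right • v.1) (y.left.toAdd : N)) -
        P.toLinearMap (x.right • y.right • v.1) (x.left.toAdd : N))
    rw [mul_smul, map_add, pairing_smul_coAct, sub_sub,
      add_comm (P.toLinearMap (y.right • v.1) _)]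
  smul_zero x := by
    change (x.right • (0 : M), 0 - P.toLinearMap (x.right • (0 : M)) _) = 0
    simp
  smul_add x v w := by
    change (x.right • (v.1 + w.1), v.2 + w.2 - P.toLinearMap (x.right • (v.1 + w.1)) _) =
      (x.right • v.1 + x.right • w.1, (v.2 - P.toLinearMap (x.right • v.1) _) +
        (w.2 - P.toLinearMap (x.right • w.1) _))
    rw [smul_add, map_add, LinearMap.add_apply, add_sub_add_comm]

lemma ext_smul_def (x : ExtWeyl P) (v : M × ℂ) :
    x • v = (x.right • v.1, v.2 - P.toLinearMap (x.right • v.1) (x.left.toAdd : N)) := rfl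

instance : SMulCommClass (ExtWeyl P) ℂ (M × ℂ) where
  smul_comm x c v := by
    simp only [ext_smul_def, Prod.smul_fst, Prod.smul_snd, smul_comm x.right c, map_smul,
      LinearMap.smul_apply, Prod.smul_mk, smul_sub]

lemma ofWeyl_smul (w : P.weylGroup) (v : M × ℂ) : ofWeyl P w • v = (w • v.1, v.2) := by
  change (w • v.1, v.2 - P.toLinearMap (w • v.1) (0 : N)) = _
  simp

lemma translation_smul (μ : coweightLattice P) (v : M × ℂ) :
    translation P μ • v = (v.1, v.2 - P.toLinearMap v.1 (μ : N)) := by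
  change ((1 : P.weylGroup) • v.1, v.2 - P.toLinearMap ((1 : P.weylGroup) • v.1) (μ : N)) = _
  simp

lemma eq_of_pairing_eq {h h' : N} (e : ∀ m, P.toLinearMap m h = P.toLinearMap m h') : h = h' :=
  P.flip.toPerfPair.injective (LinearMap.ext e)

lemma extWeyl_ext {x y : ExtWeyl P} (h : ∀ v : M × ℂ, x • v = y • v) : x = y := by
  have hright : x.right = y.right := weyl_ext fun m => congr_arg Prod.fst (h (m, 0))
  refine SemidirectProduct.ext (Multiplicative.toAdd.injective <| Subtype.ext <|
    eq_of_pairing_eq (P := P) fun m => ?_) hright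
  have hsnd := congr_arg Prod.snd (h (x.right⁻¹ • m, 0))
  simpa only [ext_smul_def, ← hright, smul_inv_smul, zero_sub, neg_inj] using hsnd

end AffineAction

section AffineRoots

open RootPairing

variable {ι M N : Type*} [AddCommGroup M] [Module ℂ M] [AddCommGroup N] [Module ℂ N]
  {P : RootPairing ι ℂ M N}

variable (P) in
/-- The affine root `α + n δ` attached to a root `α` and an integer `n`. -/
def affRoot (k : ι) (n : ℤ) : M × ℂ := (P.root k, n)

lemma affRoot_inj {k l : ι} {m n : ℤ} : affRoot P k m = affRoot P l n ↔ k = l ∧ m = n := by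
  simp [affRoot]

lemma neg_affRoot (k : ι) (n : ℤ) : -affRoot P k n = affRoot P (P.reflectionPerm k k) (-n) := by
  simp [affRoot]

lemma ofWeyl_smul_affRoot (w : P.weylGroup) (k : ι) (n : ℤ) :
    ofWeyl P w • affRoot P k n = affRoot P (P.weylGroupToPerm w k) n := by
  rw [ofWeyl_smul, affRoot, weylGroup_apply_root, affRoot]

lemma exists_smul_affRoot (x : ExtWeyl P) (k : ι) : ∃ m : ℤ, ∀ n : ℤ,
    x • affRoot P k n = affRoot P (P.weylGroupToPerm x.right k) (n + m) := by
  obtain ⟨m, hm⟩ := x.left.toAdd.2 (P.weylGroupToPerm x.right k)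
  refine ⟨-m, fun n => ?_⟩
  simp only [affRoot, ext_smul_def, weylGroup_apply_root, hm]
  push_cast
  rfl

variable (b : P.Base)

/-- Positivity of an affine weight: it is an affine root `α + n δ` with `n > 0`, or with `n = 0`
and `α` positive. -/
def IsPosAffRoot (v : M × ℂ) : Prop :=
  ∃ (k : ι) (n : ℤ), v = affRoot P k n ∧ (0 < n ∨ n = 0 ∧ b.IsPos k)

lemma isPosAffRoot_affRoot_iff (k : ι) (n : ℤ) :
    IsPosAffRoot b (affRoot P k n) ↔ 0 < n ∨ n = 0 ∧ b.IsPos k := by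
  refine ⟨?_, fun h => ⟨k, n, rfl, h⟩⟩
  rintro ⟨k', n', h, h'⟩
  obtain ⟨rfl, rfl⟩ := affRoot_inj.1 h
  exact h'

lemma isPosAffRoot_neg_iff (k : ι) (n : ℤ) :
    IsPosAffRoot b (-affRoot P k n) ↔ ¬ IsPosAffRoot b (affRoot P k n) := by
  rw [neg_affRoot, isPosAffRoot_affRoot_iff, isPosAffRoot_affRoot_iff,
    isPos_reflectionPerm_self_iff]
  grind

lemma isPosAffRoot_smul_neg_iff (x : ExtWeyl P) (k : ι) (n : ℤ) :
    IsPosAffRoot b (x • -affRoot P k n) ↔ ¬ IsPosAffRoot b (x • affRoot P k n) := by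
  obtain ⟨m, hm⟩ := exists_smul_affRoot x k
  rw [smul_neg, hm, isPosAffRoot_neg_iff]

lemma finite_inversions [Finite ι] (x : ExtWeyl P) :
    {v : M × ℂ | IsPosAffRoot b v ∧ ¬ IsPosAffRoot b (x • v)}.Finite := by
  choose m hm using exists_smul_affRoot x
  refine Set.Finite.subset (Set.finite_iUnion fun k : ι =>
    (Set.finite_Icc 0 (-m k)).image (affRoot P k)) ?_
  rintro v ⟨hv, hxv⟩
  obtain ⟨k, n, rfl, -⟩ := id hv
  rw [hm, isPosAffRoot_affRoot_iff] at hxv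
  rw [isPosAffRoot_affRoot_iff] at hv
  refine Set.mem_iUnion.2 ⟨k, n, ?_, rfl⟩
  rw [Set.mem_Icc]
  omega

end AffineRoots

section HighestRoot

open RootPairing

variable {ι M N : Type*} [AddCommGroup M] [Module ℂ M] [AddCommGroup N] [Module ℂ N]
  {P : RootPairing ι ℂ M N} (b : P.Base)

lemma height_reflectionPerm_self (k : ι) : b.height (P.reflectionPerm k k) = -b.height k :=
  b.height_reflectionPerm_self k

lemma height_reflectionPerm [P.IsCrystallographic] (j k : ι) :
    b.height (P.reflectionPerm j k) = b.height k - P.pairingIn ℤ k j * b.height j := by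
  have h : P.root (P.reflectionPerm j k) = P.root k + (-P.pairingIn ℤ k j) • P.root j := by
    rw [root_reflectionPerm, neg_smul, P.reflection_apply_root' ℤ, sub_eq_add_neg]
  rw [b.height_add_zsmul h, smul_eq_mul]
  ring

variable [P.IsRootSystem] [Finite ι] [P.IsIrreducible]

lemma height_le_highestRoot (k : ι) : b.height k ≤ b.height (highestRoot b) :=
  (exists_highestRoot b).choose_spec k

lemma neg_height_highestRoot_le (k : ι) : -b.height (highestRoot b) ≤ b.height k := by
  have h := height_le_highestRoot b (P.reflectionPerm k k)
  rw [height_reflectionPerm_self] at h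
  omega

lemma height_highestRoot_pos : 0 < b.height (highestRoot b) := by
  have := neg_height_highestRoot_le b (highestRoot b)
  have := b.height_ne_zero (highestRoot b)
  omega

variable [P.IsCrystallographic]

lemma pairingIn_highestRoot_nonneg {k : ι} (hk : b.IsPos k) :
    0 ≤ P.pairingIn ℤ k (highestRoot b) := by
  by_contra! hneg
  have hk : 0 < b.height k := hk
  have hθ := height_highestRoot_pos b
  have hne : P.root k ≠ -P.root (highestRoot b) := by
    intro h
    rw [← reflection_apply_self, ← root_reflectionPerm] at h
    rw [P.root.injective h, height_reflectionPerm_self] at hk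
    omega
  obtain ⟨l, hl⟩ := P.root_add_root_mem_of_pairingIn_neg hneg hne
  linarith [b.height_add hl, height_le_highestRoot b l]

lemma pairingIn_highestRoot_le_one {k : ι} (hk : k ≠ highestRoot b) :
    P.pairingIn ℤ k (highestRoot b) ≤ 1 := by
  by_contra! h
  obtain ⟨l, hl⟩ := P.root_sub_root_mem_of_pairingIn_pos (one_pos.trans h) hk
  have hlt : b.height k < b.height (highestRoot b) := by
    have := b.height_sub hl
    have := b.height_ne_zero l
    have := height_le_highestRoot b k
    omega
  have hrefl := height_reflectionPerm b (highestRoot b) k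
  have := neg_height_highestRoot_le b (P.reflectionPerm (highestRoot b) k)
  have := mul_le_mul_of_nonneg_right (Int.add_one_le_iff.2 h) (height_highestRoot_pos b).le
  omega

lemma neg_one_le_pairingIn_highestRoot {k : ι}
    (hk : k ≠ P.reflectionPerm (highestRoot b) (highestRoot b)) :
    -1 ≤ P.pairingIn ℤ k (highestRoot b) := by
  have h := pairingIn_highestRoot_le_one b (k := P.reflectionPerm k k) fun h =>
    hk <| P.root.injective <| by
      rw [← h, root_reflectionPerm, reflection_apply_self, root_reflectionPerm,
        reflection_apply_self, neg_neg]
  rw [pairingIn_reflectionPerm_self_left] at h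
  omega

end HighestRoot

section SimpleAffineRoots

open RootPairing

variable {ι M N : Type*} [AddCommGroup M] [Module ℂ M] [AddCommGroup N] [Module ℂ N]
  {P : RootPairing ι ℂ M N} [P.IsRootSystem] (b : P.Base) [Finite ι] [P.IsIrreducible]

/-- The coefficient of `δ` in the simple affine root attached to a node. -/
def nodeLevel : AffineNode b → ℤ
  | some _ => 0
  | none => 1

/-- The simple affine roots: `α_j` for `j ∈ I`, and `-θ + δ` for the node `0`. -/
noncomputable def simpleAffRoot (j : AffineNode b) : M × ℂ :=
  affRoot P (nodeRoot b j) (nodeLevel b j)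

lemma isPosAffRoot_simpleAffRoot (j : AffineNode b) : IsPosAffRoot b (simpleAffRoot b j) := by
  rw [simpleAffRoot, isPosAffRoot_affRoot_iff]
  rcases j with _ | j
  · exact Or.inl one_pos
  · exact Or.inr ⟨rfl, b.isPos_of_mem_support j.2⟩

variable [P.IsCrystallographic]

lemma simpleReflection_smul (j : AffineNode b) (v : M × ℂ) :
    simpleReflection b j • v =
      v - P.toLinearMap v.1 (P.coroot (nodeRoot b j)) • simpleAffRoot b j := by
  rcases j with _ | j
  · simp only [simpleReflection, mul_smul, ofWeyl_smul, translation_smul, ofIdx_smul]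
    ext
    · simp [simpleAffRoot, affRoot, nodeRoot]
    · simp only [simpleAffRoot, affRoot, nodeRoot, nodeLevel, map_sub, map_smul, map_neg,
        LinearMap.sub_apply, LinearMap.smul_apply, coroot_reflectionPerm, coreflection_apply_self,
        P.root_coroot_two, Prod.snd_sub, Prod.smul_snd, smul_eq_mul, Int.cast_one]
      ring
  · simp only [simpleReflection, ofWeyl_smul, ofIdx_smul]
    ext <;> simp [simpleAffRoot, affRoot, nodeRoot, nodeLevel]

lemma simpleReflection_smul_self (j : AffineNode b) :
    simpleReflection b j • simpleAffRoot b j = -simpleAffRoot b j := by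
  have h : P.toLinearMap (simpleAffRoot b j).1 (P.coroot (nodeRoot b j)) = 2 := P.root_coroot_two _
  rw [simpleReflection_smul, h, two_smul, sub_add_cancel_left]

lemma simpleReflection_mul_self (j : AffineNode b) :
    simpleReflection b j * simpleReflection b j = 1 := by
  refine extWeyl_ext fun v => ?_
  rw [mul_smul, one_smul, simpleReflection_smul b j v, smul_sub, smul_comm (simpleReflection b j),
    simpleReflection_smul_self, simpleReflection_smul, smul_neg, sub_neg_eq_add, sub_add_cancel]

lemma mul_simpleReflection {x : ExtWeyl P} {j k : AffineNode b}
    (h : x • simpleAffRoot b j = simpleAffRoot b k) :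
    x * simpleReflection b j = simpleReflection b k * x := by
  refine extWeyl_ext fun v => ?_
  have hpair := pairing_smul_coroot (congr_arg Prod.fst h) v.1
  rw [mul_smul, mul_smul, simpleReflection_smul, simpleReflection_smul, smul_sub, smul_comm x, h,
    ← hpair]
  rfl

lemma simpleReflection_none_smul_affRoot (k : ι) (n : ℤ) :
    simpleReflection b none • affRoot P k n =
      affRoot P (P.reflectionPerm (highestRoot b) k) (n + P.pairingIn ℤ k (highestRoot b)) := by
  rw [simpleReflection_smul]
  ext
  · simp [affRoot, simpleAffRoot, nodeRoot, reflection_apply_root]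
  · simp [affRoot, simpleAffRoot, nodeRoot, nodeLevel, cast_pairingIn]

lemma simpleReflection_some_smul_affRoot (j : b.support) (k : ι) (n : ℤ) :
    simpleReflection b (some j) • affRoot P k n = affRoot P (P.reflectionPerm j k) n := by
  rw [simpleReflection, ofWeyl_smul, affRoot, ofIdx_smul_root, affRoot]

lemma isPosAffRoot_simpleReflection_none_smul {k : ι} {n : ℤ}
    (hpos : IsPosAffRoot b (affRoot P k n)) (hne : affRoot P k n ≠ simpleAffRoot b none) :
    IsPosAffRoot b (simpleReflection b none • affRoot P k n) := by
  rw [isPosAffRoot_affRoot_iff] at hpos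
  rw [simpleReflection_none_smul_affRoot, isPosAffRoot_affRoot_iff]
  unfold Base.IsPos at *
  have hθ := height_highestRoot_pos b
  by_cases hk : k = highestRoot b
  · rw [hk, P.pairingIn_same]
    omega
  by_cases hk' : k = P.reflectionPerm (highestRoot b) (highestRoot b)
  · have hn : n ≠ 1 := fun hn => hne (by rw [hk', hn]; rfl)
    rw [hk', height_reflectionPerm_self] at hpos
    rw [hk', reflectionPerm_self, pairingIn_reflectionPerm_self_left, P.pairingIn_same]
    omega
  · have hc := pairingIn_highestRoot_le_one b hk
    have hc' := neg_one_le_pairingIn_highestRoot b hk'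
    have := neg_height_highestRoot_le b k
    have := height_le_highestRoot b (P.reflectionPerm (highestRoot b) k)
    have := b.height_ne_zero (P.reflectionPerm (highestRoot b) k)
    have hrefl := height_reflectionPerm b (highestRoot b) k
    generalize P.pairingIn ℤ k (highestRoot b) = c at *
    interval_cases c <;> omega

variable [P.IsReduced]

lemma isPosAffRoot_simpleReflection_smul (j : AffineNode b) {v : M × ℂ} (hv : IsPosAffRoot b v)
    (hne : v ≠ simpleAffRoot b j) : IsPosAffRoot b (simpleReflection b j • v) := by
  obtain ⟨k, n, rfl, h⟩ := id hv
  rcases j with _ | j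
  · exact isPosAffRoot_simpleReflection_none_smul b hv hne
  · rw [simpleReflection_some_smul_affRoot, isPosAffRoot_affRoot_iff]
    refine h.imp_right fun ⟨hn, hk⟩ => ⟨hn, hk.reflectionPerm j.2 ?_⟩
    rintro rfl
    exact hne (by rw [hn]; rfl)

lemma affine_rootedGenerators :
    RootedGenerators (IsPosAffRoot b) (simpleAffRoot b) (simpleReflection b) where
  mul_self := simpleReflection_mul_self b
  pos_simple := isPosAffRoot_simpleAffRoot b
  pos_smul_neg x j := by
    rw [simpleReflection_smul_self]
    exact isPosAffRoot_smul_neg_iff b x _ _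
  pos_smul j _ := isPosAffRoot_simpleReflection_smul b j
  mul_eq_mul _ _ _ := mul_simpleReflection b

end SimpleAffineRoots

section Translations

open RootPairing

variable {ι M N : Type*} [AddCommGroup M] [Module ℂ M] [AddCommGroup N] [Module ℂ N]
  {P : RootPairing ι ℂ M N}

lemma translation_add (μ ν : coweightLattice P) :
    translation P (μ + ν) = translation P μ * translation P ν :=
  map_mul SemidirectProduct.inl (Multiplicative.ofAdd μ) (Multiplicative.ofAdd ν)

lemma translation_neg (μ : coweightLattice P) : translation P (-μ) = (translation P μ)⁻¹ :=
  map_inv SemidirectProduct.inl _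

lemma coe_mul_left (x y : ExtWeyl P) :
    ((x * y).left.toAdd : N) = x.left.toAdd + coAct P x.right y.left.toAdd := rfl

lemma coe_inv_left (x : ExtWeyl P) :
    ((x⁻¹).left.toAdd : N) = coAct P x.right⁻¹ (-(x.left.toAdd : N)) := rfl

lemma ofWeyl_mul_translation (w : P.weylGroup) (μ : coweightLattice P) :
    ofWeyl P w * translation P μ =
      translation P ⟨coAct P w μ, coAct_mem_coweightLattice P w μ.2⟩ * ofWeyl P w := by
  refine SemidirectProduct.ext (Multiplicative.toAdd.injective <| Subtype.ext ?_) ?_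
  · change 0 + coAct P w μ = coAct P w μ + coAct P 1 0
    simp
  · simp [ofWeyl, translation]

lemma translation_mul_ofWeyl (x : ExtWeyl P) :
    translation P x.left.toAdd * ofWeyl P x.right = x :=
  SemidirectProduct.inl_left_mul_inr_right x

lemma coroot_mem_corootLattice (k : ι) : P.coroot k ∈ corootLattice P :=
  AddSubgroup.subset_closure (Set.mem_range_self k)

lemma sub_coAct_mem_corootLattice (w : P.weylGroup) {h : N} (hh : h ∈ coweightLattice P) :
    h - coAct P w h ∈ corootLattice P := by
  obtain ⟨w, hw⟩ := w
  induction hw using weylGroup.induction generalizing h with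
  | mem k =>
    obtain ⟨n, hn⟩ := hh k
    have hrefl := coAct_ofIdx (P := P) k h
    rw [weylGroup.ofIdx] at hrefl
    rw [hrefl, hn, sub_sub_cancel, Int.cast_smul_eq_zsmul]
    exact zsmul_mem (coroot_mem_corootLattice k) n
  | one =>
    rw [show (⟨1, _⟩ : P.weylGroup) = 1 from rfl, coAct_one, sub_self]
    exact zero_mem _
  | mul v w hv hw ihv ihw =>
    rw [show (⟨v * w, _⟩ : P.weylGroup) = ⟨v, hv⟩ * ⟨w, hw⟩ from rfl, coAct_mul,
      ← sub_add_sub_cancel h (coAct P ⟨w, hw⟩ h)]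
    exact add_mem (ihw hh) (ihv (coAct_mem_coweightLattice P ⟨w, hw⟩ hh))

lemma mem_affineWeyl_iff (x : ExtWeyl P) :
    x ∈ affineWeyl P ↔ (x.left.toAdd : N) ∈ corootLattice P := Iff.rfl

lemma ofWeyl_mem_affineWeyl (w : P.weylGroup) : ofWeyl P w ∈ affineWeyl P :=
  zero_mem (corootLattice P)

lemma translation_coroot_mem_affineWeyl [P.IsCrystallographic] (k : ι) :
    translation P ⟨P.coroot k, coroot_mem_coweightLattice P k⟩ ∈ affineWeyl P :=
  coroot_mem_corootLattice k

lemma mul_mem_affineWeyl_iff (x y : ExtWeyl P) :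
    x * y ∈ affineWeyl P ↔ (x.left.toAdd : N) + y.left.toAdd ∈ corootLattice P := by
  have hdiff := sub_coAct_mem_corootLattice x.right y.left.toAdd.2
  rw [mem_affineWeyl_iff, coe_mul_left, ← AddSubgroup.add_mem_cancel_right _ hdiff, add_assoc,
    add_sub_cancel]

lemma inv_mul_mem_affineWeyl_iff (x y : ExtWeyl P) :
    x⁻¹ * y ∈ affineWeyl P ↔ (y.left.toAdd : N) - x.left.toAdd ∈ corootLattice P := by
  have hdiff := sub_coAct_mem_corootLattice x.right⁻¹ x.left.toAdd.2
  rw [mul_mem_affineWeyl_iff, coe_inv_left, map_neg, neg_add_eq_sub,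
    ← sub_add_sub_cancel _ (x.left.toAdd : N), AddSubgroup.add_mem_cancel_right _ hdiff]

instance affineWeyl_normal : (affineWeyl P).Normal where
  conj_mem y hy x := by
    rwa [mul_mem_affineWeyl_iff, add_comm, ← mul_mem_affineWeyl_iff, inv_mul_cancel_left]

end Translations

section Generation

open RootPairing

variable {ι M N : Type*} [AddCommGroup M] [Module ℂ M] [AddCommGroup N] [Module ℂ N]
  {P : RootPairing ι ℂ M N}

lemma exists_pairing_smul_ne_zero [P.IsIrreducible] (k l : ι) :
    ∃ w : P.weylGroup, P.toLinearMap (w • P.root k) (P.coroot l) ≠ 0 := by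
  by_contra! horth
  have hspan : Submodule.span ℂ (MulAction.orbit P.weylGroup (P.root k)) ≤
      LinearMap.ker (P.toLinearMap.flip (P.coroot l)) := by
    rw [Submodule.span_le]
    rintro _ ⟨w, rfl⟩
    exact horth w
  rw [P.span_orbit_eq_top k] at hspan
  have hzero : P.toLinearMap (P.root l) (P.coroot l) = 0 := hspan Submodule.mem_top
  rw [P.root_coroot_two] at hzero
  exact two_ne_zero hzero

variable [P.IsRootSystem] (b : P.Base) [Finite ι] [P.IsIrreducible] [P.IsCrystallographic]
  [P.IsReduced]

lemma ofWeyl_mem_closure (w : P.weylGroup) :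
    ofWeyl P w ∈ Submonoid.closure (Set.range (simpleReflection b)) := by
  have hw := Submonoid.mem_map_of_mem (ofWeyl P) (mem_closure_weylGen b w)
  rw [MonoidHom.map_mclosure] at hw
  refine Submonoid.closure_mono ?_ hw
  rintro _ ⟨_, ⟨j, rfl⟩, rfl⟩
  exact ⟨some j, rfl⟩

/-- The coweights whose translations are products of simple reflections. -/
noncomputable def wordTranslations : AddSubgroup N where
  carrier := {h | ∃ hh : h ∈ coweightLattice P,
    translation P ⟨h, hh⟩ ∈ Submonoid.closure (Set.range (simpleReflection b))}
  zero_mem' := ⟨zero_mem _, one_mem _⟩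
  add_mem' := fun ⟨hh, hmem⟩ ⟨hh', hmem'⟩ =>
    ⟨add_mem hh hh', by
      have := mul_mem hmem hmem'
      rwa [← translation_add] at this⟩
  neg_mem' := fun ⟨hh, hmem⟩ =>
    ⟨neg_mem hh, by
      have := (affine_rootedGenerators b).inv_mem_closure hmem
      rwa [← translation_neg] at this⟩

lemma coAct_mem_wordTranslations (w : P.weylGroup) {h : N} (hh : h ∈ wordTranslations b) :
    coAct P w h ∈ wordTranslations b := by
  obtain ⟨hc, hmem⟩ := hh
  have hconj := mul_mem (mul_mem (ofWeyl_mem_closure b w) hmem) (ofWeyl_mem_closure b w⁻¹)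
  rw [ofWeyl_mul_translation, mul_assoc, ← map_mul, mul_inv_cancel, map_one, mul_one] at hconj
  exact ⟨coAct_mem_coweightLattice P w hc, hconj⟩

lemma coroot_highestRoot_mem_wordTranslations :
    P.coroot (highestRoot b) ∈ wordTranslations b := by
  refine ⟨coroot_mem_coweightLattice P _, ?_⟩
  have hmul : simpleReflection b none * ofWeyl P (weylGroup.ofIdx P (highestRoot b)) =
      translation P ⟨P.coroot (highestRoot b), coroot_mem_coweightLattice P _⟩ := by
    rw [simpleReflection, mul_assoc, ← map_mul, ofIdx_mul_self, map_one, mul_one]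
  rw [← hmul]
  exact mul_mem (gen_mem_closure (s := simpleReflection b) none) (ofWeyl_mem_closure b _)

lemma coroot_mem_wordTranslations_of_pairingIn_ne_zero {k : ι}
    (hk : P.pairingIn ℤ k (highestRoot b) ≠ 0) : P.coroot k ∈ wordTranslations b := by
  have hθ := coroot_highestRoot_mem_wordTranslations b
  by_cases h : k = highestRoot b
  · rwa [h]
  by_cases h' : k = P.reflectionPerm (highestRoot b) (highestRoot b)
  · rw [h', coroot_reflectionPerm, coreflection_apply_self]
    exact neg_mem hθ
  have hrefl := sub_mem hθ (coAct_mem_wordTranslations b (weylGroup.ofIdx P k) hθ)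
  rw [coAct_ofIdx, P.root_coroot_eq_pairing, ← cast_pairingIn, Int.cast_smul_eq_zsmul,
    sub_sub_cancel] at hrefl
  have hle := pairingIn_highestRoot_le_one b h
  have hge := neg_one_le_pairingIn_highestRoot b h'
  obtain hc | hc : P.pairingIn ℤ k (highestRoot b) = 1 ∨
      P.pairingIn ℤ k (highestRoot b) = -1 := by omega
  · rwa [hc, one_smul] at hrefl
  · rw [hc, neg_smul, one_smul] at hrefl
    exact neg_mem_iff.1 hrefl

lemma coroot_mem_wordTranslations (k : ι) : P.coroot k ∈ wordTranslations b := by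
  obtain ⟨w, hw⟩ := exists_pairing_smul_ne_zero (P := P) k (highestRoot b)
  rw [weylGroup_apply_root, P.root_coroot_eq_pairing, ← cast_pairingIn, Int.cast_ne_zero] at hw
  rw [← coAct_inv_coAct w (P.coroot k), coAct_coroot_eq]
  exact coAct_mem_wordTranslations b _ (coroot_mem_wordTranslations_of_pairingIn_ne_zero b hw)

lemma mem_affineWeyl_iff_mem_closure (x : ExtWeyl P) :
    x ∈ affineWeyl P ↔ x ∈ Submonoid.closure (Set.range (simpleReflection b)) := by
  refine ⟨fun hx => ?_, fun hx => ?_⟩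
  · have hle : corootLattice P ≤ wordTranslations b :=
      (AddSubgroup.closure_le _).2 (Set.range_subset_iff.2 (coroot_mem_wordTranslations b))
    obtain ⟨_, hleft⟩ := hle hx
    rw [← translation_mul_ofWeyl x]
    exact mul_mem hleft (ofWeyl_mem_closure b _)
  · induction hx using Submonoid.closure_induction with
    | mem x hx =>
      obtain ⟨_ | j, rfl⟩ := hx
      · exact mul_mem (translation_coroot_mem_affineWeyl _) (ofWeyl_mem_affineWeyl _)
      · exact ofWeyl_mem_affineWeyl _
    | one => exact one_mem _
    | mul x y _ _ hx hy => exact mul_mem hx hy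

end Generation

section Dominance

open RootPairing
open scoped ComplexOrder

variable {ι M N : Type*} [AddCommGroup M] [Module ℂ M] [AddCommGroup N] [Module ℂ N]
  {P : RootPairing ι ℂ M N} (b : P.Base) [Finite ι] [P.IsCrystallographic] [P.IsReduced]

lemma pairing_smul_le_of_dominant {γ : M} {h : N}
    (hγ : ∀ j : b.support, 0 ≤ P.toLinearMap γ (P.coroot j))
    (hh : ∀ k, b.IsPos k → 0 ≤ P.toLinearMap (P.root k) h) (w : P.weylGroup) :
    P.toLinearMap (w • γ) h ≤ P.toLinearMap γ h := by
  have hR := weylGen_rootedGenerators b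
  generalize hn : genLength (weylGen b) w = n
  induction n generalizing w with
  | zero =>
    obtain ⟨l, rfl, hl⟩ := exists_isReduced (mem_closure_weylGen b w)
    rw [hn, List.length_eq_zero_iff] at hl
    simp [hl]
  | succ n ih =>
    obtain ⟨j, hj⟩ := hR.exists_not_pos_smul_simple (mem_closure_weylGen b w) (by
      rintro rfl
      simp [genLength_one] at hn)
    have hlen := hR.genLength_mul_of_not_pos (mem_closure_weylGen b w) hj
    have hpos : 0 ≤ P.toLinearMap ((w * weylGen b j) • P.root j) h := by
      have hroot := (hR.pos_mul_smul_simple w j).2 hj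
      rw [weylGroup_apply_root] at hroot ⊢
      exact hh _ ((isPosRoot_root_iff b _).1 hroot)
    have hw : w • γ = (w * weylGen b j) • γ -
        P.toLinearMap γ (P.coroot j) • (w * weylGen b j) • P.root j := by
      conv_lhs => rw [← hR.mul_cancel_right j w, mul_smul, weylGen, ofIdx_smul]
      rw [smul_sub, smul_comm (w * _)]
      rfl
    calc P.toLinearMap (w • γ) h
        ≤ P.toLinearMap ((w * weylGen b j) • γ) h := by
          rw [hw, LinearMap.map_sub, LinearMap.map_smul, LinearMap.sub_apply,
            LinearMap.smul_apply, smul_eq_mul]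
          exact sub_le_self _ (mul_nonneg (hγ j) hpos)
      _ ≤ P.toLinearMap γ h := ih _ (by omega)

variable [P.IsRootSystem] [P.IsIrreducible]

lemma exists_node_pairingIn_pos (k : ι) : ∃ j, 0 < P.pairingIn ℤ k (nodeRoot b j) := by
  by_contra! hneg
  have hdom (j : b.support) : 0 ≤ P.toLinearMap (-P.root k) (P.coroot j) := by
    rw [map_neg, LinearMap.neg_apply, P.root_coroot_eq_pairing, ← cast_pairingIn, neg_nonneg]
    exact_mod_cast hneg (some j)
  have hθ : P.toLinearMap (-P.root k) (P.coroot (highestRoot b)) ≤ 0 := by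
    have := hneg none
    rw [nodeRoot, pairingIn_reflectionPerm_self_right, neg_nonpos] at this
    rw [map_neg, LinearMap.neg_apply, P.root_coroot_eq_pairing, ← cast_pairingIn, neg_nonpos]
    exact_mod_cast this
  have hle (w : P.weylGroup) : 0 ≤ P.toLinearMap (w • P.root k) (P.coroot (highestRoot b)) := by
    have := (pairing_smul_le_of_dominant b (h := P.coroot (highestRoot b)) hdom (fun l hl => by
      rw [P.root_coroot_eq_pairing, ← cast_pairingIn]
      exact_mod_cast pairingIn_highestRoot_nonneg b hl) w).trans hθ
    rwa [smul_neg, map_neg, LinearMap.neg_apply, neg_nonpos] at this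
  obtain ⟨w, hw⟩ := exists_pairing_smul_ne_zero (P := P) k (highestRoot b)
  -- `s_θ` changes the sign of the pairing with `θ^∨`.
  have hrefl := hle (weylGroup.ofIdx P (highestRoot b) * w)
  rw [mul_smul, ofIdx_smul, LinearMap.map_sub, LinearMap.map_smul, LinearMap.sub_apply,
    LinearMap.smul_apply, P.root_coroot_two, smul_eq_mul, mul_two, sub_add_cancel_left,
    neg_nonneg] at hrefl
  exact hw (le_antisymm hrefl (hle w))

end Dominance

section AffineHeight

open RootPairing
open scoped ComplexOrder

variable {ι M N : Type*} [AddCommGroup M] [Module ℂ M] [AddCommGroup N] [Module ℂ N]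
  {P : RootPairing ι ℂ M N} [P.IsRootSystem] (b : P.Base) [Finite ι] [P.IsIrreducible]

/-- The linear extension to affine weights of the height of affine roots, normalized so that all
simple affine roots have height one. -/
noncomputable def affHeight : M × ℂ →ₗ[ℂ] ℂ :=
  (b.toWeightBasis.constr ℂ fun _ => (1 : ℂ)) ∘ₗ LinearMap.fst ℂ M ℂ +
    ((b.height (highestRoot b) + 1 : ℤ) : ℂ) • LinearMap.snd ℂ M ℂ

lemma affHeight_affRoot (k : ι) (n : ℤ) : affHeight b (affRoot P k n) =
    (b.height k + n * (b.height (highestRoot b) + 1) : ℤ) := by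
  obtain ⟨f, -, -, hf⟩ := b.exists_root_eq_sum_int k
  have hroot : b.toWeightBasis.constr ℂ (fun _ => (1 : ℂ)) (P.root k) = b.height k := by
    have hsimple (j : ι) (hj : j ∈ b.support) :
        b.toWeightBasis.constr ℂ (fun _ => (1 : ℂ)) (P.root j) = 1 := by
      have := b.toWeightBasis.constr_basis ℂ (fun _ => (1 : ℂ)) ⟨j, hj⟩
      rwa [b.toWeightBasis_apply] at this
    rw [Base.height_eq_sum hf, hf, map_sum, Int.cast_sum]
    exact Finset.sum_congr rfl fun j hj => by rw [map_zsmul, hsimple j hj, zsmul_one]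
  simp only [affHeight, affRoot, LinearMap.add_apply, LinearMap.comp_apply, LinearMap.fst_apply,
    LinearMap.smul_apply, LinearMap.snd_apply, hroot, smul_eq_mul]
  push_cast
  ring

lemma affHeight_simpleAffRoot (j : AffineNode b) : affHeight b (simpleAffRoot b j) = 1 := by
  rw [simpleAffRoot, affHeight_affRoot]
  rcases j with _ | j
  · simp [nodeRoot, nodeLevel, height_reflectionPerm_self]
  · simp [nodeRoot, nodeLevel, b.height_one_of_mem_support j.2]

lemma affHeight_affRoot_pos_iff (k : ι) (n : ℤ) :
    0 < affHeight b (affRoot P k n) ↔ IsPosAffRoot b (affRoot P k n) := by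
  rw [affHeight_affRoot, isPosAffRoot_affRoot_iff, Base.isPos_iff, Int.cast_pos]
  have hθ := height_highestRoot_pos b
  have hle := height_le_highestRoot b k
  have hge := neg_height_highestRoot_le b k
  rcases lt_trichotomy n 0 with hn | rfl | hn
  · have : n * (b.height (highestRoot b) + 1) ≤ -1 * (b.height (highestRoot b) + 1) :=
      mul_le_mul_of_nonneg_right (by omega) (by omega)
    omega
  · simp
  · have : 1 * (b.height (highestRoot b) + 1) ≤ n * (b.height (highestRoot b) + 1) :=
      mul_le_mul_of_nonneg_right (by omega) (by omega)
    omega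

lemma IsPosAffRoot.exists_affHeight_eq {v : M × ℂ} (hv : IsPosAffRoot b v) :
    ∃ h : ℕ, 0 < h ∧ affHeight b v = h := by
  obtain ⟨k, n, rfl, -⟩ := id hv
  rw [← affHeight_affRoot_pos_iff, affHeight_affRoot, Int.cast_pos] at hv
  rw [affHeight_affRoot]
  lift b.height k + n * (b.height (highestRoot b) + 1) to ℕ using hv.le with h
  exact ⟨h, by exact_mod_cast hv, by norm_cast⟩

lemma isPosAffRoot_affRoot_of_eq_add {k : ι} {n c : ℤ} (hc : 0 ≤ c) {v v' : M × ℂ}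
    (hv : IsPosAffRoot b v) (hv' : IsPosAffRoot b v') (heq : affRoot P k n = v + c • v') :
    IsPosAffRoot b (affRoot P k n) := by
  obtain ⟨h, hpos, hh⟩ := hv.exists_affHeight_eq
  obtain ⟨h', -, hh'⟩ := hv'.exists_affHeight_eq
  have hheight : affHeight b (affRoot P k n) = (h + c * h' : ℤ) := by
    rw [heq, map_add, map_zsmul, hh, hh', zsmul_eq_mul]
    push_cast
    rfl
  rw [← affHeight_affRoot_pos_iff, hheight, Int.cast_pos]
  positivity

variable [P.IsCrystallographic] [P.IsReduced]

lemma IsPosAffRoot.induction_on {p : M × ℂ → Prop} (hsimple : ∀ j, p (simpleAffRoot b j))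
    (hadd : ∀ v (c : ℤ) j, 0 ≤ c → IsPosAffRoot b v → IsPosAffRoot b (v + c • simpleAffRoot b j) →
      p v → p (v + c • simpleAffRoot b j))
    {v : M × ℂ} (hv : IsPosAffRoot b v) : p v := by
  obtain ⟨h, -, hh⟩ := hv.exists_affHeight_eq
  induction h using Nat.strong_induction_on generalizing v with
  | _ h ih =>
    obtain ⟨k, n, rfl, -⟩ := id hv
    obtain ⟨j, hj⟩ := exists_node_pairingIn_pos b k
    by_cases heq : affRoot P k n = simpleAffRoot b j
    · exact heq ▸ hsimple j
    have hpos := isPosAffRoot_simpleReflection_smul b j hv heq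
    have hsum : affRoot P k n = simpleReflection b j • affRoot P k n +
        P.pairingIn ℤ k (nodeRoot b j) • simpleAffRoot b j := by
      rw [simpleReflection_smul, ← Int.cast_smul_eq_zsmul ℂ, cast_pairingIn]
      exact (sub_add_cancel _ _).symm
    obtain ⟨h', -, hh'⟩ := hpos.exists_affHeight_eq
    have hlt : h' < h := by
      have := congr_arg (affHeight b) hsum
      rw [map_add, map_zsmul, affHeight_simpleAffRoot, hh, hh', zsmul_one] at this
      have : (h : ℤ) = h' + P.pairingIn ℤ k (nodeRoot b j) := by exact_mod_cast this
      omega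
    rw [hsum] at hv ⊢
    exact hadd _ _ _ hj.le hpos hv (ih h' hlt hpos hh')

lemma isPosAffRoot_smul_of_forall_simple {x : ExtWeyl P}
    (hx : ∀ j, IsPosAffRoot b (x • simpleAffRoot b j)) {v : M × ℂ} (hv : IsPosAffRoot b v) :
    IsPosAffRoot b (x • v) := by
  refine IsPosAffRoot.induction_on b (p := fun v => IsPosAffRoot b (x • v)) hx
    (fun v c j hc _ hsum hv => ?_) hv
  obtain ⟨k, n, hkn, -⟩ := hsum
  obtain ⟨m, hm⟩ := exists_smul_affRoot x k
  rw [hkn, hm n]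
  exact isPosAffRoot_affRoot_of_eq_add b hc hv (hx j) (by rw [← hm, ← hkn, smul_add, smul_comm x c])

end AffineHeight

section Grassmannian

open RootPairing

variable {ι M N : Type*} [AddCommGroup M] [Module ℂ M] [AddCommGroup N] [Module ℂ N]
  {P : RootPairing ι ℂ M N} [P.IsRootSystem] (b : P.Base) [Finite ι] [P.IsIrreducible]

/-- Grassmannian elements of the extended affine Weyl group: those keeping the simple roots of the
finite root system positive. They are the elements of minimal length in their left coset of the
finite Weyl group, see `mem_extGrassmannian_iff`. -/
def IsGrassmannian (x : ExtWeyl P) : Prop :=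
  ∀ j : b.support, IsPosAffRoot b (x • simpleAffRoot b (some j))

variable {b} [P.IsCrystallographic]

lemma IsGrassmannian.isPosAffRoot_smul {x : ExtWeyl P} (hx : IsGrassmannian b x) {k : ι}
    (hk : b.IsPos k) : IsPosAffRoot b (x • affRoot P k 0) := by
  refine Base.IsPos.induction_on_add (b := b) (p := fun k => IsPosAffRoot b (x • affRoot P k 0))
    hk (fun i hi => hx ⟨i, hi⟩) fun i j k hsum hi hj => ?_
  obtain ⟨m, hm⟩ := exists_smul_affRoot x k
  rw [hm]
  refine isPosAffRoot_affRoot_of_eq_add b zero_le_one hi (hx ⟨j, hj⟩) ?_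
  rw [← hm, one_smul, ← smul_add]
  simp [simpleAffRoot, nodeRoot, nodeLevel, affRoot, hsum]

variable [P.IsReduced]

lemma IsGrassmannian.eq_one {x : ExtWeyl P} (hx : IsGrassmannian b x) {w : P.weylGroup}
    (hw : IsGrassmannian b (x * ofWeyl P w)) : w = 1 := by
  by_contra hw1
  obtain ⟨j, hj⟩ := (weylGen_rootedGenerators b).exists_not_pos_smul_simple
    (mem_closure_weylGen b w) hw1
  rw [weylGroup_apply_root, isPosRoot_root_iff, ← isPos_reflectionPerm_self_iff] at hj
  have hneg := hx.isPosAffRoot_smul hj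
  have hpos := hw j
  rw [simpleAffRoot, mul_smul, ofWeyl_smul_affRoot] at hpos
  rw [← neg_zero, ← neg_affRoot, isPosAffRoot_smul_neg_iff] at hneg
  exact hneg hpos

lemma IsGrassmannian.eq_of_mul {x : ExtWeyl P} {u v : P.weylGroup}
    (hu : IsGrassmannian b (x * ofWeyl P u)) (hv : IsGrassmannian b (x * ofWeyl P v)) : u = v :=
  inv_mul_eq_one.1 (hu.eq_one (by rwa [mul_assoc, ← map_mul, mul_inv_cancel_left]))

lemma exists_isGrassmannian (x : ExtWeyl P) :
    ∃ w : P.weylGroup, IsGrassmannian b (x * ofWeyl P w) := by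
  obtain ⟨l, hl⟩ := ((affine_rootedGenerators b).comp some).exists_forall_pos_mul_genProd x
    (finite_inversions b x)
  refine ⟨genProd (weylGen b) l, ?_⟩
  rwa [genProd, map_list_prod, List.map_map]

end Grassmannian

section LengthZero

open RootPairing

variable {ι M N : Type*} [AddCommGroup M] [Module ℂ M] [AddCommGroup N] [Module ℂ N]
  {P : RootPairing ι ℂ M N} [P.IsRootSystem] (b : P.Base) [Finite ι] [P.IsIrreducible]

/-- The elements of length zero of the extended affine Weyl group, that is, those keeping all
simple affine roots positive. By `mem_sigmaSet_iff` they form the group `Σ`. -/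
def IsLengthZero (x : ExtWeyl P) : Prop := ∀ j, IsPosAffRoot b (x • simpleAffRoot b j)

variable {b}

lemma simpleAffRoot_injective : Function.Injective (simpleAffRoot b) := by
  intro j k h
  obtain ⟨hroot, hlevel⟩ := affRoot_inj.1 h
  rcases j with _ | j <;> rcases k with _ | k
  · rfl
  · simp [nodeLevel] at hlevel
  · simp [nodeLevel] at hlevel
  · exact congr_arg some (Subtype.ext hroot)

lemma IsLengthZero.isGrassmannian {x : ExtWeyl P} (hx : IsLengthZero b x) :
    IsGrassmannian b x := fun j => hx (some j)

variable [P.IsCrystallographic] [P.IsReduced]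

lemma simpleReflection_mem_affineWeyl (j : AffineNode b) :
    simpleReflection b j ∈ affineWeyl P :=
  (mem_affineWeyl_iff_mem_closure b _).2 (gen_mem_closure (s := simpleReflection b) j)

lemma exists_isLengthZero_mul (x : ExtWeyl P) :
    ∃ y ∈ affineWeyl P, IsLengthZero b (x * y) := by
  obtain ⟨l, hl⟩ := (affine_rootedGenerators b).exists_forall_pos_mul_genProd x
    (finite_inversions b x)
  exact ⟨_, (mem_affineWeyl_iff_mem_closure b _).2 (genProd_mem_closure _ l), hl⟩

namespace IsLengthZero

variable {x y : ExtWeyl P}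

lemma isPosAffRoot_inv_smul (hx : IsLengthZero b x) {v : M × ℂ} (hv : IsPosAffRoot b v) :
    IsPosAffRoot b (x⁻¹ • v) := by
  obtain ⟨k, n, rfl, -⟩ := id hv
  by_contra hneg
  rw [← isPosAffRoot_smul_neg_iff] at hneg
  have hpos := isPosAffRoot_smul_of_forall_simple b hx hneg
  rw [smul_inv_smul, isPosAffRoot_neg_iff] at hpos
  exact hpos hv

lemma isPosAffRoot_smul_iff (hx : IsLengthZero b x) {v : M × ℂ} :
    IsPosAffRoot b (x • v) ↔ IsPosAffRoot b v :=
  ⟨fun h => by simpa using hx.isPosAffRoot_inv_smul h, isPosAffRoot_smul_of_forall_simple b hx⟩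

lemma mul (hx : IsLengthZero b x) (hy : IsLengthZero b y) : IsLengthZero b (x * y) := fun j => by
  rw [mul_smul, hx.isPosAffRoot_smul_iff]
  exact hy j

lemma inv (hx : IsLengthZero b x) : IsLengthZero b x⁻¹ :=
  fun j => hx.isPosAffRoot_inv_smul (isPosAffRoot_simpleAffRoot b j)

lemma isGrassmannian_mul_iff (hx : IsLengthZero b x) :
    IsGrassmannian b (x * y) ↔ IsGrassmannian b y :=
  forall_congr' fun j => by rw [mul_smul, hx.isPosAffRoot_smul_iff]

lemma eq_one (hx : IsLengthZero b x) (h : x ∈ affineWeyl P) : x = 1 :=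
  (affine_rootedGenerators b).eq_one_of_forall_pos ((mem_affineWeyl_iff_mem_closure b x).1 h) hx

lemma eq_of_inv_mul_mem (hx : IsLengthZero b x) (hy : IsLengthZero b y)
    (h : x⁻¹ * y ∈ affineWeyl P) : x = y :=
  inv_mul_eq_one.1 ((hx.inv.mul hy).eq_one h)

lemma eq_and_eq_of_mul_eq {v w : ExtWeyl P} (hx : IsLengthZero b x) (hy : IsLengthZero b y)
    (hv : v ∈ affineWeyl P) (hw : w ∈ affineWeyl P) (h : x * v = y * w) : x = y ∧ v = w := by
  have heq : x⁻¹ * y = v * w⁻¹ := by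
    rw [inv_mul_eq_iff_eq_mul, ← mul_assoc, h, mul_inv_cancel_right]
  obtain rfl := hx.eq_of_inv_mul_mem hy (heq ▸ mul_mem hv (inv_mem hw))
  exact ⟨rfl, mul_left_cancel h⟩

-- The conjugate `x s_j x⁻¹` is a non-trivial element of the affine Weyl group; a simple affine root
-- that it makes negative can only be `x α_j`.
lemma exists_smul_simpleAffRoot_eq (hx : IsLengthZero b x) (j : AffineNode b) :
    ∃ k, x • simpleAffRoot b j = simpleAffRoot b k := by
  have hR := affine_rootedGenerators b
  have hmem : x * simpleReflection b j * x⁻¹ ∈ affineWeyl P :=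
    affineWeyl_normal.conj_mem _ (simpleReflection_mem_affineWeyl j) x
  have hne : x * simpleReflection b j * x⁻¹ ≠ 1 := by
    simpa [mul_inv_eq_one] using hR.ne_one j
  obtain ⟨k, hk⟩ := hR.exists_not_pos_smul_simple ((mem_affineWeyl_iff_mem_closure b _).1 hmem) hne
  rw [mul_smul, mul_smul, hx.isPosAffRoot_smul_iff] at hk
  exact ⟨k, by rw [← hR.eq_simple (hx.inv k) hk, smul_inv_smul]⟩

lemma exists_perm (hx : IsLengthZero b x) : ∃ σ : Equiv.Perm (AffineNode b),
    ∀ j, x • simpleAffRoot b j = simpleAffRoot b (σ j) := by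
  choose f hf using hx.exists_smul_simpleAffRoot_eq
  have hinj : Function.Injective f := fun j k h =>
    simpleAffRoot_injective (smul_left_cancel x (by rw [hf, hf, h]))
  exact ⟨Equiv.ofBijective f (Finite.injective_iff_bijective.1 hinj), hf⟩

end IsLengthZero

lemma exists_eq_isLengthZero_mul (b : P.Base) (x : ExtWeyl P) :
    ∃ π v, IsLengthZero b π ∧ v ∈ affineWeyl P ∧ x = π * v := by
  obtain ⟨y, hy, hxy⟩ := exists_isLengthZero_mul (b := b) x
  exact ⟨_, y⁻¹, hxy, inv_mem hy, (mul_inv_cancel_right x y).symm⟩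

end LengthZero

section FundamentalCoweights

open RootPairing
open scoped ComplexOrder

variable {ι M N : Type*} [AddCommGroup M] [Module ℂ M] [AddCommGroup N] [Module ℂ N]
  {P : RootPairing ι ℂ M N} [P.IsRootSystem] {b : P.Base}

lemma pairing_fundCoweight_some (i : b.support) (m : M) :
    P.toLinearMap m (fundCoweight b (some i) : N) = b.toWeightBasis.repr m i :=
  LinearMap.congr_fun (P.flip.toPerfPair.apply_symm_apply (b.toWeightBasis.coord i)) m

lemma pairing_root_fundCoweight (j : b.support) (s : AffineNode b) [Decidable (some j = s)] :
    P.toLinearMap (P.root j) (fundCoweight b s : N) = if some j = s then 1 else 0 := by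
  classical
  rcases s with _ | i
  · simp [fundCoweight]
  · rw [pairing_fundCoweight_some, b.toWeightBasis_repr_root]
    simp [Finsupp.single_apply]

lemma coweight_ext (b : P.Base) {h h' : N}
    (e : ∀ j : b.support, P.toLinearMap (P.root j) h = P.toLinearMap (P.root j) h') : h = h' := by
  have hflip : P.toLinearMap.flip h = P.toLinearMap.flip h' :=
    b.toWeightBasis.ext fun j => by simpa using e j
  exact eq_of_pairing_eq (LinearMap.congr_fun hflip)

lemma weight_ext (b : P.Base) {m m' : M}
    (e : ∀ j : b.support, P.toLinearMap m (P.coroot j) = P.toLinearMap m' (P.coroot j)) :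
    m = m' :=
  P.toPerfPair.injective (b.toCoweightBasis.ext fun j => by simpa using e j)

lemma fundCoweight_injective : Function.Injective (fundCoweight b) := by
  classical
  intro s s' h
  have hiff (j : b.support) : some j = s ↔ some j = s' := by
    have := congr_arg (fun h : coweightLattice P => P.toLinearMap (P.root j) (h : N)) h
    simp only [pairing_root_fundCoweight] at this
    split_ifs at this <;> simp_all
  rcases s with _ | s
  · rcases s' with _ | s'
    · rfl
    · exact ((hiff s').2 rfl).symm
  · exact (hiff s).1 rfl

lemma eq_sum_pairing_fundCoweight (m : M) :
    m = ∑ j : b.support, P.toLinearMap m (fundCoweight b (some j) : N) • P.root j := by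
  conv_lhs => rw [← b.toWeightBasis.sum_repr m]
  simp only [pairing_fundCoweight_some, Base.toWeightBasis_apply]

lemma pairing_fundCoweight_nonneg [P.IsCrystallographic] [P.IsReduced] [Finite ι]
    (s : AffineNode b) {k : ι} (hk : b.IsPos k) :
    0 ≤ P.toLinearMap (P.root k) (fundCoweight b s : N) := by
  classical
  have hsimple (j : b.support) : 0 ≤ P.toLinearMap (P.root j) (fundCoweight b s : N) := by
    rw [pairing_root_fundCoweight]
    split_ifs <;> simp
  refine Base.IsPos.induction_on_add (b := b)
    (p := fun k => 0 ≤ P.toLinearMap (P.root k) (fundCoweight b s : N)) hk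
    (fun i hi => hsimple ⟨i, hi⟩) fun i j k hsum hi hj => ?_
  rw [hsum, map_add, LinearMap.add_apply]
  exact add_nonneg hi (hsimple ⟨j, hj⟩)

variable [Finite ι] [P.IsIrreducible]

lemma isDiagramAut_of_smul_simpleAffRoot {x : ExtWeyl P} {σ : Equiv.Perm (AffineNode b)}
    (hσ : ∀ j, x • simpleAffRoot b j = simpleAffRoot b (σ j)) : IsDiagramAut b σ := by
  have hroot (l : AffineNode b) : x.right • P.root (nodeRoot b l) = P.root (nodeRoot b (σ l)) :=
    congr_arg Prod.fst (hσ l)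
  intro j k
  rw [← P.root_coroot_eq_pairing, ← hroot j, pairing_smul_coroot (hroot k),
    P.root_coroot_eq_pairing]

lemma left_eq_fundCoweight {x : ExtWeyl P} {σ : Equiv.Perm (AffineNode b)}
    (hσ : ∀ j, x • simpleAffRoot b j = simpleAffRoot b (σ j)) :
    x.left.toAdd = fundCoweight b (σ none) := by
  classical
  refine Subtype.ext (coweight_ext b fun j => ?_)
  have hj := hσ (σ.symm (some j))
  rw [Equiv.apply_symm_apply] at hj
  have hroot : x.right • P.root (nodeRoot b (σ.symm (some j))) = P.root j := congr_arg Prod.fst hj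
  have hlevel : (nodeLevel b (σ.symm (some j)) : ℂ) -
      P.toLinearMap (x.right • P.root (nodeRoot b (σ.symm (some j)))) (x.left.toAdd : N) =
        (0 : ℤ) := congr_arg Prod.snd hj
  rw [hroot, Int.cast_zero, sub_eq_zero] at hlevel
  rw [← hlevel, pairing_root_fundCoweight]
  simp only [← Equiv.symm_apply_eq]
  rcases σ.symm (some j) with _ | k <;> simp [nodeLevel]

end FundamentalCoweights

section ShortestAntidominant

open RootPairing

variable {ι M N : Type*} [AddCommGroup M] [Module ℂ M] [AddCommGroup N] [Module ℂ N]
  {P : RootPairing ι ℂ M N} {b : P.Base}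

lemma translation_mul_ofWeyl_smul_root (μ : coweightLattice P) (u : P.weylGroup) (k : ι) :
    (translation P μ * ofWeyl P u) • affRoot P k 0 =
      (P.root (P.weylGroupToPerm u k), -P.toLinearMap (P.root k) (coAct P u⁻¹ μ)) := by
  rw [mul_smul, ofWeyl_smul_affRoot, translation_smul, pairing_coAct, inv_inv,
    weylGroup_apply_root]
  simp [affRoot]

lemma isPosAffRoot_translation_mul_ofWeyl_smul_iff {μ : coweightLattice P} {u : P.weylGroup}
    {k : ι} {n : ℤ} (hn : P.toLinearMap (P.root k) (coAct P u⁻¹ μ) = -n) :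
    IsPosAffRoot b ((translation P μ * ofWeyl P u) • affRoot P k 0) ↔
      0 < n ∨ n = 0 ∧ b.IsPos (P.weylGroupToPerm u k) := by
  rw [translation_mul_ofWeyl_smul_root, hn, neg_neg]
  exact isPosAffRoot_affRoot_iff b _ _

lemma weylLength_eq_genLength (u : P.weylGroup) : weylLength b u = genLength (weylGen b) u := by
  change weylLength b u = genLength (fun j : b.support => weylGroup.ofIdx P (j : ι)) u
  unfold weylLength genLength genProd
  congr! 6
  simp [← List.map_eq_flatMap]

variable [P.IsRootSystem] [Finite ι] [P.IsIrreducible]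

lemma IsGrassmannian.isAntidominant {μ : coweightLattice P} {u : P.weylGroup}
    (h : IsGrassmannian b (translation P μ * ofWeyl P u)) : IsAntidominant b (coAct P u⁻¹ μ) := by
  intro j
  obtain ⟨n, hn⟩ := coAct_mem_coweightLattice P u⁻¹ μ.2 j
  have hpos := h j
  rw [simpleAffRoot, nodeRoot, nodeLevel,
    isPosAffRoot_translation_mul_ofWeyl_smul_iff (n := -n) (by simpa using hn)] at hpos
  lift -n to ℕ using by omega with n' hn'
  exact ⟨n', by rw [hn, ← Int.cast_natCast, hn', Int.cast_neg, neg_neg]⟩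

variable [P.IsCrystallographic] [P.IsReduced]

lemma IsShortestAntidominant.isGrassmannian {s : AffineNode b} {u : P.weylGroup}
    (hu : IsShortestAntidominant b s u) :
    IsGrassmannian b (translation P (fundCoweight b s) * ofWeyl P u) := by
  intro j
  obtain ⟨n, hn⟩ := hu.1 j
  rw [simpleAffRoot, nodeRoot, nodeLevel, isPosAffRoot_translation_mul_ofWeyl_smul_iff (n := n) hn]
  rcases Nat.eq_zero_or_pos n with rfl | hpos
  swap
  · exact Or.inl (by exact_mod_cast hpos)
  refine Or.inr ⟨rfl, ?_⟩
  -- If `α_j` is orthogonal to `u⁻¹ ϖ_s^∨`, then `u s_j` also makes `ϖ_s^∨` anti-dominant.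
  by_contra hneg
  have hR := weylGen_rootedGenerators b
  have hshorter := hR.genLength_mul_of_not_pos (mem_closure_weylGen b u) (j := j) (by
    rwa [weylGroup_apply_root, isPosRoot_root_iff])
  have hle := hu.2 (u * weylGen b j) (by
    rw [mul_inv_rev, coAct_mul, hR.inv_eq, weylGen, coAct_ofIdx, hn]
    simpa using hu.1)
  rw [weylLength_eq_genLength, weylLength_eq_genLength] at hle
  omega

lemma exists_isShortestAntidominant (s : AffineNode b) : ∃ u, IsShortestAntidominant b s u := by
  obtain ⟨u, hu⟩ := exists_isGrassmannian (b := b) (translation P (fundCoweight b s))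
  obtain ⟨v, hv, hmin⟩ := exists_minimalFor_of_wellFoundedLT
    (fun u => IsAntidominant b (coAct P u⁻¹ (fundCoweight b s))) (weylLength b)
    ⟨u, hu.isAntidominant⟩
  exact ⟨v, hv, fun w hw => (le_total _ _).elim id (hmin hw)⟩

lemma existsUnique_isShortestAntidominant (s : AffineNode b) :
    ∃! u, IsShortestAntidominant b s u :=
  existsUnique_of_exists_of_unique (exists_isShortestAntidominant s) fun _ _ hu hv =>
    hu.isGrassmannian.eq_of_mul hv.isGrassmannian

lemma isGrassmannian_piElt (s : AffineNode b) : IsGrassmannian b (piElt b s) :=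
  (Classical.epsilon_spec (exists_isShortestAntidominant s)).isGrassmannian

end ShortestAntidominant

section Marks

open RootPairing
open scoped ComplexOrder

variable {ι M N : Type*} [AddCommGroup M] [Module ℂ M] [AddCommGroup N] [Module ℂ N]
  {P : RootPairing ι ℂ M N} [P.IsRootSystem] (b : P.Base) [Finite ι] [P.IsIrreducible]

/-- The marks of the affine Dynkin diagram: the coefficients, normalized by `m_0 = 1`, of the linear
relation between the roots attached to the affine nodes. -/
noncomputable def mark : AffineNode b → ℂ
  | none => 1
  | some j => P.toLinearMap (P.root (highestRoot b)) (fundCoweight b (some j) : N)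

variable {b}

lemma root_nodeRoot_none : P.root (nodeRoot b none) = -P.root (highestRoot b) := by
  rw [nodeRoot, P.root_reflectionPerm, P.reflection_apply_self]

lemma sum_mark_smul_root_nodeRoot : ∑ k, mark b k • P.root (nodeRoot b k) = 0 := by
  have hθ := eq_sum_pairing_fundCoweight (b := b) (P.root (highestRoot b))
  rw [Fintype.sum_option, root_nodeRoot_none, mark, one_smul, neg_add_eq_zero]
  exact hθ

lemma eq_mul_mark_of_sum_smul_eq_zero {c : AffineNode b → ℂ}
    (hc : ∑ k, c k • P.root (nodeRoot b k) = 0) (k : AffineNode b) : c k = c none * mark b k := by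
  classical
  rcases k with _ | j
  · rw [mark, mul_one]
  have hpair := congr_arg (fun m => P.toLinearMap m (fundCoweight b (some j) : N)) hc
  rw [Fintype.sum_option, root_nodeRoot_none] at hpair
  simp only [nodeRoot, map_add, map_sum, map_smul, LinearMap.add_apply,
    LinearMap.sum_apply, LinearMap.smul_apply, pairing_root_fundCoweight, map_neg,
    LinearMap.neg_apply, Option.some.injEq, smul_eq_mul, mul_ite, mul_one, mul_zero,
    Finset.sum_ite_eq', Finset.mem_univ, if_true, map_zero, LinearMap.zero_apply] at hpair
  rw [mark]
  linear_combination hpair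

lemma IsDiagramAut.sum_mark_smul_root {σ : Equiv.Perm (AffineNode b)} (hσ : IsDiagramAut b σ) :
    ∑ k, mark b k • P.root (nodeRoot b (σ k)) = 0 := by
  refine weight_ext b fun j => ?_
  have hpair := congr_arg (fun m => P.toLinearMap m (P.coroot (nodeRoot b (σ.symm (some j)))))
    (sum_mark_smul_root_nodeRoot (b := b))
  have hcartan (k : AffineNode b) : P.pairing (nodeRoot b (σ k)) j =
      P.pairing (nodeRoot b k) (nodeRoot b (σ.symm (some j))) := by
    rw [← hσ, Equiv.apply_symm_apply]
    rfl
  simp only [map_sum, map_smul, LinearMap.sum_apply, LinearMap.smul_apply,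
    P.root_coroot_eq_pairing, map_zero, LinearMap.zero_apply, hcartan] at hpair ⊢
  exact hpair

variable [P.IsCrystallographic] [P.IsReduced]

lemma exists_mark_eq_natCast (s : AffineNode b) : ∃ n : ℕ, mark b s = n := by
  rcases s with _ | j
  · exact ⟨1, Nat.cast_one.symm⟩
  obtain ⟨n, hn⟩ := (fundCoweight b (some j)).2 (highestRoot b)
  have hnonneg := pairing_fundCoweight_nonneg (some j)
    ((Base.isPos_iff b).2 (height_highestRoot_pos b))
  rw [hn, Int.cast_nonneg_iff] at hnonneg
  lift n to ℕ using hnonneg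
  exact ⟨n, by rw [mark, hn, Int.cast_natCast]⟩

-- A diagram automorphism turns the relation between the roots into another one, so it rescales the
-- marks, by a factor whose product with the mark of the image of `0` is `1`.
lemma IsSpecial.mark_eq_one {s : AffineNode b} (hs : IsSpecial b s) : mark b s = 1 := by
  obtain ⟨σ, hσ, rfl⟩ := hs
  have hrel : ∑ k, mark b (σ.symm k) • P.root (nodeRoot b k) = 0 := by
    rw [← hσ.sum_mark_smul_root, ← Equiv.sum_comp σ]
    simp only [Equiv.symm_apply_apply]
  have hscale := eq_mul_mark_of_sum_smul_eq_zero hrel (σ none)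
  obtain ⟨m, hm⟩ := exists_mark_eq_natCast (σ.symm none)
  obtain ⟨n, hn⟩ := exists_mark_eq_natCast (σ none)
  rw [Equiv.symm_apply_apply, hm, hn, mark] at hscale
  have hmul : m * n = 1 := by exact_mod_cast hscale.symm
  rw [hn, Nat.eq_one_of_mul_eq_one_left hmul, Nat.cast_one]

lemma IsSpecial.pairing_smul_highestRoot_le_one {s : AffineNode b} (hs : IsSpecial b s)
    (w : P.weylGroup) :
    P.toLinearMap (w • P.root (highestRoot b)) (fundCoweight b s : N) ≤ 1 := by
  refine (pairing_smul_le_of_dominant b (fun j => ?_)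
    (fun k hk => pairing_fundCoweight_nonneg s hk) w).trans ?_
  · have hnonneg := pairingIn_highestRoot_nonneg b (b.isPos_of_mem_support j.2)
    rw [P.root_coroot_eq_pairing, ← cast_pairingIn, Int.cast_nonneg_iff]
    by_contra! hneg
    exact hnonneg.not_gt ((P.pairingIn_lt_zero_iff ℤ).1 hneg)
  · rcases s with _ | j
    · simp [fundCoweight]
    · exact hs.mark_eq_one.le

lemma isLengthZero_piElt {s : AffineNode b} (hs : IsSpecial b s) : IsLengthZero b (piElt b s) := by
  rintro (_ | j)
  swap
  · exact isGrassmannian_piElt s j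
  set β := P.weylGroupToPerm (uElt b s) (highestRoot b) with hβ
  obtain ⟨n, hn⟩ := (fundCoweight b s).2 β
  have hsmul : piElt b s • simpleAffRoot b none = affRoot P (P.reflectionPerm β β) (1 + n) := by
    have hneg : simpleAffRoot b none = -affRoot P (highestRoot b) (-1) := by
      rw [neg_affRoot, neg_neg]
      rfl
    have hβ' : affRoot P (P.reflectionPerm β β) (1 + n) = -affRoot P β (-1 - n) := by
      rw [neg_affRoot, neg_sub, sub_neg_eq_add, add_comm]
    rw [hneg, hβ', smul_neg, piElt, mul_smul, ofWeyl_smul_affRoot, ← hβ, translation_smul]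
    simp [affRoot, hn]
  have hge : -n ≤ 1 := by
    have hle := hs.pairing_smul_highestRoot_le_one (uElt b s * weylGroup.ofIdx P (highestRoot b))
    rw [mul_smul, ofIdx_smul_root, P.root_reflectionPerm, P.reflection_apply_self, smul_neg,
      weylGroup_apply_root, ← hβ, map_neg, LinearMap.neg_apply, hn] at hle
    exact_mod_cast hle
  rw [hsmul, isPosAffRoot_affRoot_iff, isPos_reflectionPerm_self_iff]
  by_cases hpos : b.IsPos β
  · have hnonneg := pairing_fundCoweight_nonneg s hpos
    rw [hn, Int.cast_nonneg_iff] at hnonneg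
    omega
  · have : 0 < 1 + n ∨ 1 + n = 0 := by omega
    tauto

end Marks

section SpecialNodes

open RootPairing

variable {ι M N : Type*} [AddCommGroup M] [Module ℂ M] [AddCommGroup N] [Module ℂ N]
  {P : RootPairing ι ℂ M N} [P.IsRootSystem] {b : P.Base}

lemma piElt_left (s : AffineNode b) : (piElt b s).left.toAdd = fundCoweight b s := by
  simp [piElt, translation, ofWeyl]

lemma piElt_right (s : AffineNode b) : (piElt b s).right = uElt b s := by
  simp [piElt, translation, ofWeyl]

variable [Finite ι] [P.IsIrreducible]

lemma isSpecialFor_iff (i : b.support) (s : AffineNode b) : IsSpecialFor b i s ↔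
    IsSpecial b s ∧ (piElt b s)⁻¹ * translation P (fundCoweight b (some i)) ∈ affineWeyl P := by
  rw [inv_mul_mem_affineWeyl_iff, piElt_left]
  rfl

variable [P.IsCrystallographic] [P.IsReduced]

lemma IsLengthZero.exists_eq_piElt {x : ExtWeyl P} (hx : IsLengthZero b x) :
    ∃ s, IsSpecial b s ∧ x = piElt b s := by
  obtain ⟨σ, hσ⟩ := hx.exists_perm
  refine ⟨σ none, ⟨σ, isDiagramAut_of_smul_simpleAffRoot hσ, rfl⟩, ?_⟩
  have hxeq : translation P (fundCoweight b (σ none)) * ofWeyl P x.right = x := by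
    rw [← left_eq_fundCoweight hσ, translation_mul_ofWeyl]
  have hright : x.right = uElt b (σ none) :=
    IsGrassmannian.eq_of_mul (hxeq.symm ▸ hx.isGrassmannian) (isGrassmannian_piElt (σ none))
  rw [← hxeq, hright, piElt]

lemma mem_sigmaSet_iff (x : ExtWeyl P) : x ∈ sigmaSet b ↔ IsLengthZero b x := by
  refine ⟨?_, IsLengthZero.exists_eq_piElt⟩
  rintro ⟨s, hs, rfl⟩
  exact isLengthZero_piElt hs

lemma existsUnique_isSpecialFor (i : b.support) : ∃! s, IsSpecialFor b i s := by
  refine existsUnique_of_exists_of_unique ?_ fun s t hs ht => ?_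
  · obtain ⟨π, v, hπ, hv, htrans⟩ :=
      exists_eq_isLengthZero_mul b (translation P (fundCoweight b (some i)))
    obtain ⟨s, hs, rfl⟩ := hπ.exists_eq_piElt
    exact ⟨s, (isSpecialFor_iff i s).2 ⟨hs, by rwa [htrans, inv_mul_cancel_left]⟩⟩
  · rw [isSpecialFor_iff] at hs ht
    have hmem := mul_mem hs.2 (inv_mem ht.2)
    rw [mul_inv_rev, inv_inv, mul_assoc, mul_inv_cancel_left] at hmem
    have heq := (isLengthZero_piElt hs.1).eq_of_inv_mul_mem (isLengthZero_piElt ht.1) hmem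
    exact fundCoweight_injective (by rw [← piElt_left, ← piElt_left, heq])

lemma isSpecialFor_specialNode (i : b.support) : IsSpecialFor b i (specialNode b i) :=
  Classical.epsilon_spec (existsUnique_isSpecialFor i).exists

lemma isLengthZero_piElt_specialNode (i : b.support) :
    IsLengthZero b (piElt b (specialNode b i)) :=
  isLengthZero_piElt (isSpecialFor_specialNode i).1

end SpecialNodes

section Length

open RootPairing

variable {ι M N : Type*} [AddCommGroup M] [Module ℂ M] [AddCommGroup N] [Module ℂ N]
  {P : RootPairing ι ℂ M N} [P.IsRootSystem] {b : P.Base} [Finite ι] [P.IsIrreducible]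
  [P.IsCrystallographic] [P.IsReduced] {x v : ExtWeyl P}

lemma IsLengthZero.decomp_mul (hx : IsLengthZero b x) (hv : v ∈ affineWeyl P) :
    decomp b (x * v) = (x, v) := by
  obtain ⟨hfst, hsnd, heq⟩ := Classical.epsilon_spec (p := fun p : ExtWeyl P × ExtWeyl P =>
    p.1 ∈ sigmaSet b ∧ p.2 ∈ affineWeyl P ∧ x * v = p.1 * p.2)
    ⟨(x, v), (mem_sigmaSet_iff x).2 hx, hv, rfl⟩
  obtain ⟨hx', hv'⟩ := hx.eq_and_eq_of_mul_eq ((mem_sigmaSet_iff _).1 hfst) hv hsnd heq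
  exact (Prod.ext hx' hv').symm

lemma IsLengthZero.extLength_mul (hx : IsLengthZero b x) (hv : v ∈ affineWeyl P) :
    extLength b (x * v) = affLength b v := by
  have hset : {n | ∃ σ ∈ sigmaSet b, ∃ w ∈ affineWeyl P, x * v = σ * w ∧ affLength b w = n} =
      {affLength b v} := by
    refine Set.eq_singleton_iff_unique_mem.2
      ⟨⟨x, (mem_sigmaSet_iff x).2 hx, v, hv, rfl, rfl⟩, ?_⟩
    rintro _ ⟨σ, hσ, w, hw, heq, rfl⟩
    rw [(hx.eq_and_eq_of_mul_eq ((mem_sigmaSet_iff σ).1 hσ) hv hw heq).2]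
  rw [extLength, hset, csInf_singleton]

lemma isGrassmannian_of_forall_affLength_le (hx : x ∈ affineWeyl P)
    (h : ∀ u : P.weylGroup, affLength b x ≤ affLength b (x * ofWeyl P u)) :
    IsGrassmannian b x := by
  intro j
  by_contra hneg
  have hshorter := (affine_rootedGenerators b).genLength_mul_of_not_pos
    ((mem_affineWeyl_iff_mem_closure b x).1 hx) hneg
  have hle : genLength (simpleReflection b) x ≤
    genLength (simpleReflection b) (x * simpleReflection b (some j)) := h (weylGen b j)
  omega

lemma mem_affGrassmannian_iff : x ∈ affGrassmannian b ↔ x ∈ affineWeyl P ∧ IsGrassmannian b x := by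
  refine and_congr_right fun hx => ⟨isGrassmannian_of_forall_affLength_le hx, fun h => ?_⟩
  obtain ⟨u, hmin⟩ : ∃ u, ∀ w, affLength b (x * ofWeyl P u) ≤ affLength b (x * ofWeyl P w) :=
    ⟨_, fun w => Function.argmin_le (fun u => affLength b (x * ofWeyl P u)) w⟩
  have hu : u = 1 := h.eq_one <| isGrassmannian_of_forall_affLength_le
    (mul_mem hx (ofWeyl_mem_affineWeyl u)) fun w => by
      rw [mul_assoc, ← map_mul]
      exact hmin _
  simpa [hu] using hmin

lemma mem_extGrassmannian_iff : x ∈ extGrassmannian b ↔ IsGrassmannian b x := by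
  obtain ⟨π, v, hπ, hv, rfl⟩ := exists_eq_isLengthZero_mul b x
  have haff : π * v ∈ extGrassmannian b ↔ v ∈ affGrassmannian b := by
    refine .trans (forall_congr' fun u => ?_) (and_iff_right hv).symm
    rw [mul_assoc, hπ.extLength_mul hv, hπ.extLength_mul (mul_mem hv (ofWeyl_mem_affineWeyl u))]
  rw [haff, mem_affGrassmannian_iff, and_iff_right hv, hπ.isGrassmannian_mul_iff]

end Length

section Kappa

open RootPairing

variable {ι M N : Type*} [AddCommGroup M] [Module ℂ M] [AddCommGroup N] [Module ℂ N]
  {P : RootPairing ι ℂ M N} [P.IsRootSystem] {b : P.Base} [Finite ι] [P.IsIrreducible]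

open scoped Classical in
lemma translation_zsmul_fundCoweight_smul (n : ℤ) (i j : b.support) :
    translation P (n • fundCoweight b (some i)) • simpleAffRoot b (some j) =
      affRoot P j (if j = i then -n else 0) := by
  rw [translation_smul]
  simp [simpleAffRoot, nodeRoot, nodeLevel, affRoot, pairing_root_fundCoweight,
    apply_ite (Int.cast : ℤ → ℂ), apply_ite (Neg.neg : ℂ → ℂ)]

lemma translation_neg_fundCoweight_smul_self (i : b.support) :
    translation P (-fundCoweight b (some i)) • simpleAffRoot b (some i) = affRoot P i 1 := by
  simpa using translation_zsmul_fundCoweight_smul (-1) i i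

lemma translation_neg_fundCoweight_smul_of_ne {i j : b.support} (h : j ≠ i) :
    translation P (-fundCoweight b (some i)) • simpleAffRoot b (some j) =
      simpleAffRoot b (some j) := by
  have hsmul := translation_zsmul_fundCoweight_smul (-1) i j
  rwa [neg_one_zsmul, if_neg h] at hsmul

lemma isGrassmannian_translation_neg_fundCoweight [P.IsReduced] (i : b.support) :
    IsGrassmannian b (translation P (-fundCoweight b (some i))) := by
  intro j
  rcases eq_or_ne j i with rfl | hj
  · rw [translation_neg_fundCoweight_smul_self, isPosAffRoot_affRoot_iff]
    exact Or.inl one_pos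
  · rw [translation_neg_fundCoweight_smul_of_ne hj]
    exact isPosAffRoot_simpleAffRoot b (some j)

variable [P.IsCrystallographic] [P.IsReduced]

lemma kappa_mem_affineWeyl (i : b.support) : kappa b i ∈ affineWeyl P := by
  have hmem := neg_mem (isSpecialFor_specialNode i).2
  rw [neg_sub, sub_eq_add_neg] at hmem
  rwa [kappa, mul_mem_affineWeyl_iff, piElt_left]

lemma kappa_mem_affGrassmannian (i : b.support) : kappa b i ∈ affGrassmannian b :=
  mem_affGrassmannian_iff.2 ⟨kappa_mem_affineWeyl i,
    (isLengthZero_piElt_specialNode i).isGrassmannian_mul_iff.2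
      (isGrassmannian_translation_neg_fundCoweight i)⟩

end Kappa

section TwistedAlgebra

variable {ι M N : Type*} [AddCommGroup M] [Module ℂ M] [AddCommGroup N] [Module ℂ N]
  {P : RootPairing ι ℂ M N}

lemma scalar_mul_scalar (f g : SReg P) : scalar P f * scalar P g = scalar P (f * g) := by
  simp [scalar, SkewMonoidAlgebra.single_mul_single]

lemma scalar_one : scalar P 1 = 1 := rfl

lemma scalar_zero : scalar P 0 = 0 := SkewMonoidAlgebra.single_zero _

lemma scalar_add (f g : SReg P) : scalar P (f + g) = scalar P f + scalar P g :=
  SkewMonoidAlgebra.single_add _ _ _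

lemma scalar_neg (f : SReg P) : scalar P (-f) = -scalar P f :=
  SkewMonoidAlgebra.single_neg _ _

lemma grp_one : grp P 1 = 1 := rfl

lemma grp_mul_grp (x y : ExtWeyl P) : grp P x * grp P y = grp P (x * y) := by
  simp [grp, SkewMonoidAlgebra.single_mul_single]

lemma grp_mul_scalar (x : ExtWeyl P) (f : SReg P) :
    grp P x * scalar P f = scalar P (x • f) * grp P x := by
  simp [grp, scalar, SkewMonoidAlgebra.single_mul_single]

lemma conj_mul (u : P.weylGroup) (a c : TwistedAlg P) :
    conj P u (a * c) = conj P u a * conj P u c := by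
  have hcancel : grp P (ofWeyl P u)⁻¹ * grp P (ofWeyl P u) = 1 := by
    rw [grp_mul_grp, inv_mul_cancel, grp_one]
  simp only [conj, mul_assoc]
  rw [← mul_assoc (grp P _⁻¹) (grp P _), hcancel, one_mul]

lemma single_eq_scalar_mul_grp (x : ExtWeyl P) (f : SReg P) :
    (SkewMonoidAlgebra.single x f : TwistedAlg P) = scalar P f * grp P x := by
  simp [grp, scalar, SkewMonoidAlgebra.single_mul_single]

lemma smul_eq_scalar_mul (f : SRing P) (a : TwistedAlg P) :
    f • a = scalar P (algebraMap (SRing P) (SReg P) f) * a := by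
  ext x
  rw [scalar, SkewMonoidAlgebra.coeff_single_one_mul]
  simp [Algebra.smul_def]

lemma scalar_mul_mem {V : Submodule (SRing P) (TwistedAlg P)} {a : TwistedAlg P} (ha : a ∈ V)
    (f : SRing P) : scalar P (algebraMap _ _ f) * a ∈ V := by
  rw [← smul_eq_scalar_mul]
  exact V.smul_mem f ha

variable (P) in
/-- A weight `m`, as a linear form in `S^reg`. -/
noncomputable def regWeight (m : M) : SReg P :=
  algebraMap (SRing P) (SReg P) (SymmetricAlgebra.ι ℂ M m)

variable (P) in
/-- A complex number, as a constant in `S^reg`. -/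
noncomputable def regConst (c : ℂ) : SReg P :=
  algebraMap (SRing P) (SReg P) (algebraMap ℂ (SRing P) c)

lemma regWeight_sub (m m' : M) : regWeight P (m - m') = regWeight P m - regWeight P m' := by
  simp [regWeight]

lemma regWeight_neg (m : M) : regWeight P (-m) = -regWeight P m := by simp [regWeight]

lemma regWeight_smul (c : ℂ) (m : M) : regWeight P (c • m) = regConst P c * regWeight P m := by
  simp [regWeight, regConst, Algebra.smul_def]

lemma ext_smul_algebraMap (x : ExtWeyl P) (f : SRing P) :
    x • algebraMap (SRing P) (SReg P) f = algebraMap _ _ (symAct P x.right f) :=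
  regAct_algebraMap P _ f

lemma ext_smul_regWeight (x : ExtWeyl P) (m : M) :
    x • regWeight P m = regWeight P (x.right • m) := by
  rw [regWeight, ext_smul_algebraMap, symAct_ι, regWeight]

lemma ext_smul_regConst (x : ExtWeyl P) (c : ℂ) : x • regConst P c = regConst P c := by
  rw [regConst, ext_smul_algebraMap, AlgHom.commutes]

lemma rootInv_mul_regWeight (k : ι) : rootInv P k * regWeight P (P.root k) = 1 := by
  have hspec := IsLocalization.mk'_spec (SReg P) (1 : SRing P)
    (⟨rootS P k, Submonoid.subset_closure ⟨k, rfl⟩⟩ : rootMonoid P)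
  rwa [map_one] at hspec

lemma eq_rootInv_of_mul_regWeight {f : SReg P} {k : ι} (h : f * regWeight P (P.root k) = 1) :
    f = rootInv P k :=
  left_inv_eq_right_inv h (by rw [mul_comm, rootInv_mul_regWeight])

lemma ext_smul_rootInv {x : ExtWeyl P} {j k : ι} (h : x.right • P.root j = P.root k) :
    x • rootInv P j = rootInv P k :=
  eq_rootInv_of_mul_regWeight <| by
    rw [← h, ← ext_smul_regWeight, ← smul_mul', rootInv_mul_regWeight, smul_one]

lemma rootInv_reflectionPerm (k : ι) : rootInv P (P.reflectionPerm k k) = -rootInv P k :=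
  (eq_rootInv_of_mul_regWeight <| by
    rw [P.root_reflectionPerm, P.reflection_apply_self, regWeight_neg, neg_mul_neg,
      rootInv_mul_regWeight]).symm

lemma grp_mul_rootInv_mul_one_sub_grp {x s t : ExtWeyl P} {j k : ι}
    (hroot : x.right • P.root j = P.root k) (hconj : x * s = t * x) :
    grp P x * (scalar P (rootInv P j) * (1 - grp P s)) =
      scalar P (rootInv P k) * (1 - grp P t) * grp P x := by
  rw [← mul_assoc, grp_mul_scalar, ext_smul_rootInv hroot, mul_assoc, mul_assoc, mul_sub, sub_mul,
    grp_mul_grp, grp_mul_grp, hconj, mul_one, one_mul]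

omit [AddCommGroup N] [Module ℂ N] in
lemma symmetricAlgebra_ι_injective : Function.Injective (SymmetricAlgebra.ι ℂ M) := by
  refine (injective_iff_map_eq_zero _).2 fun m hm => ?_
  refine (Module.forall_dual_apply_eq_zero_iff ℂ m).1 fun φ => ?_
  rw [← SymmetricAlgebra.lift_ι_apply φ m, hm, map_zero]

lemma rootMonoid_le_nonZeroDivisors : rootMonoid P ≤ nonZeroDivisors (SRing P) := by
  rw [rootMonoid, Submonoid.closure_le]
  rintro _ ⟨k, rfl⟩
  exact mem_nonZeroDivisors_of_ne_zero <|
    (map_ne_zero_iff _ symmetricAlgebra_ι_injective).2 (P.ne_zero k)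

lemma algebraMap_injective : Function.Injective (algebraMap (SRing P) (SReg P)) :=
  IsLocalization.injective (SReg P) rootMonoid_le_nonZeroDivisors

lemma regWeight_injective : Function.Injective (regWeight P) :=
  algebraMap_injective.comp symmetricAlgebra_ι_injective

instance : IsDomain (SReg P) :=
  IsLocalization.isDomain_of_le_nonZeroDivisors (SReg P) (rootMonoid_le_nonZeroDivisors (P := P))

end TwistedAlgebra

section NilGen

variable {ι M N : Type*} [AddCommGroup M] [Module ℂ M] [AddCommGroup N] [Module ℂ N]
  {P : RootPairing ι ℂ M N} [P.IsRootSystem] {b : P.Base} [Finite ι] [P.IsIrreducible]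
  [P.IsCrystallographic]

lemma simpleReflection_right_smul (j : AffineNode b) (m : M) :
    (simpleReflection b j).right • m =
      m - P.toLinearMap m (P.coroot (nodeRoot b j)) • P.root (nodeRoot b j) :=
  congr_arg Prod.fst (simpleReflection_smul b j (m, 0))

lemma simpleReflection_smul_rootInv (j : AffineNode b) :
    simpleReflection b j • rootInv P (nodeRoot b j) = -rootInv P (nodeRoot b j) := by
  rw [← rootInv_reflectionPerm]
  apply ext_smul_rootInv
  rw [simpleReflection_right_smul, P.root_coroot_two, two_smul, sub_add_cancel_left,
    P.root_reflectionPerm, P.reflection_apply_self]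

lemma grp_simpleReflection (j : AffineNode b) : grp P (simpleReflection b j) =
    1 - scalar P (regWeight P (P.root (nodeRoot b j))) * nilGen b j := by
  rw [nilGen, ← mul_assoc, scalar_mul_scalar, mul_comm (regWeight _ _), rootInv_mul_regWeight,
    scalar_one, one_mul, sub_sub_cancel]

lemma grp_mul_nilGen (j : AffineNode b) :
    grp P (simpleReflection b j) * nilGen b j = nilGen b j := by
  rw [nilGen, ← mul_assoc, grp_mul_scalar, simpleReflection_smul_rootInv, mul_assoc, mul_sub,
    grp_mul_grp, simpleReflection_mul_self, grp_one, mul_one, scalar_neg, neg_mul, ← mul_neg,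
    neg_sub]

lemma nilGen_mul_self (j : AffineNode b) : nilGen b j * nilGen b j = 0 := by
  conv_lhs => rw [nilGen, mul_assoc, ← nilGen, sub_mul, grp_mul_nilGen, one_mul, sub_self,
    mul_zero]

lemma nilGen_mul_scalar (j : AffineNode b) (f : SReg P) :
    nilGen b j * scalar P f = scalar P (simpleReflection b j • f) * nilGen b j +
      scalar P (rootInv P (nodeRoot b j) * (f - simpleReflection b j • f)) := by
  set s := simpleReflection b j
  set r := rootInv P (nodeRoot b j)
  have hsplit : scalar P (r * (f - s • f)) = scalar P (r * f) - scalar P (r * (s • f)) := by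
    rw [sub_eq_add_neg, mul_add, mul_neg, scalar_add, scalar_neg, sub_eq_add_neg]
  rw [hsplit, nilGen, mul_assoc, sub_mul, grp_mul_scalar, one_mul, mul_sub, ← mul_assoc,
    scalar_mul_scalar, scalar_mul_scalar, ← mul_assoc, scalar_mul_scalar, mul_comm (s • f) r,
    mul_sub, mul_one]
  abel

lemma nilGen_mul_regWeight (j : AffineNode b) (m : M) :
    nilGen b j * scalar P (regWeight P m) =
      scalar P (regWeight P ((simpleReflection b j).right • m)) * nilGen b j +
        scalar P (regConst P (P.toLinearMap m (P.coroot (nodeRoot b j)))) := by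
  rw [nilGen_mul_scalar, ext_smul_regWeight, ← regWeight_sub, simpleReflection_right_smul,
    sub_sub_cancel, regWeight_smul, mul_left_comm, rootInv_mul_regWeight, mul_one]

lemma nilGen_mul_regConst (j : AffineNode b) (c : ℂ) :
    nilGen b j * scalar P (regConst P c) = scalar P (regConst P c) * nilGen b j := by
  rw [nilGen_mul_scalar, ext_smul_regConst, sub_self, mul_zero, scalar_zero, add_zero]

lemma rootS_dvd_sub_symAct (j : AffineNode b) (f : SRing P) :
    rootS P (nodeRoot b j) ∣ f - symAct P (simpleReflection b j).right f := by
  set quotMap := Ideal.Quotient.mkₐ ℂ (Ideal.span {rootS P (nodeRoot b j)})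
  have hquot : quotMap = quotMap.comp (symAct P (simpleReflection b j).right) := by
    refine SymmetricAlgebra.algHom_ext (LinearMap.ext fun m => ?_)
    have hroot : quotMap (SymmetricAlgebra.ι ℂ M (P.root (nodeRoot b j))) = 0 :=
      Ideal.Quotient.eq_zero_iff_mem.2 (Ideal.mem_span_singleton_self _)
    simp [symAct_ι, simpleReflection_right_smul, hroot]
  rw [← Ideal.mem_span_singleton, ← Ideal.Quotient.eq]
  exact DFunLike.congr_fun hquot f

lemma exists_nilGen_mul_scalar (j : AffineNode b) (f : SRing P) : ∃ g : SRing P,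
    nilGen b j * scalar P (algebraMap (SRing P) (SReg P) f) =
      scalar P (algebraMap _ _ (symAct P (simpleReflection b j).right f)) * nilGen b j +
        scalar P (algebraMap _ _ g) := by
  obtain ⟨g, hg⟩ := rootS_dvd_sub_symAct j f
  refine ⟨g, ?_⟩
  have hdiv : rootInv P (nodeRoot b j) * algebraMap (SRing P) (SReg P)
      (f - symAct P (simpleReflection b j).right f) = algebraMap _ _ g := by
    rw [hg, map_mul, ← mul_assoc]
    exact (congr_arg (· * _) (rootInv_mul_regWeight _)).trans (one_mul _)
  rw [nilGen_mul_scalar, ext_smul_algebraMap, ← map_sub, hdiv]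

end NilGen

section DihedralWords

variable {G : Type*} [Group G]

lemma exists_eq_zpow_mul_of_mem_closure_pair {x y z : G} (hx : x * x = 1) (hy : y * y = 1)
    (hz : z ∈ Subgroup.closure {x, y}) :
    ∃ n : ℤ, z = (x * y) ^ n ∨ z = (x * y) ^ n * x := by
  have hx_inv : x⁻¹ = x := inv_eq_of_mul_eq_one_left hx
  have hy_inv : y⁻¹ = y := inv_eq_of_mul_eq_one_left hy
  have hconj (n : ℤ) : x * (x * y) ^ n = (x * y) ^ (-n) * x := by
    have hinv : x * (x * y) * x⁻¹ = (x * y)⁻¹ := by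
      rw [← mul_assoc, hx, one_mul, mul_inv_rev, hy_inv]
    rw [zpow_neg, ← inv_zpow, ← hinv, conj_zpow]
    group
  have mul_x {z : G} (hz : ∃ n : ℤ, z = (x * y) ^ n ∨ z = (x * y) ^ n * x) :
      ∃ n : ℤ, x * z = (x * y) ^ n ∨ x * z = (x * y) ^ n * x := by
    obtain ⟨n, rfl | rfl⟩ := hz
    · exact ⟨-n, Or.inr (hconj n)⟩
    · exact ⟨-n, Or.inl (by rw [← mul_assoc, hconj, mul_assoc, hx, mul_one])⟩
  have mul_y {z : G} (hz : ∃ n : ℤ, z = (x * y) ^ n ∨ z = (x * y) ^ n * x) :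
      ∃ n : ℤ, y * z = (x * y) ^ n ∨ y * z = (x * y) ^ n * x := by
    have hyz : y * z = (x * y) ^ (-1 : ℤ) * (x * z) := by
      rw [zpow_neg_one, mul_inv_rev, mul_assoc, inv_mul_cancel_left, hy_inv]
    obtain ⟨n, hn | hn⟩ := mul_x hz
    · exact ⟨-1 + n, Or.inl (by rw [hyz, hn, ← zpow_add])⟩
    · exact ⟨-1 + n, Or.inr (by rw [hyz, hn, ← mul_assoc, ← zpow_add])⟩
  induction hz using Subgroup.closure_induction_left with
  | one => exact ⟨0, Or.inl (zpow_zero _).symm⟩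
  | mul_left g hg z _ ih =>
    rcases hg with rfl | rfl
    · exact mul_x ih
    · exact mul_y ih
  | inv_mul_cancel g hg z _ ih =>
    rcases hg with rfl | rfl
    · exact hx_inv.symm ▸ mul_x ih
    · exact hy_inv.symm ▸ mul_y ih

lemma isOfFinOrder_of_mem_closure_pair {x y z : G} (hx : x * x = 1) (hy : y * y = 1)
    (hxy : IsOfFinOrder (x * y)) (hz : z ∈ Subgroup.closure {x, y}) : IsOfFinOrder z := by
  obtain ⟨n, rfl | rfl⟩ := exists_eq_zpow_mul_of_mem_closure_pair hx hy hz
  · exact hxy.zpow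
  · have hconj : x * (x * y) ^ n * x⁻¹ = ((x * y) ^ n)⁻¹ := by
      rw [← conj_zpow, ← inv_zpow, ← mul_assoc, hx, one_mul, mul_inv_rev,
        inv_eq_of_mul_eq_one_left hy]
    refine isOfFinOrder_iff_pow_eq_one.2 ⟨2, two_pos, ?_⟩
    have hcomm := mul_inv_eq_iff_eq_mul.1 hconj
    rw [pow_two, mul_assoc, ← mul_assoc x, hcomm, mul_assoc, hx, mul_one, mul_inv_cancel]

variable {J : Type*}

/-- The last letter of the alternating word `i j i j …` with `n + 1` letters. -/
def altLast (i j : J) : ℕ → J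
  | 0 => i
  | n + 1 => altLast j i n

lemma altWord_succ (i j : J) (n : ℕ) :
    altWord i j (n + 1) = altWord i j n ++ [altLast i j n] := by
  induction n generalizing i j with
  | zero => rfl
  | succ n ih => rw [altWord, ih]; rfl

lemma eq_or_eq_of_mem_altWord {i j k : J} {n : ℕ} (hk : k ∈ altWord i j n) : k = i ∨ k = j := by
  induction n generalizing i j with
  | zero => cases hk
  | succ n ih =>
    rcases List.mem_cons.1 hk with rfl | hk
    · exact Or.inl rfl
    · exact (ih hk).symm

variable {R : Type*} [MulAction G R] {pos : R → Prop} {a : J → R} {s : J → G}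
  (h : RootedGenerators pos a s)
include h

lemma RootedGenerators.genProd_altWord (i j : J) (n : ℕ) :
    genProd s (altWord i j n) = (s i * s j) ^ n * genProd s (altWord j i n) := by
  induction n generalizing i j with
  | zero => simp [altWord]
  | succ n ih =>
    have hsemi : SemiconjBy (s i) (s j * s i) (s i * s j) := (mul_assoc _ _ _).symm
    rw [altWord, altWord, genProd_cons, genProd_cons, ih j i, ← mul_assoc, (hsemi.pow_right n).eq,
      pow_succ, mul_assoc, mul_assoc, mul_assoc, h.mul_cancel_left]

lemma RootedGenerators.isOfFinOrder_mul {i j : J} {m : ℕ} (hm : 0 < m)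
    (hb : genProd s (altWord i j m) = genProd s (altWord j i m)) : IsOfFinOrder (s i * s j) := by
  rw [h.genProd_altWord, mul_eq_right] at hb
  exact isOfFinOrder_iff_pow_eq_one.2 ⟨m, hm, hb⟩

end DihedralWords

section BraidRelations

variable {ι M N : Type*} [AddCommGroup M] [Module ℂ M] [AddCommGroup N] [Module ℂ N]
  {P : RootPairing ι ℂ M N}

variable (P) in
/-- The sum of the coefficients, i.e. the augmentation of the twisted group algebra. -/
noncomputable def coeffSum : TwistedAlg P →+ SReg P where
  toFun a := a.sum fun _ f => f
  map_zero' := SkewMonoidAlgebra.sum_zero_index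
  map_add' _ _ := SkewMonoidAlgebra.sum_add_index' (fun _ => rfl) (fun _ _ _ => rfl)

lemma coeffSum_single (x : ExtWeyl P) (f : SReg P) :
    coeffSum P (SkewMonoidAlgebra.single x f) = f :=
  SkewMonoidAlgebra.sum_single_index (h := fun _ f => f) rfl

lemma coeffSum_mul_grp (a : TwistedAlg P) (x : ExtWeyl P) :
    coeffSum P (a * grp P x) = coeffSum P a := by
  have hcomp : (coeffSum P).comp (AddMonoidHom.mulRight (grp P x)) = coeffSum P := by
    refine SkewMonoidAlgebra.addHom_ext fun y f => ?_
    simp [grp, SkewMonoidAlgebra.single_mul_single, coeffSum_single]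
  exact DFunLike.congr_fun hcomp a

lemma eq_one_of_isOfFinOrder {z : ExtWeyl P} (hz : z.right = 1) (hfin : IsOfFinOrder z) :
    z = 1 := by
  obtain ⟨n, hn, hpow⟩ := isOfFinOrder_iff_pow_eq_one.1 hfin
  obtain ⟨t, rfl⟩ : ∃ t, z = SemidirectProduct.inl t :=
    ⟨z.left, SemidirectProduct.ext rfl hz⟩
  rw [← map_pow, map_eq_one_iff _ SemidirectProduct.inl_injective] at hpow
  have hsmul : n • ((t.toAdd : coweightLattice P) : N) = 0 := congr_arg Subtype.val hpow
  rw [← Nat.cast_smul_eq_nsmul ℂ, smul_eq_zero, Nat.cast_eq_zero] at hsmul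
  have ht : t = 1 := Subtype.ext (hsmul.resolve_left hn.ne')
  rw [ht, map_one]

lemma right_eq_of_mul_regWeight {D : TwistedAlg P} {w : P.weylGroup}
    (hD : ∀ μ : M, D * scalar P (regWeight P μ) = scalar P (regWeight P (w • μ)) * D)
    {x : ExtWeyl P} (hx : D.coeff x ≠ 0) : x.right = w := by
  refine weyl_ext fun μ => ?_
  have hcoeff := congr_arg (fun a => SkewMonoidAlgebra.coeff a x) (hD μ)
  simp only [scalar, SkewMonoidAlgebra.coeff_mul_single_one,
    SkewMonoidAlgebra.coeff_single_one_mul, ext_smul_regWeight] at hcoeff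
  rw [mul_comm] at hcoeff
  exact regWeight_injective (mul_right_cancel₀ hx hcoeff)

variable [P.IsRootSystem] {b : P.Base} [Finite ι] [P.IsIrreducible] [P.IsCrystallographic]

/-- The product of the nil-Hecke generators along a word. -/
noncomputable def nilProd (b : P.Base) (l : List (AffineNode b)) : TwistedAlg P :=
  (l.map (nilGen b)).prod

@[simp] lemma nilProd_nil : nilProd b [] = 1 := rfl

@[simp] lemma nilProd_cons (j : AffineNode b) (l : List (AffineNode b)) :
    nilProd b (j :: l) = nilGen b j * nilProd b l := by simp [nilProd]

lemma nilProd_append (l l' : List (AffineNode b)) :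
    nilProd b (l ++ l') = nilProd b l * nilProd b l' := by simp [nilProd]

lemma coeffSum_mul_nilGen (a : TwistedAlg P) (j : AffineNode b) :
    coeffSum P (a * nilGen b j) = 0 := by
  rw [nilGen, ← mul_assoc, mul_sub, mul_one, map_sub, coeffSum_mul_grp, sub_self]

lemma coeff_nilGen_mul (j : AffineNode b) (a : TwistedAlg P) (x : ExtWeyl P) :
    (nilGen b j * a).coeff x = rootInv P (nodeRoot b j) *
      (a.coeff x - simpleReflection b j • a.coeff ((simpleReflection b j)⁻¹ * x)) := by
  rw [nilGen, mul_assoc, scalar, SkewMonoidAlgebra.coeff_single_one_mul, sub_mul, one_mul,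
    SkewMonoidAlgebra.coeff_sub, grp]
  simp only [Finsupp.sub_apply, SkewMonoidAlgebra.coeff_single_mul, one_mul]

lemma mem_of_coeff_nilProd_ne_zero {H : Subgroup (ExtWeyl P)} {l : List (AffineNode b)}
    (hl : ∀ j ∈ l, simpleReflection b j ∈ H) {x : ExtWeyl P}
    (hx : (nilProd b l).coeff x ≠ 0) : x ∈ H := by
  induction l generalizing x with
  | nil =>
    rw [nilProd_nil, SkewMonoidAlgebra.coeff_one] at hx
    by_contra hxH
    exact hx (Finsupp.single_eq_of_ne fun h => hxH (h ▸ one_mem _))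
  | cons j l ih =>
    have hj := hl j List.mem_cons_self
    replace ih {y} := ih (fun k hk => hl k (List.mem_cons_of_mem j hk)) (x := y)
    by_contra hxH
    rw [nilProd_cons, coeff_nilGen_mul, not_ne_iff.1 (mt ih hxH),
      not_ne_iff.1 (mt ih (mt (H.mul_mem_cancel_left (inv_mem hj)).1 hxH)), smul_zero, sub_zero,
      mul_zero] at hx
    exact hx rfl

lemma nilProd_altWord_mul_regWeight (i j : AffineNode b) (n : ℕ) (m : M) :
    nilProd b (altWord i j (n + 2)) * scalar P (regWeight P m) =
      scalar P (regWeight P ((genProd (simpleReflection b) (altWord i j (n + 2))).right • m)) *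
          nilProd b (altWord i j (n + 2)) +
        scalar P (regConst P (P.toLinearMap
          ((genProd (simpleReflection b) (altWord j i (n + 1))).right • m)
            (P.coroot (nodeRoot b i)))) * nilProd b (altWord j i (n + 1)) +
        scalar P (regConst P (P.toLinearMap m (P.coroot (nodeRoot b (altLast i j (n + 1)))))) *
          nilProd b (altWord i j (n + 1)) := by
  induction n generalizing i j with
  | zero =>
    simp only [altWord, nilProd_cons, nilProd_nil, mul_one, genProd_cons, genProd_nil, altLast]
    rw [mul_assoc, nilGen_mul_regWeight, mul_add, ← mul_assoc, nilGen_mul_regWeight,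
      nilGen_mul_regConst]
    simp only [SemidirectProduct.mul_right, mul_smul, add_mul, mul_assoc]
  | succ n ih =>
    have hzero : nilGen b i * nilProd b (altWord i j (n + 1)) = 0 := by
      rw [altWord, nilProd_cons, ← mul_assoc, nilGen_mul_self, zero_mul]
    rw [altWord, nilProd_cons, mul_assoc, ih, mul_add, mul_add, ← mul_assoc (nilGen b i),
      nilGen_mul_regWeight, ← mul_assoc (nilGen b i), nilGen_mul_regConst,
      ← mul_assoc (nilGen b i), nilGen_mul_regConst, mul_assoc (scalar P _) (nilGen b i),
      hzero, mul_zero, add_zero]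
    simp only [genProd_cons, SemidirectProduct.mul_right, mul_smul, add_mul, mul_assoc, altLast]
    rfl

variable [P.IsReduced]

lemma pairing_genProd_altWord_smul {i j : AffineNode b} {n : ℕ}
    (hb : genProd (simpleReflection b) (altWord i j (n + 1)) =
      genProd (simpleReflection b) (altWord j i (n + 1)))
    (hred : IsReduced (simpleReflection b) (altWord i j (n + 1))) (m : M) :
    P.toLinearMap ((genProd (simpleReflection b) (altWord j i n)).right • m)
      (P.coroot (nodeRoot b i)) =
    P.toLinearMap m (P.coroot (nodeRoot b (altLast j i n))) := by
  have hR := affine_rootedGenerators b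
  set x := genProd (simpleReflection b) (altWord j i n) with hx
  have hleft : genProd (simpleReflection b) (altWord i j (n + 1)) = simpleReflection b i * x :=
    genProd_cons ..
  have hright : genProd (simpleReflection b) (altWord i j (n + 1)) =
      x * simpleReflection b (altLast j i n) := by
    rw [hb, altWord_succ, genProd_append, genProd_cons, genProd_nil, mul_one]
  have hpos : IsPosAffRoot b (x • simpleAffRoot b (altLast j i n)) := by
    by_contra hneg
    have hlen : genLength (simpleReflection b) x ≤ n :=
      (genLength_genProd_le _ _).trans_eq (length_altWord j i n)
    have hdesc := hR.genLength_mul_of_not_pos (genProd_mem_closure _ _) hneg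
    rw [← hx, ← hright, hred, length_altWord] at hdesc
    omega
  have hsimple : x • simpleAffRoot b (altLast j i n) = simpleAffRoot b i := by
    apply hR.eq_simple hpos
    rwa [← mul_smul, ← hleft, hright, hR.pos_mul_smul_simple, not_not]
  exact pairing_smul_coroot (congr_arg Prod.fst hsimple) m

section

variable {i j : AffineNode b} {m : ℕ}
  (hb : genProd (simpleReflection b) (altWord i j m) =
    genProd (simpleReflection b) (altWord j i m))
include hb

lemma nilProd_altWord_sub_mul_regWeight (hm : 2 ≤ m)
    (hred : IsReduced (simpleReflection b) (altWord i j m)) (μ : M) :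
    (nilProd b (altWord i j m) - nilProd b (altWord j i m)) * scalar P (regWeight P μ) =
      scalar P (regWeight P ((genProd (simpleReflection b) (altWord i j m)).right • μ)) *
        (nilProd b (altWord i j m) - nilProd b (altWord j i m)) := by
  obtain ⟨n, rfl⟩ := Nat.exists_eq_add_of_le' hm
  have hred' : IsReduced (simpleReflection b) (altWord j i (n + 2)) :=
    hred.of_genProd_eq hb (by rw [length_altWord, length_altWord])
  rw [sub_mul, nilProd_altWord_mul_regWeight, nilProd_altWord_mul_regWeight, ← hb,
    pairing_genProd_altWord_smul hb hred, pairing_genProd_altWord_smul hb.symm hred', mul_sub]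
  abel

lemma coeff_nilProd_altWord_sub (hm : 2 ≤ m)
    (hred : IsReduced (simpleReflection b) (altWord i j m)) {x : ExtWeyl P}
    (hx : x ≠ genProd (simpleReflection b) (altWord i j m)) :
    (nilProd b (altWord i j m) - nilProd b (altWord j i m)).coeff x = 0 := by
  have hR := affine_rootedGenerators b
  by_contra hcoeff
  set H := Subgroup.closure {simpleReflection b i, simpleReflection b j}
  have hi : simpleReflection b i ∈ H := Subgroup.subset_closure (Set.mem_insert _ _)
  have hj : simpleReflection b j ∈ H := Subgroup.subset_closure (Set.mem_insert_of_mem _ rfl)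
  have hij : ∀ k ∈ altWord i j m, simpleReflection b k ∈ H := fun k hk => by
    obtain rfl | rfl := eq_or_eq_of_mem_altWord hk <;> assumption
  have hji : ∀ k ∈ altWord j i m, simpleReflection b k ∈ H := fun k hk => by
    obtain rfl | rfl := eq_or_eq_of_mem_altWord hk <;> assumption
  have hxH : x ∈ H := by
    by_contra hxH
    rw [SkewMonoidAlgebra.coeff_sub, Finsupp.sub_apply,
      not_ne_iff.1 (mt (mem_of_coeff_nilProd_ne_zero hij) hxH),
      not_ne_iff.1 (mt (mem_of_coeff_nilProd_ne_zero hji) hxH), sub_zero] at hcoeff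
    exact hcoeff rfl
  have hwH : genProd (simpleReflection b) (altWord i j m) ∈ H :=
    Subgroup.list_prod_mem _ (by simpa using hij)
  have hright := right_eq_of_mul_regWeight (nilProd_altWord_sub_mul_regWeight hb hm hred) hcoeff
  refine hx (mul_inv_eq_one.1 (eq_one_of_isOfFinOrder (by simp [hright]) ?_))
  exact isOfFinOrder_of_mem_closure_pair (hR.mul_self i) (hR.mul_self j)
    (hR.isOfFinOrder_mul (two_pos.trans_le hm) hb) (mul_mem hxH (inv_mem hwH))

end

/- The difference of the two alternating products commutes with weights like `w`, so it is
supported on `w` alone; its single coefficient vanishes since the augmentation kills `A_i`. -/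
lemma satisfiesBraidRelations_nilGen :
    SatisfiesBraidRelations (simpleReflection b) (nilGen b) := by
  intro i j m hij hb hred
  rcases m with _ | _ | n
  · rfl
  · simp only [altWord, genProd_cons, genProd_nil, mul_one] at hb
    exact absurd (simpleAffRoot_injective ((affine_rootedGenerators b).simple_eq_of_eq hb)) hij
  change nilProd b _ = nilProd b _
  rw [← sub_eq_zero]
  set w := genProd (simpleReflection b) (altWord i j (n + 2))
  set D := nilProd b (altWord i j (n + 2)) - nilProd b (altWord j i (n + 2)) with hD
  have hsingle : D = SkewMonoidAlgebra.single w (D.coeff w) := by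
    ext x
    by_cases hx : x = w
    · rw [hx]; simp
    · rw [coeff_nilProd_altWord_sub hb (Nat.le_add_left 2 n) hred hx,
        SkewMonoidAlgebra.coeff_single, Finsupp.single_eq_of_ne hx]
  have haug : coeffSum P D = 0 := by
    rw [hD, map_sub, altWord_succ i, altWord_succ j, nilProd_append, nilProd_append]
    simp only [nilProd_cons, nilProd_nil, mul_one, coeffSum_mul_nilGen, sub_zero]
  rw [hsingle, coeffSum_single] at haug
  rw [hsingle, haug, SkewMonoidAlgebra.single_zero]

end BraidRelations

section NilBasis

variable {ι M N : Type*} [AddCommGroup M] [Module ℂ M] [AddCommGroup N] [Module ℂ N]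
  {P : RootPairing ι ℂ M N} [P.IsRootSystem] {b : P.Base} [Finite ι] [P.IsIrreducible]
  [P.IsCrystallographic] [P.IsReduced]

section Affine

variable {x y : ExtWeyl P}

lemma exists_reducedWord (b : P.Base) (hx : x ∈ affineWeyl P) :
    ∃ l, IsReduced (simpleReflection b) l ∧ genProd (simpleReflection b) l = x := by
  obtain ⟨l, rfl, hl⟩ := exists_isReduced ((mem_affineWeyl_iff_mem_closure b x).1 hx)
  exact ⟨l, hl.symm, rfl⟩

lemma nilAff_genProd {l : List (AffineNode b)} (hl : IsReduced (simpleReflection b) l) :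
    nilAff b (genProd (simpleReflection b) l) = nilProd b l := by
  obtain ⟨hprod, hlen⟩ := Classical.epsilon_spec (p := fun l' : List (AffineNode b) =>
    wordProd b l' = genProd (simpleReflection b) l ∧
      l'.length = affLength b (genProd (simpleReflection b) l)) ⟨l, rfl, hl.symm⟩
  have hred : IsReduced (simpleReflection b) (reducedWord b (genProd (simpleReflection b) l)) :=
    (congr_arg (genLength (simpleReflection b)) hprod).trans hlen.symm
  exact (affine_rootedGenerators b).prod_map_eq_of_isReduced satisfiesBraidRelations_nilGen
    hred hl hprod

lemma nilAff_one : nilAff b 1 = 1 :=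
  nilAff_genProd (b := b) (l := []) (genLength_one _)

lemma nilAff_simpleReflection (j : AffineNode b) :
    nilAff b (simpleReflection b j) = nilGen b j := by
  have hred : IsReduced (simpleReflection b) [j] := by
    simpa [IsReduced] using (affine_rootedGenerators b).genLength_simple j
  simpa using nilAff_genProd hred

lemma nilAff_mul (hx : x ∈ affineWeyl P) (hy : y ∈ affineWeyl P)
    (h : affLength b (x * y) = affLength b x + affLength b y) :
    nilAff b x * nilAff b y = nilAff b (x * y) := by
  obtain ⟨l, hl, rfl⟩ := exists_reducedWord b hx
  obtain ⟨l', hl', rfl⟩ := exists_reducedWord b hy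
  have hred : IsReduced (simpleReflection b) (l ++ l') := by
    rw [IsReduced, genProd_append, List.length_append, ← hl, ← hl']
    exact h
  rw [nilAff_genProd hl, nilAff_genProd hl', ← nilProd_append, ← nilAff_genProd hred,
    genProd_append]

lemma nilGen_mul_nilAff_of_pos (hx : x ∈ affineWeyl P) {j : AffineNode b}
    (hp : IsPosAffRoot b (x⁻¹ • simpleAffRoot b j)) :
    nilGen b j * nilAff b x = nilAff b (simpleReflection b j * x) := by
  have hR := affine_rootedGenerators b
  rw [← nilAff_simpleReflection, nilAff_mul (simpleReflection_mem_affineWeyl j) hx]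
  have hlen := hR.genLength_simple_mul_of_pos ((mem_affineWeyl_iff_mem_closure b x).1 hx) hp
  exact (hlen.trans (add_comm _ _)).trans (congr_arg (· + _) (hR.genLength_simple j).symm)

lemma nilGen_mul_nilAff_of_not_pos (hx : x ∈ affineWeyl P) {j : AffineNode b}
    (hn : ¬ IsPosAffRoot b (x⁻¹ • simpleAffRoot b j)) :
    nilGen b j * nilAff b x = 0 := by
  have hR := affine_rootedGenerators b
  have hp : IsPosAffRoot b ((simpleReflection b j * x)⁻¹ • simpleAffRoot b j) := by
    rwa [mul_inv_rev, hR.inv_eq, hR.pos_mul_smul_simple]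
  rw [← hR.mul_cancel_left j x,
    ← nilGen_mul_nilAff_of_pos (mul_mem (simpleReflection_mem_affineWeyl j) hx) hp, ← mul_assoc,
    nilGen_mul_self, zero_mul]

lemma nilAff_mul_nilGen_of_pos (hx : x ∈ affineWeyl P) {j : AffineNode b}
    (hp : IsPosAffRoot b (x • simpleAffRoot b j)) :
    nilAff b x * nilGen b j = nilAff b (x * simpleReflection b j) := by
  have hR := affine_rootedGenerators b
  rw [← nilAff_simpleReflection, nilAff_mul hx (simpleReflection_mem_affineWeyl j)]
  have hlen := hR.genLength_mul_of_pos ((mem_affineWeyl_iff_mem_closure b x).1 hx) hp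
  exact hlen.trans (congr_arg (_ + ·) (hR.genLength_simple j).symm)

lemma nilAff_mul_nilGen_of_not_pos (hx : x ∈ affineWeyl P) {j : AffineNode b}
    (hn : ¬ IsPosAffRoot b (x • simpleAffRoot b j)) :
    nilAff b x * nilGen b j = 0 := by
  have hR := affine_rootedGenerators b
  have hp : IsPosAffRoot b ((x * simpleReflection b j) • simpleAffRoot b j) := by
    rwa [hR.pos_mul_smul_simple]
  rw [← hR.mul_cancel_right j x,
    ← nilAff_mul_nilGen_of_pos (mul_mem hx (simpleReflection_mem_affineWeyl j)) hp, mul_assoc,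
    nilGen_mul_self, mul_zero]

end Affine

section LengthZero

variable {x y z v : ExtWeyl P}

omit [P.IsReduced] in
lemma grp_mul_nilGen_of_smul {j k : AffineNode b}
    (h : x • simpleAffRoot b j = simpleAffRoot b k) :
    grp P x * nilGen b j = nilGen b k * grp P x :=
  grp_mul_rootInv_mul_one_sub_grp (congr_arg Prod.fst h) (mul_simpleReflection b h)

section

variable {σ : AffineNode b → AffineNode b}
  (hσ : ∀ j, x • simpleAffRoot b j = simpleAffRoot b (σ j))
include hσ

omit [P.IsReduced] in
lemma genProd_map_of_smul (l : List (AffineNode b)) : genProd (simpleReflection b) (l.map σ) =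
    x * genProd (simpleReflection b) l * x⁻¹ := by
  induction l with
  | nil => simp
  | cons j l ih =>
    rw [List.map_cons, genProd_cons, genProd_cons, ih, ← mul_assoc, ← mul_assoc, ← mul_assoc,
      mul_simpleReflection b (hσ j)]

omit [P.IsReduced] in
lemma grp_mul_nilProd_of_smul (l : List (AffineNode b)) :
    grp P x * nilProd b l = nilProd b (l.map σ) * grp P x := by
  induction l with
  | nil => simp
  | cons j l ih =>
    rw [List.map_cons, nilProd_cons, nilProd_cons, ← mul_assoc, grp_mul_nilGen_of_smul (hσ j),
      mul_assoc, ih, mul_assoc]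

end

lemma IsLengthZero.affLength_conj (hx : IsLengthZero b x) (hv : v ∈ affineWeyl P) :
    affLength b (x * v * x⁻¹) = affLength b v := by
  have conj_le : ∀ {x v}, IsLengthZero b x → v ∈ affineWeyl P →
      affLength b (x * v * x⁻¹) ≤ affLength b v := by
    intro x v hx hv
    obtain ⟨σ, hσ⟩ := hx.exists_perm
    obtain ⟨l, hl, rfl⟩ := exists_reducedWord b hv
    rw [← genProd_map_of_smul hσ]
    exact (genLength_genProd_le _ _).trans_eq ((List.length_map _).trans hl.symm)
  refine le_antisymm (conj_le hx hv) ?_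
  simpa [mul_assoc] using conj_le hx.inv (affineWeyl_normal.conj_mem v hv x)

lemma IsLengthZero.grp_mul_nilAff (hx : IsLengthZero b x) (hv : v ∈ affineWeyl P) :
    grp P x * nilAff b v = nilAff b (x * v * x⁻¹) * grp P x := by
  have hlen := hx.affLength_conj hv
  obtain ⟨σ, hσ⟩ := hx.exists_perm
  obtain ⟨l, hl, rfl⟩ := exists_reducedWord b hv
  rw [← genProd_map_of_smul hσ] at hlen ⊢
  have hred : IsReduced (simpleReflection b) (l.map σ) :=
    (hlen.trans hl).trans (List.length_map _).symm
  rw [nilAff_genProd hl, nilAff_genProd hred, grp_mul_nilProd_of_smul hσ]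

lemma IsLengthZero.nilExt_mul (hx : IsLengthZero b x) (hv : v ∈ affineWeyl P) :
    nilExt b (x * v) = grp P x * nilAff b v := by
  rw [nilExt, hx.decomp_mul hv]

omit [P.IsCrystallographic] [P.IsReduced] in
lemma isLengthZero_one : IsLengthZero b (1 : ExtWeyl P) := fun j => by
  rw [one_smul]
  exact isPosAffRoot_simpleAffRoot b j

lemma nilExt_of_mem (hv : v ∈ affineWeyl P) : nilExt b v = nilAff b v := by
  simpa [grp_one] using isLengthZero_one.nilExt_mul (b := b) hv

lemma IsLengthZero.grp_mul_nilExt (hx : IsLengthZero b x) (y : ExtWeyl P) :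
    grp P x * nilExt b y = nilExt b (x * y) := by
  obtain ⟨z, v, hz, hv, rfl⟩ := exists_eq_isLengthZero_mul b y
  rw [hz.nilExt_mul hv, ← mul_assoc, ← mul_assoc, grp_mul_grp, (hx.mul hz).nilExt_mul hv]

lemma IsLengthZero.exists_smul_eq_simpleAffRoot (hz : IsLengthZero b z) (j : AffineNode b) :
    ∃ k, z • simpleAffRoot b k = simpleAffRoot b j := by
  obtain ⟨σ, hσ⟩ := hz.exists_perm
  exact ⟨σ.symm j, by rw [hσ, σ.apply_symm_apply]⟩

lemma nilExt_mul_nilGen_of_pos {j : AffineNode b}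
    (hp : IsPosAffRoot b (x • simpleAffRoot b j)) :
    nilExt b x * nilGen b j = nilExt b (x * simpleReflection b j) := by
  obtain ⟨z, v, hz, hv, rfl⟩ := exists_eq_isLengthZero_mul b x
  rw [mul_smul, hz.isPosAffRoot_smul_iff] at hp
  rw [hz.nilExt_mul hv, mul_assoc, nilAff_mul_nilGen_of_pos hv hp, mul_assoc,
    hz.nilExt_mul (mul_mem hv (simpleReflection_mem_affineWeyl j))]

lemma nilExt_mul_nilGen_of_not_pos {j : AffineNode b}
    (hn : ¬ IsPosAffRoot b (x • simpleAffRoot b j)) :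
    nilExt b x * nilGen b j = 0 := by
  obtain ⟨z, v, hz, hv, rfl⟩ := exists_eq_isLengthZero_mul b x
  rw [mul_smul, hz.isPosAffRoot_smul_iff] at hn
  rw [hz.nilExt_mul hv, mul_assoc, nilAff_mul_nilGen_of_not_pos hv hn, mul_zero]

lemma nilGen_mul_nilExt_of_pos {j : AffineNode b}
    (hp : IsPosAffRoot b (x⁻¹ • simpleAffRoot b j)) :
    nilGen b j * nilExt b x = nilExt b (simpleReflection b j * x) := by
  obtain ⟨z, v, hz, hv, rfl⟩ := exists_eq_isLengthZero_mul b x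
  obtain ⟨k, hk⟩ := hz.exists_smul_eq_simpleAffRoot j
  rw [mul_inv_rev, mul_smul, ← hk, inv_smul_smul] at hp
  rw [hz.nilExt_mul hv, ← mul_assoc, ← grp_mul_nilGen_of_smul hk, mul_assoc,
    nilGen_mul_nilAff_of_pos hv hp, ← mul_assoc, ← mul_simpleReflection b hk, mul_assoc,
    hz.nilExt_mul (mul_mem (simpleReflection_mem_affineWeyl k) hv)]

lemma nilGen_mul_nilExt_of_not_pos {j : AffineNode b}
    (hn : ¬ IsPosAffRoot b (x⁻¹ • simpleAffRoot b j)) : nilGen b j * nilExt b x = 0 := by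
  obtain ⟨z, v, hz, hv, rfl⟩ := exists_eq_isLengthZero_mul b x
  obtain ⟨k, hk⟩ := hz.exists_smul_eq_simpleAffRoot j
  rw [mul_inv_rev, mul_smul, ← hk, inv_smul_smul] at hn
  rw [hz.nilExt_mul hv, ← mul_assoc, ← grp_mul_nilGen_of_smul hk, mul_assoc,
    nilGen_mul_nilAff_of_not_pos hv hn, mul_zero]

end LengthZero

end NilBasis

section NilHecke

variable {ι M N : Type*} [AddCommGroup M] [Module ℂ M] [AddCommGroup N] [Module ℂ N]
  {P : RootPairing ι ℂ M N} [P.IsRootSystem] {b : P.Base} [Finite ι] [P.IsIrreducible]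
  [P.IsCrystallographic] {a c : TwistedAlg P}

lemma nilExt_mem_nilHecke (x : ExtWeyl P) : nilExt b x ∈ nilHecke b :=
  Submodule.subset_span ⟨x, rfl⟩

lemma mul_mem_nilHecke_of_forall_nilExt (hnil : ∀ x, c * nilExt b x ∈ nilHecke b)
    (hscalar : ∀ f : SRing P, ∃ g h : SRing P, c * scalar P (algebraMap _ _ f) =
      scalar P (algebraMap _ _ g) * c + scalar P (algebraMap _ _ h))
    (ha : a ∈ nilHecke b) : c * a ∈ nilHecke b := by
  induction ha using Submodule.span_induction with
  | mem a h => obtain ⟨x, rfl⟩ := h; exact hnil x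
  | zero => simp
  | add x y _ _ hx hy => rw [mul_add]; exact add_mem hx hy
  | smul f x hx hcx =>
    obtain ⟨g, h, hf⟩ := hscalar f
    rw [smul_eq_scalar_mul, ← mul_assoc, hf, add_mul, mul_assoc]
    exact add_mem (scalar_mul_mem hcx g) (scalar_mul_mem hx h)

variable [P.IsReduced]

lemma nilGen_mul_mem_nilHecke (j : AffineNode b) (ha : a ∈ nilHecke b) :
    nilGen b j * a ∈ nilHecke b := by
  refine mul_mem_nilHecke_of_forall_nilExt (fun x => ?_)
    (fun f => ⟨_, exists_nilGen_mul_scalar j f⟩) ha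
  by_cases hp : IsPosAffRoot b (x⁻¹ • simpleAffRoot b j)
  · rw [nilGen_mul_nilExt_of_pos hp]
    exact nilExt_mem_nilHecke _
  · rw [nilGen_mul_nilExt_of_not_pos hp]
    exact zero_mem _

lemma nilProd_mul_mem_nilHecke (l : List (AffineNode b)) (ha : a ∈ nilHecke b) :
    nilProd b l * a ∈ nilHecke b := by
  induction l with
  | nil => simpa using ha
  | cons j l ih =>
    rw [nilProd_cons, mul_assoc]
    exact nilGen_mul_mem_nilHecke j ih

lemma IsLengthZero.grp_mul_mem_nilHecke {z : ExtWeyl P} (hz : IsLengthZero b z)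
    (ha : a ∈ nilHecke b) : grp P z * a ∈ nilHecke b := by
  refine mul_mem_nilHecke_of_forall_nilExt (fun x => ?_) (fun f => ⟨symAct P z.right f, 0, ?_⟩) ha
  · rw [hz.grp_mul_nilExt]
    exact nilExt_mem_nilHecke _
  · rw [grp_mul_scalar, ext_smul_algebraMap, map_zero, scalar_zero, add_zero]

lemma exists_nilExt_eq_grp_mul_nilProd (b : P.Base) (x : ExtWeyl P) :
    ∃ z l, IsLengthZero b z ∧ nilExt b x = grp P z * nilProd b l := by
  obtain ⟨z, v, hz, hv, rfl⟩ := exists_eq_isLengthZero_mul b x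
  obtain ⟨l, hl, rfl⟩ := exists_reducedWord b hv
  exact ⟨z, l, hz, by rw [hz.nilExt_mul hv, nilAff_genProd hl]⟩

lemma mul_mem_nilHecke (ha : a ∈ nilHecke b) (hc : c ∈ nilHecke b) : a * c ∈ nilHecke b := by
  induction ha using Submodule.span_induction with
  | mem a h =>
    obtain ⟨x, rfl⟩ := h
    obtain ⟨z, l, hz, heq⟩ := exists_nilExt_eq_grp_mul_nilProd b x
    rw [heq, mul_assoc]
    exact hz.grp_mul_mem_nilHecke (nilProd_mul_mem_nilHecke l hc)
  | zero => simp
  | add x y _ _ hx hy => rw [add_mul]; exact add_mem hx hy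
  | smul f x _ hx =>
    rw [smul_eq_scalar_mul, mul_assoc]
    exact scalar_mul_mem hx f

lemma one_mem_nilHecke (b : P.Base) : (1 : TwistedAlg P) ∈ nilHecke b := by
  simpa [nilExt_of_mem (one_mem _), nilAff_one] using nilExt_mem_nilHecke (b := b) 1

lemma scalar_mem_nilHecke (b : P.Base) (f : SRing P) :
    scalar P (algebraMap _ _ f) ∈ nilHecke b := by
  simpa using scalar_mul_mem (one_mem_nilHecke b) f

lemma nilGen_mem_nilHecke (j : AffineNode b) : nilGen b j ∈ nilHecke b := by
  simpa using nilGen_mul_mem_nilHecke j (one_mem_nilHecke b)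

lemma grp_mem_nilHecke (b : P.Base) (x : ExtWeyl P) : grp P x ∈ nilHecke b := by
  obtain ⟨z, v, hz, hv, rfl⟩ := exists_eq_isLengthZero_mul b x
  rw [← grp_mul_grp]
  apply hz.grp_mul_mem_nilHecke
  have hcl := (mem_affineWeyl_iff_mem_closure b v).1 hv
  clear hv
  induction hcl using Submonoid.closure_induction with
  | mem x hx =>
    obtain ⟨j, rfl⟩ := hx
    rw [grp_simpleReflection]
    exact sub_mem (one_mem_nilHecke b) (scalar_mul_mem (nilGen_mem_nilHecke j) _)
  | one => exact one_mem_nilHecke b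
  | mul x y _ _ hx hy =>
    rw [← grp_mul_grp]
    exact mul_mem_nilHecke hx hy

end NilHecke

section Projection

variable {ι M N : Type*} [AddCommGroup M] [Module ℂ M] [AddCommGroup N] [Module ℂ N]
  {P : RootPairing ι ℂ M N}

/-- The translation part `t_μ` of the element `t_μ u` of the extended affine Weyl group. -/
noncomputable def translationPart (x : ExtWeyl P) : ExtWeyl P := translation P x.left.toAdd

lemma translationPart_mul_ofWeyl (x : ExtWeyl P) (u : P.weylGroup) :
    translationPart (x * ofWeyl P u) = translationPart x := by
  simp [translationPart, ofWeyl]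

lemma translationPart_mul_translationPart (x y : ExtWeyl P) :
    translationPart (x * translationPart y) = translationPart (x * y) := by
  simp [translationPart, translation]

lemma translationPart_translationPart (x : ExtWeyl P) :
    translationPart (translationPart x) = translationPart x := rfl

lemma translationPart_eq_mul (x : ExtWeyl P) :
    translationPart x = x * (ofWeyl P x.right)⁻¹ :=
  eq_mul_inv_iff_mul_eq.2 (SemidirectProduct.inl_left_mul_inr_right x)

lemma translationPart_smul (x : ExtWeyl P) (f : SReg P) : translationPart x • f = f :=
  one_smul (ExtWeyl P) f

lemma translationPart_mul_comm (x y : ExtWeyl P) :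
    translationPart x * translationPart y = translationPart y * translationPart x := by
  simp only [translationPart, ← translation_add, add_comm]

variable (P) in
/-- The projection `f ⊗ t_μ u ↦ f ⊗ t_μ` of the twisted group algebra onto its commutative
subalgebra spanned by the translations. -/
noncomputable def proj : TwistedAlg P →+ TwistedAlg P :=
  SkewMonoidAlgebra.mapDomain translationPart

lemma proj_single (x : ExtWeyl P) (f : SReg P) :
    proj P (SkewMonoidAlgebra.single x f) = SkewMonoidAlgebra.single (translationPart x) f :=
  SkewMonoidAlgebra.mapDomain_single

lemma proj_one : proj P 1 = 1 := proj_single 1 1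

lemma proj_grp (x : ExtWeyl P) : proj P (grp P x) = grp P (translationPart x) := proj_single x 1

lemma proj_mul_grp_ofWeyl (a : TwistedAlg P) (u : P.weylGroup) :
    proj P (a * grp P (ofWeyl P u)) = proj P a := by
  have hcomp : (proj P).comp (AddMonoidHom.mulRight (grp P (ofWeyl P u))) = proj P := by
    refine SkewMonoidAlgebra.addHom_ext fun y f => ?_
    simp [grp, SkewMonoidAlgebra.single_mul_single, proj_single, translationPart_mul_ofWeyl]
  exact DFunLike.congr_fun hcomp a

lemma proj_proj (a : TwistedAlg P) : proj P (proj P a) = proj P a := by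
  have hcomp : (proj P).comp (proj P) = proj P := by
    refine SkewMonoidAlgebra.addHom_ext fun y f => ?_
    simp [proj_single, translationPart_translationPart]
  exact DFunLike.congr_fun hcomp a

lemma proj_scalar_mul (f : SReg P) (a : TwistedAlg P) :
    proj P (scalar P f * a) = scalar P f * proj P a := by
  have hcomp : (proj P).comp (AddMonoidHom.mulLeft (scalar P f)) =
      (AddMonoidHom.mulLeft (scalar P f)).comp (proj P) := by
    refine SkewMonoidAlgebra.addHom_ext fun y g => ?_
    simp [scalar, SkewMonoidAlgebra.single_mul_single, proj_single]
  exact DFunLike.congr_fun hcomp a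

lemma proj_mul_scalar (a : TwistedAlg P) (f : SReg P) :
    proj P a * scalar P f = scalar P f * proj P a := by
  have hcomp : (AddMonoidHom.mulRight (scalar P f)).comp (proj P) =
      (AddMonoidHom.mulLeft (scalar P f)).comp (proj P) := by
    refine SkewMonoidAlgebra.addHom_ext fun y g => ?_
    simp [scalar, SkewMonoidAlgebra.single_mul_single, proj_single, translationPart_smul, mul_comm]
  exact DFunLike.congr_fun hcomp a

lemma proj_mul_proj (a c : TwistedAlg P) : proj P (a * proj P c) = proj P (a * c) := by
  have hcomp : (AddMonoidHom.mul.compr₂ (proj P)).compl₂ (proj P) =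
      (AddMonoidHom.mul (R := TwistedAlg P)).compr₂ (proj P) := by
    refine SkewMonoidAlgebra.addHom_ext fun x f => SkewMonoidAlgebra.addHom_ext fun y g => ?_
    simp [SkewMonoidAlgebra.single_mul_single, proj_single, translationPart_mul_translationPart]
  exact DFunLike.congr_fun (DFunLike.congr_fun hcomp a) c

lemma commute_proj_proj (a c : TwistedAlg P) : Commute (proj P a) (proj P c) := by
  have hcomp : ((AddMonoidHom.mul (R := TwistedAlg P)).compl₂ (proj P)).comp (proj P) =
      ((AddMonoidHom.mul (R := TwistedAlg P)).flip.compl₂ (proj P)).comp (proj P) := by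
    refine SkewMonoidAlgebra.addHom_ext fun x f => SkewMonoidAlgebra.addHom_ext fun y g => ?_
    simp [SkewMonoidAlgebra.single_mul_single, proj_single, translationPart_smul,
      translationPart_mul_comm x y, mul_comm f g]
  exact DFunLike.congr_fun (DFunLike.congr_fun hcomp a) c

lemma proj_grp_mul_proj (x : ExtWeyl P) (a : TwistedAlg P) :
    proj P (grp P x * proj P a) = grp P x * proj P a * grp P (ofWeyl P x.right)⁻¹ := by
  have hcomp : (proj P).comp ((AddMonoidHom.mulLeft (grp P x)).comp (proj P)) =
      (AddMonoidHom.mulRight (grp P (ofWeyl P x.right)⁻¹)).comp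
        ((AddMonoidHom.mulLeft (grp P x)).comp (proj P)) := by
    refine SkewMonoidAlgebra.addHom_ext fun y g => ?_
    simp only [AddMonoidHom.comp_apply, proj_single, AddMonoidHom.coe_mulLeft,
      AddMonoidHom.coe_mulRight, grp, SkewMonoidAlgebra.single_mul_single,
      translationPart_eq_mul (x * translationPart y)]
    simp [translationPart, translation]
  exact DFunLike.congr_fun hcomp a

lemma proj_grp_mul_proj_eq_mul_conj (x : ExtWeyl P) (a : TwistedAlg P) :
    proj P (grp P x * proj P a) = grp P (translationPart x) * conj P x.right (proj P a) := by
  rw [proj_grp_mul_proj, conj, ← mul_assoc, ← mul_assoc, grp_mul_grp, translationPart_eq_mul,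
    inv_mul_cancel_right]

lemma conj_proj (u : P.weylGroup) (a : TwistedAlg P) :
    conj P u (proj P a) = proj P (grp P (ofWeyl P u) * proj P a) :=
  (proj_grp_mul_proj (ofWeyl P u) a).symm

lemma proj_mul_of_commute {p : TwistedAlg P} (hp : proj P p = p)
    (hW : ∀ u, Commute (grp P (ofWeyl P u)) p) (a : TwistedAlg P) :
    proj P (a * p) = proj P a * p := by
  have proj_grp_mul (x : ExtWeyl P) : proj P (grp P x * p) = grp P (translationPart x) * p := by
    have hx := proj_grp_mul_proj x p
    rw [hp] at hx
    rw [hx, translationPart_eq_mul, ← grp_mul_grp, ← map_inv, mul_assoc, mul_assoc, (hW _).eq]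
  have hcomp : (proj P).comp (AddMonoidHom.mulRight p) =
      (AddMonoidHom.mulRight p).comp (proj P) := by
    refine SkewMonoidAlgebra.addHom_ext fun x f => ?_
    simp only [AddMonoidHom.comp_apply, proj_single, AddMonoidHom.coe_mulRight]
    rw [single_eq_scalar_mul_grp, single_eq_scalar_mul_grp, mul_assoc, proj_scalar_mul,
      proj_grp_mul, mul_assoc]
  exact DFunLike.congr_fun hcomp a

lemma proj_eq_self {a : TwistedAlg P}
    (ha : ∀ m, Commute a (scalar P (regWeight P m))) : proj P a = a := by
  have hsupport (x : ExtWeyl P) (hx : a.coeff x ≠ 0) : translationPart x = x := by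
    have hright : x.right = 1 :=
      right_eq_of_mul_regWeight (fun μ => by rw [one_smul]; exact ha μ) hx
    rw [translationPart_eq_mul, hright, map_one, inv_one, mul_one]
  calc proj P a = a.sum fun x f => SkewMonoidAlgebra.single (translationPart x) f := rfl
    _ = a.sum fun x f => SkewMonoidAlgebra.single x f := by
      rw [SkewMonoidAlgebra.sum_def, SkewMonoidAlgebra.sum_def]
      refine Finset.sum_congr rfl fun x hx => ?_
      exact congr_arg (SkewMonoidAlgebra.single · _) (hsupport x (Finsupp.mem_support_iff.1 hx))
    _ = a := a.sum_single

end Projection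

section Schubert

open RootPairing

variable {ι M N : Type*} [AddCommGroup M] [Module ℂ M] [AddCommGroup N] [Module ℂ N]
  {P : RootPairing ι ℂ M N}

variable (P) in
/-- The divided difference element `α⁻¹ (1 - s_α)` attached to the root `α` with index `k`. -/
noncomputable def rootNil (k : ι) : TwistedAlg P :=
  scalar P (rootInv P k) * (1 - grp P (ofWeyl P (weylGroup.ofIdx P k)))

lemma grp_ofWeyl_mul_rootNil {u : P.weylGroup} {j k : ι} (h : u • P.root j = P.root k) :
    grp P (ofWeyl P u) * rootNil P j = rootNil P k * grp P (ofWeyl P u) :=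
  grp_mul_rootInv_mul_one_sub_grp h (by rw [← map_mul, mul_ofIdx h, map_mul])

lemma rootNil_reflectionPerm_self (k : ι) : rootNil P (P.reflectionPerm k k) = -rootNil P k := by
  rw [rootNil, rootNil, rootInv_reflectionPerm, ofIdx_reflectionPerm, ofIdx_mul_self, one_mul,
    scalar_neg, neg_mul]

lemma proj_mul_rootNil (a : TwistedAlg P) (k : ι) : proj P (a * rootNil P k) = 0 := by
  rw [rootNil, ← mul_assoc, mul_sub, mul_one, map_sub, proj_mul_grp_ofWeyl, sub_self]

variable [P.IsRootSystem] {b : P.Base} [Finite ι] [P.IsIrreducible] [P.IsCrystallographic]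

lemma simpleReflection_right (j : AffineNode b) :
    (simpleReflection b j).right = weylGroup.ofIdx P (nodeRoot b j) :=
  weyl_ext fun m => by rw [simpleReflection_right_smul, ofIdx_smul]

variable (b) in
/-- The `S`-span of the `A_v` for `v` outside `extGrassmannian b`, i.e. not of minimal length in
`v W`. -/
noncomputable def nonGrassSpan : Submodule (SRing P) (TwistedAlg P) :=
  Submodule.span (SRing P) (nilExt b '' (extGrassmannian b)ᶜ)

lemma nonGrassSpan_le_nilHecke : nonGrassSpan b ≤ nilHecke b :=
  Submodule.span_mono (Set.image_subset_range _ _)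

variable [P.IsReduced] {a c : TwistedAlg P}

lemma nilExt_mul_nilGen_mem_nonGrassSpan (x : ExtWeyl P) (j : b.support) :
    nilExt b x * nilGen b (some j) ∈ nonGrassSpan b := by
  by_cases hp : IsPosAffRoot b (x • simpleAffRoot b (some j))
  · rw [nilExt_mul_nilGen_of_pos hp]
    refine Submodule.subset_span ⟨_, fun h => ?_, rfl⟩
    exact ((affine_rootedGenerators b).pos_mul_smul_simple x (some j)).1
      (mem_extGrassmannian_iff.1 h j) hp
  · rw [nilExt_mul_nilGen_of_not_pos hp]
    exact zero_mem _

lemma mul_nilGen_mem_nonGrassSpan (ha : a ∈ nilHecke b) (j : b.support) :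
    a * nilGen b (some j) ∈ nonGrassSpan b := by
  induction ha using Submodule.span_induction with
  | mem a h => obtain ⟨x, rfl⟩ := h; exact nilExt_mul_nilGen_mem_nonGrassSpan x j
  | zero => simp
  | add x y _ _ hx hy => rw [add_mul]; exact add_mem hx hy
  | smul f x _ hx =>
    rw [smul_eq_scalar_mul, mul_assoc]
    exact scalar_mul_mem hx f

lemma exists_nilExt_eq_mul_nilGen {x : ExtWeyl P} (hx : x ∉ extGrassmannian b) :
    ∃ (y : ExtWeyl P) (j : b.support), nilExt b x = nilExt b y * nilGen b (some j) := by
  rw [mem_extGrassmannian_iff, IsGrassmannian, not_forall] at hx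
  obtain ⟨j, hj⟩ := hx
  refine ⟨x * simpleReflection b (some j), j, ?_⟩
  rw [nilExt_mul_nilGen_of_pos, (affine_rootedGenerators b).mul_cancel_right]
  rwa [(affine_rootedGenerators b).pos_mul_smul_simple]

lemma mul_mem_nonGrassSpan (ha : a ∈ nilHecke b) (hc : c ∈ nonGrassSpan b) :
    a * c ∈ nonGrassSpan b := by
  induction hc using Submodule.span_induction generalizing a with
  | mem c h =>
    obtain ⟨x, hx, rfl⟩ := h
    obtain ⟨y, k, hxy⟩ := exists_nilExt_eq_mul_nilGen hx
    rw [hxy, ← mul_assoc]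
    exact mul_nilGen_mem_nonGrassSpan (mul_mem_nilHecke ha (nilExt_mem_nilHecke y)) k
  | zero => simp
  | add x y _ _ hx hy => rw [mul_add]; exact add_mem (hx ha) (hy ha)
  | smul f x _ hx =>
    rw [smul_eq_scalar_mul, ← mul_assoc]
    exact hx (mul_mem_nilHecke ha (scalar_mem_nilHecke b f))

lemma mul_grp_ofWeyl_sub_mem_nonGrassSpan (ha : a ∈ nilHecke b) (u : P.weylGroup) :
    a * grp P (ofWeyl P u) - a ∈ nonGrassSpan b := by
  induction mem_closure_weylGen b u using Submonoid.closure_induction generalizing a with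
  | mem u hu =>
    obtain ⟨j, rfl⟩ := hu
    have hgrp : a * grp P (ofWeyl P (weylGen b j)) - a =
        -(a * scalar P (regWeight P (P.root j)) * nilGen b (some j)) := by
      rw [show ofWeyl P (weylGen b j) = simpleReflection b (some j) from rfl,
        grp_simpleReflection, mul_sub, mul_one, sub_sub_cancel_left, mul_assoc]
      rfl
    rw [hgrp]
    exact neg_mem (mul_nilGen_mem_nonGrassSpan
      (mul_mem_nilHecke ha (scalar_mem_nilHecke b (SymmetricAlgebra.ι ℂ M (P.root j)))) j)
  | one => simp [grp_one]
  | mul u w _ _ hu hw =>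
    rw [map_mul, ← grp_mul_grp, ← mul_assoc, ← sub_add_sub_cancel _ (a * grp P (ofWeyl P u))]
    exact add_mem (hw (mul_mem_nilHecke ha (grp_mem_nilHecke b _))) (hu ha)

lemma mul_grp_ofWeyl_mem_nonGrassSpan (ha : a ∈ nonGrassSpan b) (u : P.weylGroup) :
    a * grp P (ofWeyl P u) ∈ nonGrassSpan b := by
  simpa using add_mem (mul_grp_ofWeyl_sub_mem_nonGrassSpan (nonGrassSpan_le_nilHecke ha) u) ha

lemma proj_eq_zero_of_mem_nonGrassSpan (ha : a ∈ nonGrassSpan b) : proj P a = 0 := by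
  induction ha using Submodule.span_induction with
  | mem a h =>
    obtain ⟨x, hx, rfl⟩ := h
    obtain ⟨y, k, hxy⟩ := exists_nilExt_eq_mul_nilGen hx
    rw [hxy]
    exact proj_mul_rootNil _ _
  | zero => simp
  | add x y _ _ hx hy => rw [map_add, hx, hy, add_zero]
  | smul f x _ hx => rw [smul_eq_scalar_mul, proj_scalar_mul, hx, mul_zero]

lemma rootNil_mem_nonGrassSpan (b : P.Base) (k : ι) : rootNil P k ∈ nonGrassSpan b := by
  induction k using b.induction_reflect with
  | h₀ k hk =>
    rw [rootNil_reflectionPerm_self]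
    exact neg_mem hk
  | h₁ j hj =>
    rw [← one_mul (rootNil P j)]
    exact mul_nilGen_mem_nonGrassSpan (one_mem_nilHecke b) ⟨j, hj⟩
  | h₂ k j hk _ =>
    have hconj := grp_ofWeyl_mul_rootNil (P := P) (ofIdx_smul_root j k)
    rw [← mul_one (rootNil P (P.reflectionPerm j k)), ← grp_one,
      ← mul_inv_cancel (ofWeyl P (weylGroup.ofIdx P j)), ← grp_mul_grp, ← mul_assoc, ← hconj,
      ← map_inv]
    exact mul_grp_ofWeyl_mem_nonGrassSpan (mul_mem_nonGrassSpan (grp_mem_nilHecke b _) hk) _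

omit [P.IsReduced] in
lemma proj_nilGen_mul_proj (j : AffineNode b) (a : TwistedAlg P) :
    proj P (nilGen b j * proj P a) = nilGen b j * proj P a -
      grp P (simpleReflection b j) * proj P a * rootNil P (nodeRoot b j) := by
  have hright : (ofWeyl P (simpleReflection b j).right)⁻¹ =
      ofWeyl P (weylGroup.ofIdx P (nodeRoot b j)) := by
    rw [simpleReflection_right, ← map_inv, inv_eq_of_mul_eq_one_right (ofIdx_mul_self _)]
  have hscalar : grp P (simpleReflection b j) * proj P a * scalar P (rootInv P (nodeRoot b j)) =
      -(scalar P (rootInv P (nodeRoot b j)) * (grp P (simpleReflection b j) * proj P a)) := by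
    rw [mul_assoc, proj_mul_scalar, ← mul_assoc, grp_mul_scalar, simpleReflection_smul_rootInv,
      scalar_neg, neg_mul, neg_mul, mul_assoc]
  rw [rootNil, ← mul_assoc, hscalar, nilGen, mul_assoc, proj_scalar_mul, sub_mul, one_mul, map_sub,
    proj_proj, proj_grp_mul_proj, hright]
  noncomm_ring

lemma proj_nilProd (l : List (AffineNode b)) : proj P (nilProd b l) ∈ nilHecke b ∧
    proj P (nilProd b l) - nilProd b l ∈ nonGrassSpan b := by
  induction l with
  | nil =>
    rw [nilProd_nil, proj_one, sub_self]
    exact ⟨one_mem_nilHecke b, zero_mem _⟩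
  | cons j l ih =>
    have herror : grp P (simpleReflection b j) * proj P (nilProd b l) *
        rootNil P (nodeRoot b j) ∈ nonGrassSpan b :=
      mul_mem_nonGrassSpan (mul_mem_nilHecke (grp_mem_nilHecke b _) ih.1)
        (rootNil_mem_nonGrassSpan b _)
    rw [nilProd_cons, ← proj_mul_proj, proj_nilGen_mul_proj]
    refine ⟨sub_mem (nilGen_mul_mem_nilHecke j ih.1) (nonGrassSpan_le_nilHecke herror), ?_⟩
    rw [sub_right_comm, ← mul_sub]
    exact sub_mem (mul_mem_nonGrassSpan (nilGen_mem_nilHecke j) ih.2) herror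

lemma proj_nilExt (b : P.Base) (x : ExtWeyl P) : proj P (nilExt b x) ∈ nilHecke b ∧
    proj P (nilExt b x) - nilExt b x ∈ nonGrassSpan b := by
  obtain ⟨z, l, -, heq⟩ := exists_nilExt_eq_grp_mul_nilProd b x
  obtain ⟨hmem, hsub⟩ := proj_nilProd l
  have hz : grp P z * proj P (nilProd b l) ∈ nilHecke b :=
    mul_mem_nilHecke (grp_mem_nilHecke b z) hmem
  rw [heq, ← proj_mul_proj, proj_grp_mul_proj, ← map_inv]
  refine ⟨mul_mem_nilHecke hz (grp_mem_nilHecke b _), ?_⟩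
  rw [← sub_add_sub_cancel _ (grp P z * proj P (nilProd b l)), ← mul_sub]
  exact add_mem (mul_grp_ofWeyl_sub_mem_nonGrassSpan hz _)
    (mul_mem_nonGrassSpan (grp_mem_nilHecke b z) hsub)

lemma isSchubert_proj_nilExt (b : P.Base) (w : ExtWeyl P) :
    IsSchubert b w (proj P (nilExt b w)) :=
  ⟨⟨(proj_nilExt b w).1, fun _ => proj_mul_scalar _ _⟩, (proj_nilExt b w).2⟩

lemma IsSchubert.eq_proj_nilExt {w : ExtWeyl P} (ha : IsSchubert b w a) :
    a = proj P (nilExt b w) := by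
  have hproj := proj_eq_zero_of_mem_nonGrassSpan ha.2
  rwa [map_sub, sub_eq_zero, proj_eq_self fun m => ha.1.2 _] at hproj

lemma existsUnique_isSchubert (b : P.Base) (w : ExtWeyl P) : ∃! a, IsSchubert b w a :=
  ⟨_, isSchubert_proj_nilExt b w, fun _ h => h.eq_proj_nilExt⟩

lemma jElt_eq_proj_nilExt (b : P.Base) (w : ExtWeyl P) : jElt b w = proj P (nilExt b w) :=
  (Classical.epsilon_spec (existsUnique_isSchubert b w).exists).eq_proj_nilExt

end Schubert

section Factorization

open RootPairing

variable {ι M N : Type*} [AddCommGroup M] [Module ℂ M] [AddCommGroup N] [Module ℂ N]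
  {P : RootPairing ι ℂ M N}

lemma commute_grp_ofIdx {p : TwistedAlg P} (hp : proj P p = p) {k : ι}
    (h : proj P (rootNil P k * p) = 0) : Commute (grp P (ofWeyl P (weylGroup.ofIdx P k))) p := by
  set s := ofWeyl P (weylGroup.ofIdx P k)
  have hconj : proj P (grp P s * p) = grp P s * p * grp P s⁻¹ := by
    have := proj_grp_mul_proj s p
    rw [hp] at this
    exact this
  have hsub : p - proj P (grp P s * p) = 0 := calc
    p - proj P (grp P s * p) = scalar P (regWeight P (P.root k)) * proj P (rootNil P k * p) := by
      rw [rootNil, mul_assoc, proj_scalar_mul, ← mul_assoc, scalar_mul_scalar,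
        mul_comm (regWeight _ _), rootInv_mul_regWeight, scalar_one, one_mul, sub_mul, one_mul,
        map_sub, hp]
    _ = 0 := by rw [h, mul_zero]
  rw [hconj, sub_eq_zero] at hsub
  calc grp P s * p = grp P s * p * grp P s⁻¹ * grp P s := by
        rw [mul_assoc, grp_mul_grp, inv_mul_cancel, grp_one, mul_one]
    _ = p * grp P s := by rw [← hsub]

variable [P.IsRootSystem] {b : P.Base}

lemma proj_grp_piElt_mul (s : AffineNode b) (a : TwistedAlg P) :
    proj P (grp P (piElt b s) * a) =
      grp P (translationPart (piElt b s)) * conj P (uElt b s) (proj P a) := by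
  rw [← proj_mul_proj, proj_grp_mul_proj_eq_mul_conj, piElt_right]

variable [Finite ι] [P.IsIrreducible]

lemma not_isPosAffRoot_translation_neg_fundCoweight_inv_smul (i : b.support) :
    ¬ IsPosAffRoot b
      ((translation P (-fundCoweight b (some i)))⁻¹ • simpleAffRoot b (some i)) := by
  have hsmul := translation_zsmul_fundCoweight_smul 1 i i
  rw [one_zsmul, if_pos rfl] at hsmul
  rw [translation_neg, inv_inv, hsmul, isPosAffRoot_affRoot_iff]
  omega

lemma bar_mem_affineWeyl (i : b.support) {v : ExtWeyl P} (hv : v ∈ affineWeyl P) :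
    bar b i v ∈ affineWeyl P := by
  simpa [bar] using affineWeyl_normal.conj_mem v hv (piElt b (specialNode b i))⁻¹

lemma mul_kappa (i : b.support) (v : ExtWeyl P) : v * kappa b i =
    piElt b (specialNode b i) * (bar b i v * translation P (-fundCoweight b (some i))) := by
  simp [kappa, bar, mul_assoc]

variable [P.IsCrystallographic] [P.IsReduced]

omit [P.IsRootSystem] [P.IsIrreducible] in
lemma commute_grp_ofWeyl {p : TwistedAlg P} (hp : proj P p = p)
    (h : ∀ j : b.support, proj P (rootNil P j * p) = 0) (u : P.weylGroup) :
    Commute (grp P (ofWeyl P u)) p := by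
  induction mem_closure_weylGen b u using Submonoid.closure_induction with
  | mem u hu => obtain ⟨j, rfl⟩ := hu; exact commute_grp_ofIdx hp (h j)
  | one => rw [map_one, grp_one]; exact Commute.one_left p
  | mul u w _ _ hu hw => rw [map_mul, ← grp_mul_grp]; exact hu.mul_left hw

lemma commute_proj_nilExt_translation (i : b.support) (u : P.weylGroup) :
    Commute (grp P (ofWeyl P u))
      (proj P (nilExt b (translation P (-fundCoweight b (some i))))) := by
  refine commute_grp_ofWeyl (b := b) (proj_proj _) (fun j => ?_) u
  rw [proj_mul_proj]
  change proj P (nilGen b (some j) * _) = 0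
  rcases eq_or_ne j i with rfl | hj
  · rw [nilGen_mul_nilExt_of_not_pos (not_isPosAffRoot_translation_neg_fundCoweight_inv_smul j),
      map_zero]
  · have hfix := translation_neg_fundCoweight_smul_of_ne hj
    have hpos := isPosAffRoot_simpleAffRoot b (some j)
    rw [nilGen_mul_nilExt_of_pos (by rwa [← hfix, inv_smul_smul]), ← mul_simpleReflection b hfix,
      ← nilExt_mul_nilGen_of_pos (by rwa [hfix])]
    exact proj_mul_rootNil _ _

lemma proj_mul_nilExt_translation (i : b.support) (a : TwistedAlg P) :
    proj P (a * nilExt b (translation P (-fundCoweight b (some i)))) =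
      proj P a * proj P (nilExt b (translation P (-fundCoweight b (some i)))) := by
  rw [← proj_mul_proj]
  exact proj_mul_of_commute (proj_proj _) (commute_proj_nilExt_translation i) a

variable {v : ExtWeyl P}

lemma bar_mem_affGrassmannian (i : b.support) (hv : v ∈ affineWeyl P)
    (hκ : v * kappa b i ∈ affGrassmannian b)
    (hlen : affLength b (v * kappa b i) = affLength b v + affLength b (kappa b i)) :
    bar b i v ∈ affGrassmannian b := by
  have hπ := isLengthZero_piElt_specialNode i
  refine mem_affGrassmannian_iff.2 ⟨bar_mem_affineWeyl i hv, fun j => ?_⟩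
  rcases eq_or_ne j i with rfl | hj
  · obtain ⟨k, hk⟩ := hπ.exists_smul_simpleAffRoot_eq (some j)
    have hκ_neg : ¬ IsPosAffRoot b ((kappa b j)⁻¹ • simpleAffRoot b k) := by
      rw [kappa, mul_inv_rev, mul_smul, ← hk, inv_smul_smul]
      exact not_isPosAffRoot_translation_neg_fundCoweight_inv_smul j
    have hv_pos := (affine_rootedGenerators b).pos_smul_simple_of_genLength_mul
      ((mem_affineWeyl_iff_mem_closure b v).1 hv)
      ((mem_affineWeyl_iff_mem_closure b _).1 (kappa_mem_affineWeyl j)) hlen hκ_neg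
    rwa [← hπ.isPosAffRoot_smul_iff, bar, mul_smul, mul_smul, smul_inv_smul, hk]
  · have hpos := (mem_affGrassmannian_iff.1 hκ).2 j
    rwa [mul_kappa, mul_smul, hπ.isPosAffRoot_smul_iff, mul_smul,
      translation_neg_fundCoweight_smul_of_ne hj] at hpos

lemma nilAff_mul_grp_piElt (i : b.support) (hv : v ∈ affineWeyl P) :
    nilAff b v * grp P (piElt b (specialNode b i)) =
      grp P (piElt b (specialNode b i)) * nilAff b (bar b i v) := by
  rw [(isLengthZero_piElt_specialNode i).grp_mul_nilAff (bar_mem_affineWeyl i hv)]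
  simp [bar, mul_assoc]

lemma nilExt_kappa (i : b.support) : nilExt b (kappa b i) =
    grp P (piElt b (specialNode b i)) * nilExt b (translation P (-fundCoweight b (some i))) :=
  ((isLengthZero_piElt_specialNode i).grp_mul_nilExt _).symm

lemma nilExt_mul_kappa (i : b.support) (hv : v ∈ affineWeyl P)
    (hlen : affLength b (v * kappa b i) = affLength b v + affLength b (kappa b i)) :
    nilExt b (v * kappa b i) = grp P (piElt b (specialNode b i)) *
      (nilExt b (bar b i v) * nilExt b (translation P (-fundCoweight b (some i)))) := by
  have hκ := kappa_mem_affineWeyl i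
  rw [nilExt_of_mem (mul_mem hv hκ), ← nilAff_mul hv hκ hlen, ← nilExt_of_mem hκ, nilExt_kappa,
    ← mul_assoc, nilAff_mul_grp_piElt i hv, mul_assoc, nilExt_of_mem (bar_mem_affineWeyl i hv)]

lemma jElt_mul_kappa (i : b.support) (hv : v ∈ affineWeyl P)
    (hlen : affLength b (v * kappa b i) = affLength b v + affLength b (kappa b i)) :
    jElt b (v * kappa b i) =
      conj P (uElt b (specialNode b i)) (jElt b (bar b i v)) * jElt b (kappa b i) := by
  set u := uElt b (specialNode b i)
  set t := translationPart (piElt b (specialNode b i)) with ht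
  set q := proj P (nilExt b (translation P (-fundCoweight b (some i))))
  have jElt_kappa : jElt b (kappa b i) = grp P t * conj P u q := by
    rw [jElt_eq_proj_nilExt, nilExt_kappa, proj_grp_piElt_mul]
  have hcomm : Commute (grp P t) (conj P u (jElt b (bar b i v))) := by
    rw [ht, ← proj_grp, jElt_eq_proj_nilExt, conj_proj]
    exact commute_proj_proj _ _
  calc jElt b (v * kappa b i)
      = grp P t * conj P u (jElt b (bar b i v) * q) := by
        rw [jElt_eq_proj_nilExt, nilExt_mul_kappa i hv hlen, proj_grp_piElt_mul,
          proj_mul_nilExt_translation, jElt_eq_proj_nilExt]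
    _ = conj P u (jElt b (bar b i v)) * jElt b (kappa b i) := by
        rw [conj_mul, ← mul_assoc, hcomm.eq, mul_assoc, jElt_kappa]

end Factorization

end AffineNilHecke

/-- Factorization of the Schubert class of `v κ_i` in the extended Peterson algebra. The first
four clauses say that `i^s`, `u_{i^s}`, `κ_i` and the Schubert basis are well defined. -/
theorem mainTheorem9 {ι M N : Type*} [Finite ι] [AddCommGroup M] [Module ℂ M]
    [AddCommGroup N] [Module ℂ N] (P : RootPairing ι ℂ M N)
    [P.IsRootSystem] [P.IsCrystallographic] [P.IsReduced] [P.IsIrreducible]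
    (b : P.Base) (i : b.support) :
    (∃! s, IsSpecialFor b i s) ∧
    (∃! u, IsShortestAntidominant b (specialNode b i) u) ∧
    kappa b i ∈ affGrassmannian b ∧
    (∀ w ∈ extGrassmannian b, ∃! a, IsSchubert b w a) ∧
    ∀ v ∈ affineWeyl P,
      v * kappa b i ∈ affGrassmannian b →
      affLength b (v * kappa b i) = affLength b v + affLength b (kappa b i) →
        bar b i v ∈ affGrassmannian b ∧
        jElt b (v * kappa b i) =
          conj P (uElt b (specialNode b i)) (jElt b (bar b i v)) * jElt b (kappa b i) := by
  refine ⟨existsUnique_isSpecialFor i, existsUnique_isShortestAntidominant _,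
    kappa_mem_affGrassmannian i, fun w _ => existsUnique_isSchubert b w, ?_⟩
  intro v hv hκ hlen
  exact ⟨bar_mem_affGrassmannian i hv hκ hlen, jElt_mul_kappa i hv hlen⟩
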